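/- Superalgebras are over $\mathbb{C}$. For a commutative superalgebra $A=A_0\oplus A_1$ let $\mathfrak{gl}_{m|n}(A)$ be the algebra of even supermatrices $M=\begin{pmatrix}p&q\\ r&s\end{pmatrix}$ ($p$ of size $m\times m$ and $s$ of size $n\times n$ with entries in $A_0$; $q,r$ with entries in $A_1$), and let $GL_{m|n}(A)$ be its group of units. Put $\mathrm{str}\,M=\mathrm{tr}\,p-\mathrm{tr}\,s$, $\mathrm{Ber}\,M=\det(p-qs^{-1}r)\det(s^{-1})$, $M^{st}=\begin{pmatrix}p^{T}&r^{T}\\-q^{T}&s^{T}\end{pmatrix}$. For $n$ even let $J$ be the matrix of the standard nondegenerate bilinear form on $\mathbb{C}^{m|n}$, symmetric on $\mathbb{C}^m$ and alternating on $\mathbb{C}^n$. Let $(G,\mathfrak g)$ be one of the following pairs, in which the Cartan–Killing form of $\mathfrak g$ is nondegenerate: (a) $m\neq n$, $G(A)=SL_{m|n}(A)=\{g\in GL_{m|n}(A):\mathrm{Ber}\,g=1\}$, $\mathfrak g(A)=\mathfrak{sl}_{m|n}(A)=\{X\in\mathfrak{gl}_{m|n}(A):\mathrm{str}\,X=0\}$;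 (b) $n$ even, $m-n\neq 2$, $G(A)=OSp_{m|n}(A)=\{g\in GL_{m|n}(A): g^{st}Jg=J\}$, $\mathfrak g(A)=\mathfrak{osp}_{m|n}(A)=\{X\in\mathfrak{gl}_{m|n}(A):X^{st}J+JX=0\}$. Let $\mathbb{C}[\mathfrak g]$ be the superalgebra representing $\mathfrak g$, i.e. the free commutative superalgebra on the entries of an even supermatrix modulo the above linear equations, and let $\mathbb{C}[\mathfrak g^\circ]$ be its quotient by the ideal generated by the odd elements. A polynomial $\hat p\in\mathbb{C}[\mathfrak g]$ is invariant if $\hat p(gXg^{-1})=\hat p(X)$ for every commutative superalgebra $A$, $g\in G(A)$, $X\in\mathfrak g(A)$. Theorem. Let $X_0\in\mathfrak g(\mathbb{C})$ have $m+n$ distinct eigenvalues (so that it is regular semisimple). Let $\hat p_1,\dots,\hat p_l\in\mathbb{C}[\mathfrak g]$ be invariant polynomials, $p_i$ the image of $\hat p_i$ in $\mathbb{C}[\mathfrak g^\circ]$, $c_i=\hat p_i(X_0)=p_i(X_0)$, and suppose that $(p_1-c_1,\dots,p_l-c_l)$ is the ideal of all elements of $\mathbb{C}[\mathfrak g^\circ]$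 that vanish on the orbit $\{gX_0g^{-1}: g\in G(\mathbb{C})\}$. Consider the functor from commutative superalgebras to sets $$\mathcal C_{X_0}(A)=\{\mathrm{Ad}_gX_0=gX_0g^{-1}: g\in G(A)\}\subset\mathfrak g(A)$$ (through the isomorphism $\mathfrak g\simeq\mathfrak g^*$ given by the Cartan–Killing form it is the coadjoint orbit functor). Then the sheafification of $\mathcal C_{X_0}$ is representable, by the superalgebra $$A_{X_0}=\mathbb{C}[\mathfrak g]/(\hat p_1-c_1,\dots,\hat p_l-c_l).$$ More precisely, the natural transformation $\mathcal C_{X_0}\to\mathrm{Hom}(A_{X_0},-)$ that sends $Y\in\mathcal C_{X_0}(A)$ to evaluation at $Y$ is well defined, its target is a local functor, and it is universal among natural transformations from $\mathcal C_{X_0}$ to local functors. Here a functor $F$ from commutative superalgebras to sets is local if for every $A$ and all $f_1,\dots,f_s\in A_0$ that generate the unit ideal the diagram $F(A)\to\prod_iF(A_{f_i})\rightrightarrows\prod_{i,j}F(A_{f_if_j})$ is exact. -/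

import Mathlib

open CategoryTheory

noncomputable section

namespace SuperOrbit

/-- A commutative superalgebra over `ℂ`: an associative unital algebra `A = A₀ ⊕ A₁` with
`AᵢAⱼ ⊆ Aᵢ₊ⱼ` and `ab = (-1)^{|a||b|} ba` for homogeneous `a`, `b`. -/
structure SuperAlg where
  carrier : Type
  [ring : Ring carrier]
  [algebra : Algebra ℂ carrier]
  even : Subalgebra ℂ carrier
  odd : Submodule ℂ carrier
  isCompl : IsCompl (Subalgebra.toSubmodule even) odd
  even_mul_odd : ∀ a ∈ even, ∀ b ∈ odd, a * b ∈ odd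
  odd_mul_odd : ∀ a ∈ odd, ∀ b ∈ odd, a * b ∈ even
  even_comm : ∀ a ∈ even, ∀ b, a * b = b * a
  odd_anticomm : ∀ a ∈ odd, ∀ b ∈ odd, a * b = -(b * a)

namespace SuperAlg

instance : CoeSort SuperAlg Type := ⟨SuperAlg.carrier⟩

instance (A : SuperAlg) : Ring A := A.ring

instance (A : SuperAlg) : Algebra ℂ A := A.algebra

instance (A : SuperAlg) : CommRing A.even :=
  { (inferInstance : Ring A.even) with
    mul_comm := fun a b => Subtype.ext (A.even_comm a a.2 b) }

/-- The projection `A → A₀` along `A₁`. -/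
def ev (A : SuperAlg) : A →ₗ[ℂ] A.even :=
  Submodule.projectionOnto (Subalgebra.toSubmodule A.even) A.odd A.isCompl

theorem ev_even (A : SuperAlg) (a : A.even) : A.ev a = a :=
  Submodule.projectionOnto_apply_left A.isCompl a

theorem ev_odd (A : SuperAlg) {a : A} (h : a ∈ A.odd) : A.ev a = 0 :=
  Submodule.projectionOnto_apply_right A.isCompl ⟨a, h⟩

theorem exists_add (A : SuperAlg) (a : A) :
    ∃ b ∈ A.even, ∃ c ∈ A.odd, a = b + c := by
  obtain ⟨b, hb, c, hc, h⟩ := Submodule.mem_sup.1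
    (A.isCompl.sup_eq_top ▸ Submodule.mem_top :
      a ∈ Subalgebra.toSubmodule A.even ⊔ A.odd)
  exact ⟨b, hb, c, hc, h.symm⟩

theorem sub_ev_mem (A : SuperAlg) (a : A) : a - A.ev a ∈ A.odd := by
  obtain ⟨b, hb, c, hc, rfl⟩ := A.exists_add a
  have h1 := A.ev_even ⟨b, hb⟩
  simp only at h1
  rw [map_add, h1, A.ev_odd hc]
  simpa using hc

theorem odd_mul_even (A : SuperAlg) {a b : A} (ha : a ∈ A.odd) (hb : b ∈ A.even) :
    a * b ∈ A.odd := by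
  rw [← A.even_comm b hb a]
  exact A.even_mul_odd b hb a ha

/-- A morphism of superalgebras: a unital algebra homomorphism that preserves parity. -/
@[ext]
structure Hom (A B : SuperAlg) where
  toAlgHom : A →ₐ[ℂ] B
  map_even : ∀ a ∈ A.even, toAlgHom a ∈ B.even
  map_odd : ∀ a ∈ A.odd, toAlgHom a ∈ B.odd

/-- The category of commutative superalgebras over `ℂ`. -/
instance : Category SuperAlg where
  Hom A B := Hom A B
  id A := ⟨AlgHom.id ℂ A, fun _ h => h, fun _ h => h⟩
  comp f g := ⟨g.toAlgHom.comp f.toAlgHom,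
    fun a h => g.map_even _ (f.map_even a h), fun a h => g.map_odd _ (f.map_odd a h)⟩

/-- The underlying algebra homomorphism of a morphism. -/
def hom {A B : SuperAlg} (φ : A ⟶ B) : A →ₐ[ℂ] B := Hom.toAlgHom φ

theorem hom_even {A B : SuperAlg} (φ : A ⟶ B) {a : A} (h : a ∈ A.even) : hom φ a ∈ B.even :=
  Hom.map_even φ a h

theorem hom_odd {A B : SuperAlg} (φ : A ⟶ B) {a : A} (h : a ∈ A.odd) : hom φ a ∈ B.odd :=
  Hom.map_odd φ a h

theorem hom_ext {A B : SuperAlg} {φ ψ : A ⟶ B} (h : hom φ = hom ψ) : φ = ψ :=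
  Hom.ext h

theorem hom_comp {A B C : SuperAlg} (φ : A ⟶ B) (ψ : B ⟶ C) :
    hom (φ ≫ ψ) = (hom ψ).comp (hom φ) := rfl

theorem hom_id (A : SuperAlg) : hom (𝟙 A) = AlgHom.id ℂ A := rfl

/-- The restriction `A₀ → B₀` of a morphism. -/
def evenHom {A B : SuperAlg} (φ : A ⟶ B) : A.even →+* B.even where
  toFun a := ⟨hom φ (a : A), hom_even φ a.2⟩
  map_one' := Subtype.ext (map_one (hom φ))
  map_mul' a b := Subtype.ext (map_mul (hom φ) (a : A) (b : A))
  map_zero' := Subtype.ext (map_zero (hom φ))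
  map_add' a b := Subtype.ext (map_add (hom φ) (a : A) (b : A))

theorem evenHom_ev {A B : SuperAlg} (φ : A ⟶ B) (a : A) :
    evenHom φ (A.ev a) = B.ev (hom φ a) := by
  obtain ⟨b, hb, c, hc, rfl⟩ := A.exists_add a
  have h1 := A.ev_even ⟨b, hb⟩
  have h2 := B.ev_even ⟨hom φ b, hom_even φ hb⟩
  simp only at h1 h2
  rw [map_add (hom φ), map_add A.ev, map_add B.ev, h1, A.ev_odd hc, h2,
    B.ev_odd (hom_odd φ hc), add_zero, add_zero]
  rfl

/-- `ℂ`, as a superalgebra without odd elements. -/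
def base : SuperAlg where
  carrier := ℂ
  even := ⊤
  odd := ⊥
  isCompl := by simpa using isCompl_top_bot
  even_mul_odd := by simp
  odd_mul_odd := by simp
  even_comm a _ b := mul_comm a b
  odd_anticomm := by simp

/-- The structure morphism `ℂ → A`. -/
def unit (A : SuperAlg) : base ⟶ A where
  toAlgHom := Algebra.ofId ℂ A
  map_even a _ := A.even.algebraMap_mem a
  map_odd a h := by
    have h0 : a = (0 : ℂ) := h
    subst h0
    have h1 : Algebra.ofId ℂ A 0 = 0 := map_zero _
    exact (congrArg (· ∈ A.odd) h1).mpr A.odd.zero_mem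

theorem unit_comp {A B : SuperAlg} (φ : A ⟶ B) : unit A ≫ φ = unit B :=
  hom_ext (Subsingleton.elim (α := ℂ →ₐ[ℂ] B) _ _)

/-- The superalgebra given by an algebra with an involution `σ`: the even part is
`{a | σ a = a}` and the odd part is `{a | σ a = -a}`. -/
def ofInvolution (R : Type) [Ring R] [Algebra ℂ R] (σ : R →ₐ[ℂ] R) (hσ : ∀ a, σ (σ a) = a)
    (h0 : ∀ a b, (a + σ a) * b = b * (a + σ a))
    (h1 : ∀ a b, (a - σ a) * (b - σ b) = -((b - σ b) * (a - σ a))) : SuperAlg where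
  carrier := R
  even := AlgHom.equalizer σ (AlgHom.id ℂ R)
  odd := LinearMap.ker (σ.toLinearMap + LinearMap.id)
  isCompl := by
    constructor
    · rw [Submodule.disjoint_def]
      intro x hx hy
      have h2 : σ x = x := hx
      have h3 : σ x + x = 0 := hy
      rw [h2, ← two_smul ℂ] at h3
      exact (smul_eq_zero.1 h3).resolve_left two_ne_zero
    · rw [codisjoint_iff, eq_top_iff]
      intro x _
      refine Submodule.mem_sup.2 ⟨(2⁻¹ : ℂ) • (x + σ x), ?_, (2⁻¹ : ℂ) • (x - σ x), ?_, ?_⟩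
      · change σ _ = _
        rw [map_smul, map_add, hσ, add_comm]
        rfl
      · change σ _ + ((2⁻¹ : ℂ) • (x - σ x)) = 0
        rw [map_smul, map_sub, hσ, ← smul_add]
        simp
      · rw [← smul_add, add_add_sub_cancel, ← two_smul ℂ, smul_smul]
        norm_num
  even_mul_odd a ha b hb := by
    have h2 : σ a = a := ha
    have h3 : σ b + b = 0 := hb
    change σ (a * b) + a * b = 0
    rw [map_mul, h2, ← mul_add, h3, mul_zero]
  odd_mul_odd a ha b hb := by
    have h2 : σ a = -a := eq_neg_of_add_eq_zero_left ha
    have h3 : σ b = -b := eq_neg_of_add_eq_zero_left hb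
    change σ (a * b) = a * b
    rw [map_mul, h2, h3, neg_mul_neg]
  even_comm a ha b := by
    have h2 : σ a = a := ha
    have h3 := h0 ((2⁻¹ : ℂ) • a) b
    rw [map_smul, h2, ← add_smul] at h3
    norm_num at h3
    exact h3
  odd_anticomm a ha b hb := by
    have h2 : σ a = -a := eq_neg_of_add_eq_zero_left ha
    have h3 : σ b = -b := eq_neg_of_add_eq_zero_left hb
    have h4 := h1 ((2⁻¹ : ℂ) • a) ((2⁻¹ : ℂ) • b)
    rw [map_smul, h2, map_smul, h3, smul_neg, smul_neg, sub_neg_eq_add, sub_neg_eq_add,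
      ← add_smul, ← add_smul] at h4
    norm_num at h4
    exact h4

/-- The parity involution `a₀ + a₁ ↦ a₀ - a₁`. -/
def parity (A : SuperAlg) : A →ₐ[ℂ] A :=
  AlgHom.ofLinearMap
    (A.even.val.toLinearMap ∘ₗ A.ev + A.even.val.toLinearMap ∘ₗ A.ev - LinearMap.id)
    (by
      have h1 := A.ev_even 1
      simp only [OneMemClass.coe_one] at h1
      simp [h1])
    (by
      intro x y
      obtain ⟨a, ha, b, hb, rfl⟩ := A.exists_add x
      obtain ⟨c, hc, d, hd, rfl⟩ := A.exists_add y
      have e1 := A.ev_even ⟨a, ha⟩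
      have e2 := A.ev_even ⟨c, hc⟩
      have e3 := A.ev_even ⟨a * c, A.even.mul_mem ha hc⟩
      have e4 := A.ev_even ⟨b * d, A.odd_mul_odd b hb d hd⟩
      have e5 := A.ev_odd (A.even_mul_odd a ha d hd)
      have e6 := A.ev_odd (A.odd_mul_even hb hc)
      simp only at e1 e2 e3 e4
      simp only [add_mul, mul_add, LinearMap.sub_apply, LinearMap.add_apply, LinearMap.comp_apply,
        map_add, e1, e2, e3, e4, e5, e6, A.ev_odd hb, A.ev_odd hd, LinearMap.id_apply,
        AlgHom.toLinearMap_apply, Subalgebra.coe_val, map_zero]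
      noncomm_ring)

theorem parity_even {A : SuperAlg} {a : A} (h : a ∈ A.even) : A.parity a = a := by
  have e1 := A.ev_even ⟨a, h⟩
  simp only at e1
  simp [parity, e1]

theorem parity_odd {A : SuperAlg} {a : A} (h : a ∈ A.odd) : A.parity a = -a := by
  simp [parity, A.ev_odd h]

theorem parity_parity (A : SuperAlg) (a : A) : A.parity (A.parity a) = a := by
  obtain ⟨b, hb, c, hc, rfl⟩ := A.exists_add a
  simp [parity_even hb, parity_odd hc]

theorem add_parity_mem (A : SuperAlg) (a : A) : a + A.parity a ∈ A.even := by
  obtain ⟨b, hb, c, hc, rfl⟩ := A.exists_add a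
  rw [map_add, parity_even hb, parity_odd hc]
  convert A.even.add_mem hb hb using 1
  abel

theorem sub_parity_mem (A : SuperAlg) (a : A) : a - A.parity a ∈ A.odd := by
  obtain ⟨b, hb, c, hc, rfl⟩ := A.exists_add a
  rw [map_add, parity_even hb, parity_odd hc]
  convert A.odd.add_mem hc hc using 1
  abel

theorem mem_even_of_parity (A : SuperAlg) {a : A} (h : A.parity a = a) : a ∈ A.even := by
  have h1 := A.even.smul_mem (A.add_parity_mem a) (2⁻¹ : ℂ)
  rw [h, ← two_smul ℂ, smul_smul] at h1
  norm_num at h1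
  exact h1

theorem mem_odd_of_parity (A : SuperAlg) {a : A} (h : A.parity a = -a) : a ∈ A.odd := by
  have h1 := A.odd.smul_mem (2⁻¹ : ℂ) (A.sub_parity_mem a)
  rw [h, sub_neg_eq_add, ← two_smul ℂ, smul_smul] at h1
  norm_num at h1
  exact h1

/-! ### Free commutative superalgebras -/

/-- Supercommutation relations for even generators `E` and odd generators `O`. -/
inductive FreeRel (E O : Type) : FreeAlgebra ℂ (E ⊕ O) → FreeAlgebra ℂ (E ⊕ O) → Prop
  | even (e : E) (x : E ⊕ O) :
      FreeRel E O (FreeAlgebra.ι ℂ (Sum.inl e) * FreeAlgebra.ι ℂ x)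
        (FreeAlgebra.ι ℂ x * FreeAlgebra.ι ℂ (Sum.inl e))
  | odd (o o' : O) :
      FreeRel E O (FreeAlgebra.ι ℂ (Sum.inr o) * FreeAlgebra.ι ℂ (Sum.inr o'))
        (-(FreeAlgebra.ι ℂ (Sum.inr o') * FreeAlgebra.ι ℂ (Sum.inr o)))

/-- The underlying algebra of `ℂ[x_e, ξ_o]`. -/
def FreeCarrier (E O : Type) : Type := RingQuot (FreeRel E O)

instance (E O : Type) : Ring (FreeCarrier E O) :=
  inferInstanceAs (Ring (RingQuot (FreeRel E O)))

instance (E O : Type) : Algebra ℂ (FreeCarrier E O) :=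
  inferInstanceAs (Algebra ℂ (RingQuot (FreeRel E O)))

/-- The projection from the free associative algebra. -/
def freeMk (E O : Type) : FreeAlgebra ℂ (E ⊕ O) →ₐ[ℂ] FreeCarrier E O :=
  RingQuot.mkAlgHom ℂ (FreeRel E O)

/-- The generators of `ℂ[x_e, ξ_o]`. -/
def gen {E O : Type} (x : E ⊕ O) : FreeCarrier E O :=
  freeMk E O (FreeAlgebra.ι ℂ x)

theorem gen_even {E O : Type} (e : E) (x : E ⊕ O) :
    gen (Sum.inl e) * gen x = gen x * gen (Sum.inl e) := by
  have h : freeMk E O _ = freeMk E O _ := RingQuot.mkAlgHom_rel ℂ (FreeRel.even e x)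
  rwa [map_mul, map_mul] at h

theorem gen_odd {E O : Type} (o o' : O) :
    (gen (Sum.inr o) * gen (Sum.inr o') : FreeCarrier E O)
      = -(gen (Sum.inr o') * gen (Sum.inr o)) := by
  have h : freeMk E O _ = freeMk E O _ := RingQuot.mkAlgHom_rel ℂ (FreeRel.odd o o')
  rwa [map_mul, map_neg, map_mul] at h

/-- The algebra homomorphism out of `ℂ[x_e, ξ_o]` with given values on the generators. -/
def freeLift {E O : Type} {R : Type} [Ring R] [Algebra ℂ R] (v : E ⊕ O → R)
    (h0 : ∀ e x, v (Sum.inl e) * v x = v x * v (Sum.inl e))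
    (h1 : ∀ o o', v (Sum.inr o) * v (Sum.inr o') = -(v (Sum.inr o') * v (Sum.inr o))) :
    FreeCarrier E O →ₐ[ℂ] R :=
  RingQuot.liftAlgHom ℂ ⟨FreeAlgebra.lift ℂ v, by
    rintro _ _ (⟨e, x⟩ | ⟨o, o'⟩)
    · simpa using h0 e x
    · simpa using h1 o o'⟩

theorem freeLift_gen {E O : Type} {R : Type} [Ring R] [Algebra ℂ R] (v : E ⊕ O → R)
    (h0 : ∀ e x, v (Sum.inl e) * v x = v x * v (Sum.inl e))
    (h1 : ∀ o o', v (Sum.inr o) * v (Sum.inr o') = -(v (Sum.inr o') * v (Sum.inr o)))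
    (x : E ⊕ O) : freeLift v h0 h1 (gen x) = v x :=
  (RingQuot.liftAlgHom_mkAlgHom_apply ℂ (FreeAlgebra.lift ℂ v) _ _).trans
    (FreeAlgebra.lift_ι_apply v x)

theorem free_induction {E O : Type} (P : FreeCarrier E O → Prop)
    (hc : ∀ c : ℂ, P (algebraMap ℂ _ c)) (hg : ∀ x, P (gen x))
    (hm : ∀ a b, P a → P b → P (a * b)) (ha : ∀ a b, P a → P b → P (a + b)) (a) : P a := by
  obtain ⟨a, rfl⟩ : ∃ b, freeMk E O b = a := RingQuot.mkAlgHom_surjective ℂ (FreeRel E O) a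
  induction a using FreeAlgebra.induction with
  | grade0 r => rw [AlgHom.commutes]; exact hc r
  | grade1 x => exact hg x
  | mul a b h1 h2 => rw [map_mul]; exact hm _ _ h1 h2
  | add a b h1 h2 => rw [map_add]; exact ha _ _ h1 h2

/-- The sign involution of `ℂ[x_e, ξ_o]`: `x_e ↦ x_e`, `ξ_o ↦ -ξ_o`. -/
def freeSign (E O : Type) : FreeCarrier E O →ₐ[ℂ] FreeCarrier E O :=
  freeLift (Sum.elim (fun e => gen (Sum.inl e)) (fun o => -gen (Sum.inr o)))
    (by
      rintro e (x | x)
      · exact gen_even e _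
      · simp [gen_even e (Sum.inr x)])
    (by
      intro o o'
      simpa using gen_odd o o')

theorem freeSign_even {E O : Type} (e : E) :
    freeSign E O (gen (Sum.inl e)) = gen (Sum.inl e) := by
  rw [freeSign, freeLift_gen, Sum.elim_inl]

theorem freeSign_odd {E O : Type} (o : O) :
    freeSign E O (gen (Sum.inr o)) = -gen (Sum.inr o) := by
  rw [freeSign, freeLift_gen, Sum.elim_inr]

theorem freeSign_freeSign {E O : Type} (a : FreeCarrier E O) :
    freeSign E O (freeSign E O a) = a := by
  refine free_induction (fun a => freeSign E O (freeSign E O a) = a) ?_ ?_ ?_ ?_ a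
  · intro c; simp
  · rintro (e | o)
    · simp [freeSign_even]
    · simp [freeSign_odd]
  · intro a b h1 h2; rw [map_mul, map_mul, h1, h2]
  · intro a b h1 h2; rw [map_add, map_add, h1, h2]

theorem mul_gen_even {E O : Type} (a : FreeCarrier E O) (e : E) :
    a * gen (Sum.inl e) = gen (Sum.inl e) * a := by
  refine free_induction (fun a => a * gen (Sum.inl e) = gen (Sum.inl e) * a) ?_ ?_ ?_ ?_ a
  · intro c; exact Algebra.commutes c _
  · intro x; exact (gen_even e x).symm
  · intro a b h1 h2; rw [mul_assoc, h2, ← mul_assoc, h1, mul_assoc]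
  · intro a b h1 h2; rw [add_mul, mul_add, h1, h2]

theorem mul_gen_odd {E O : Type} (a : FreeCarrier E O) (o : O) :
    a * gen (Sum.inr o) = gen (Sum.inr o) * freeSign E O a := by
  refine free_induction
    (fun a => a * gen (Sum.inr o) = gen (Sum.inr o) * freeSign E O a) ?_ ?_ ?_ ?_ a
  · intro c; rw [AlgHom.commutes]; exact Algebra.commutes c _
  · rintro (e | o')
    · rw [freeSign_even, gen_even]
    · rw [freeSign_odd, gen_odd, mul_neg]
  · intro a b h1 h2; rw [mul_assoc, h2, ← mul_assoc, h1, mul_assoc, map_mul]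
  · intro a b h1 h2; rw [add_mul, map_add, mul_add, h1, h2]

theorem free_even_comm {E O : Type} (a b : FreeCarrier E O) (ha : freeSign E O a = a) :
    a * b = b * a := by
  refine free_induction (fun b => a * b = b * a) ?_ ?_ ?_ ?_ b
  · intro c; exact (Algebra.commutes c a).symm
  · rintro (e | o)
    · exact mul_gen_even a e
    · rw [mul_gen_odd, ha]
  · intro b c h1 h2; rw [← mul_assoc, h1, mul_assoc, h2, mul_assoc]
  · intro b c h1 h2; rw [mul_add, add_mul, h1, h2]

theorem free_odd_comm {E O : Type} (a b : FreeCarrier E O) (ha : freeSign E O a = -a) :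
    a * b = freeSign E O b * a := by
  refine free_induction (fun b => a * b = freeSign E O b * a) ?_ ?_ ?_ ?_ b
  · intro c; rw [AlgHom.commutes]; exact (Algebra.commutes c a).symm
  · rintro (e | o)
    · rw [freeSign_even, mul_gen_even a e]
    · rw [mul_gen_odd, ha, freeSign_odd, mul_neg, neg_mul]
  · intro b c h1 h2; rw [← mul_assoc, h1, mul_assoc, h2, map_mul, mul_assoc]
  · intro b c h1 h2; rw [mul_add, map_add, add_mul, h1, h2]

/-- The free commutative superalgebra `ℂ[x_e, ξ_o]` on even generators `E` and odd
generators `O`. -/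
def free (E O : Type) : SuperAlg :=
  ofInvolution (FreeCarrier E O) (freeSign E O) freeSign_freeSign
    (fun a b => free_even_comm _ b (by rw [map_add, freeSign_freeSign, add_comm]))
    (fun a b => by
      rw [free_odd_comm _ _ (by rw [map_sub, freeSign_freeSign, neg_sub]), map_sub,
        freeSign_freeSign, ← neg_sub b, neg_mul])

theorem freeLift_sign {E O : Type} {A : SuperAlg} (v : E ⊕ O → A)
    (hu : ∀ e, v (Sum.inl e) ∈ A.even) (hw : ∀ o, v (Sum.inr o) ∈ A.odd)
    (h0 : ∀ e x, v (Sum.inl e) * v x = v x * v (Sum.inl e))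
    (h1 : ∀ o o', v (Sum.inr o) * v (Sum.inr o') = -(v (Sum.inr o') * v (Sum.inr o)))
    (a : FreeCarrier E O) :
    freeLift v h0 h1 (freeSign E O a) = A.parity (freeLift v h0 h1 a) := by
  refine free_induction
    (fun a => freeLift v h0 h1 (freeSign E O a) = A.parity (freeLift v h0 h1 a)) ?_ ?_ ?_ ?_ a
  · intro c; simp
  · rintro (e | o)
    · rw [freeSign_even, freeLift_gen, parity_even (hu e)]
    · rw [freeSign_odd, map_neg, freeLift_gen, parity_odd (hw o)]
  · intro a b h1 h2; simp only [map_mul, h1, h2]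
  · intro a b h1 h2; simp only [map_add, h1, h2]

/-- The morphism `ℂ[x_e, ξ_o] → A` with given values on the generators. -/
def freeDesc {E O : Type} {A : SuperAlg} (v : E ⊕ O → A)
    (hu : ∀ e, v (Sum.inl e) ∈ A.even) (hw : ∀ o, v (Sum.inr o) ∈ A.odd) : free E O ⟶ A where
  toAlgHom := freeLift v (fun e _ => A.even_comm _ (hu e) _)
    (fun o o' => A.odd_anticomm _ (hw o) _ (hw o'))
  map_even a ha := A.mem_even_of_parity
    ((freeLift_sign v hu hw _ _ a).symm.trans (congrArg _ ha))
  map_odd a ha := A.mem_odd_of_parity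
    ((freeLift_sign v hu hw _ _ a).symm.trans
      ((congrArg _ (eq_neg_of_add_eq_zero_left ha)).trans (map_neg _ (_ : FreeCarrier E O))))

theorem freeDesc_gen {E O : Type} {A : SuperAlg} (v : E ⊕ O → A)
    (hu : ∀ e, v (Sum.inl e) ∈ A.even) (hw : ∀ o, v (Sum.inr o) ∈ A.odd) (x : E ⊕ O) :
    hom (freeDesc v hu hw) (gen x : FreeCarrier E O) = v x :=
  freeLift_gen v (fun e _ => A.even_comm _ (hu e) _)
    (fun o o' => A.odd_anticomm _ (hw o) _ (hw o')) x

/-! ### Quotients -/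

/-- The relations `s = 0` for `s ∈ S`, imposed on the homogeneous components of `s`. -/
inductive QuotRel (P : SuperAlg) (S : Set P) : P → P → Prop
  | even (s : P) (hs : s ∈ S) : QuotRel P S (P.ev s : P) 0
  | odd (s : P) (hs : s ∈ S) : QuotRel P S (s - P.ev s) 0

/-- The underlying algebra of a quotient superalgebra. -/
def QuotCarrier (P : SuperAlg) (S : Set P) : Type := RingQuot (QuotRel P S)

instance (P : SuperAlg) (S : Set P) : Ring (QuotCarrier P S) :=
  inferInstanceAs (Ring (RingQuot (QuotRel P S)))

instance (P : SuperAlg) (S : Set P) : Algebra ℂ (QuotCarrier P S) :=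
  inferInstanceAs (Algebra ℂ (RingQuot (QuotRel P S)))

/-- The projection to the quotient, as an algebra homomorphism. -/
def quotMk (P : SuperAlg) (S : Set P) : P →ₐ[ℂ] QuotCarrier P S :=
  RingQuot.mkAlgHom ℂ (QuotRel P S)

theorem quotMk_surjective (P : SuperAlg) (S : Set P) : Function.Surjective (quotMk P S) :=
  RingQuot.mkAlgHom_surjective ℂ (QuotRel P S)

theorem quotMk_ev (P : SuperAlg) (S : Set P) {s : P} (hs : s ∈ S) : quotMk P S (P.ev s) = 0 :=
  (RingQuot.mkAlgHom_rel ℂ (QuotRel.even s hs)).trans (map_zero (quotMk P S))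

theorem quotMk_sub_ev (P : SuperAlg) (S : Set P) {s : P} (hs : s ∈ S) :
    quotMk P S (s - P.ev s) = 0 :=
  (RingQuot.mkAlgHom_rel ℂ (QuotRel.odd s hs)).trans (map_zero (quotMk P S))

/-- The algebra homomorphism out of a quotient. -/
def quotLift (P : SuperAlg) (S : Set P) {R : Type} [Ring R] [Algebra ℂ R] (F : P →ₐ[ℂ] R)
    (h0 : ∀ s ∈ S, F (P.ev s) = 0) (h1 : ∀ s ∈ S, F (s - P.ev s) = 0) :
    QuotCarrier P S →ₐ[ℂ] R :=
  RingQuot.liftAlgHom ℂ ⟨F, by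
    rintro _ _ (⟨s, hs⟩ | ⟨s, hs⟩)
    · rw [h0 s hs, map_zero]
    · rw [h1 s hs, map_zero]⟩

theorem quotLift_mk (P : SuperAlg) (S : Set P) {R : Type} [Ring R] [Algebra ℂ R] (F : P →ₐ[ℂ] R)
    (h0 : ∀ s ∈ S, F (P.ev s) = 0) (h1 : ∀ s ∈ S, F (s - P.ev s) = 0) (a : P) :
    quotLift P S F h0 h1 (quotMk P S a) = F a :=
  RingQuot.liftAlgHom_mkAlgHom_apply ℂ F _ a

/-- The parity involution of the quotient. -/
def quotSign (P : SuperAlg) (S : Set P) : QuotCarrier P S →ₐ[ℂ] QuotCarrier P S :=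
  quotLift P S ((quotMk P S).comp P.parity)
    (fun s hs => by
      rw [AlgHom.comp_apply, parity_even (P.ev s).2, quotMk_ev P S hs])
    (fun s hs => by
      rw [AlgHom.comp_apply, parity_odd (P.sub_ev_mem s), map_neg, quotMk_sub_ev P S hs,
        neg_zero])

theorem quotSign_mk (P : SuperAlg) (S : Set P) (a : P) :
    quotSign P S (quotMk P S a) = quotMk P S (P.parity a) :=
  quotLift_mk P S _ _ _ a

/-- The quotient of the superalgebra `P` by the smallest homogeneous ideal that contains `S`, that
is, by the ideal generated by the homogeneous components of the elements of `S` (for homogeneous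
elements: by the ideal generated by `S`). The grading is induced from `P`. -/
def quot (P : SuperAlg) (S : Set P) : SuperAlg :=
  ofInvolution (QuotCarrier P S) (quotSign P S)
    (fun a => by
      obtain ⟨a, rfl⟩ := quotMk_surjective P S a
      rw [quotSign_mk, quotSign_mk, parity_parity])
    (fun a b => by
      obtain ⟨a, rfl⟩ := quotMk_surjective P S a
      obtain ⟨b, rfl⟩ := quotMk_surjective P S b
      rw [quotSign_mk, ← map_add, ← map_mul, ← map_mul, P.even_comm _ (P.add_parity_mem a)])
    (fun a b => by
      obtain ⟨a, rfl⟩ := quotMk_surjective P S a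
      obtain ⟨b, rfl⟩ := quotMk_surjective P S b
      rw [quotSign_mk, quotSign_mk, ← map_sub, ← map_sub, ← map_mul, ← map_mul,
        P.odd_anticomm _ (P.sub_parity_mem a) _ (P.sub_parity_mem b), map_neg])

/-- The projection `P → P/(S)`. -/
def toQuot (P : SuperAlg) (S : Set P) : P ⟶ quot P S where
  toAlgHom := quotMk P S
  map_even a ha := (quotSign_mk P S a).trans (congrArg _ (parity_even ha))
  map_odd a ha := by
    change quotSign P S (quotMk P S a) + quotMk P S a = 0
    rw [quotSign_mk, parity_odd ha, map_neg, neg_add_cancel]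

/-- The morphism out of the quotient induced by a morphism that vanishes on `S`. -/
def quotDesc (P : SuperAlg) (S : Set P) {B : SuperAlg} (φ : P ⟶ B)
    (h : ∀ s ∈ S, hom φ s = 0) : quot P S ⟶ B :=
  have h0 : ∀ s ∈ S, hom φ (P.ev s) = 0 := fun s hs => by
    have h1 := evenHom_ev φ s
    rw [h s hs, map_zero] at h1
    exact congrArg Subtype.val h1
  have h1 : ∀ s ∈ S, hom φ (s - P.ev s) = 0 := fun s hs => by
    rw [map_sub, h s hs, h0 s hs, sub_zero]
  have key : ∀ a, quotLift P S (hom φ) h0 h1 (quotSign P S a)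
      = B.parity (quotLift P S (hom φ) h0 h1 a) := fun a => by
    obtain ⟨a, rfl⟩ := quotMk_surjective P S a
    obtain ⟨b, hb, c, hc, rfl⟩ := P.exists_add a
    rw [quotSign_mk, quotLift_mk, quotLift_mk, map_add, parity_even hb, parity_odd hc,
      map_add, map_add, map_add, map_neg, parity_even (hom_even φ hb),
      parity_odd (hom_odd φ hc)]
  { toAlgHom := quotLift P S (hom φ) h0 h1
    map_even := fun a ha => B.mem_even_of_parity ((key a).symm.trans (congrArg _ ha))
    map_odd := fun a ha => B.mem_odd_of_parity ((key a).symm.trans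
      ((congrArg _ (eq_neg_of_add_eq_zero_left ha)).trans (map_neg _ (_ : QuotCarrier P S)))) }

theorem toQuot_desc (P : SuperAlg) (S : Set P) {B : SuperAlg} (φ : P ⟶ B)
    (h : ∀ s ∈ S, hom φ s = 0) : toQuot P S ≫ quotDesc P S φ h = φ :=
  hom_ext (AlgHom.ext fun a => by
    refine quotLift_mk P S (hom φ) ?_ ?_ a
    · intro s hs
      have h1 := evenHom_ev φ s
      rw [h s hs, map_zero] at h1
      exact congrArg Subtype.val h1
    · intro s hs
      have h1 := evenHom_ev φ s
      rw [h s hs, map_zero] at h1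
      have h2 : hom φ (P.ev s : P) = 0 := congrArg Subtype.val h1
      rw [map_sub, h s hs, h2, sub_zero])

/-! ### The reduced algebra -/

/-- The ordinary algebra `A° = A/(A₁)`, the quotient by the ideal generated by the odd part. -/
def Red (A : SuperAlg) : Type := RingQuot (fun a b : A => a ∈ A.odd ∧ b = 0)

instance (A : SuperAlg) : Ring (Red A) :=
  inferInstanceAs (Ring (RingQuot (fun a b : A => a ∈ A.odd ∧ b = 0)))

theorem Red.exists_even (A : SuperAlg) (x : Red A) :
    ∃ a ∈ A.even, RingQuot.mkRingHom (fun a b : A => a ∈ A.odd ∧ b = 0) a = x := by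
  obtain ⟨a, rfl⟩ := RingQuot.mkRingHom_surjective (fun a b : A => a ∈ A.odd ∧ b = 0) x
  obtain ⟨b, hb, c, hc, rfl⟩ := A.exists_add a
  refine ⟨b, hb, ?_⟩
  have h : RingQuot.mkRingHom (fun a b : A => a ∈ A.odd ∧ b = 0) c
      = RingQuot.mkRingHom (fun a b : A => a ∈ A.odd ∧ b = 0) 0 :=
    RingQuot.mkRingHom_rel ⟨hc, rfl⟩
  rw [map_add, h, map_zero, add_zero]

instance (A : SuperAlg) : CommRing (Red A) :=
  { (inferInstance : Ring (Red A)) with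
    mul_comm := fun x y => by
      obtain ⟨a, ha, rfl⟩ := Red.exists_even A x
      obtain ⟨b, hb, rfl⟩ := Red.exists_even A y
      have h := congrArg (RingQuot.mkRingHom (fun a b : A => a ∈ A.odd ∧ b = 0))
        (A.even_comm a ha b)
      exact ((map_mul _ a b).symm.trans h).trans (map_mul _ b a) }

/-- The projection `A → A°`. -/
def toRed (A : SuperAlg) : A →+* Red A :=
  RingQuot.mkRingHom (fun a b : A => a ∈ A.odd ∧ b = 0)

theorem toRed_odd (A : SuperAlg) {a : A} (h : a ∈ A.odd) : toRed A a = 0 :=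
  (RingQuot.mkRingHom_rel ⟨h, rfl⟩).trans (map_zero (toRed A))

/-- The ring homomorphism underlying a `ℂ`-point `A → ℂ`. -/
def baseHom {A : SuperAlg} (x : A ⟶ base) : A →+* ℂ := (hom x).toRingHom

theorem baseHom_odd {A : SuperAlg} (x : A ⟶ base) {a : A} (h : a ∈ A.odd) : baseHom x a = 0 :=
  hom_odd x h

/-- The map `A° → ℂ` induced by a `ℂ`-point `A → ℂ`: the evaluation of elements of `A°`. -/
def redEval {A : SuperAlg} (x : A ⟶ base) : Red A →+* ℂ :=
  RingQuot.lift (r := fun a b : A => a ∈ A.odd ∧ b = 0) ⟨baseHom x, by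
    rintro a b ⟨ha, rfl⟩
    rw [map_zero, baseHom_odd x ha]⟩

theorem redEval_toRed {A : SuperAlg} (x : A ⟶ base) (a : A) :
    redEval x (toRed A a) = baseHom x a :=
  RingQuot.lift_mkRingHom_apply (baseHom x) _ a

/-! ### Localization -/

/-- The powers of an even element form an Ore set, since even elements are central. -/
instance (A : SuperAlg) (f : A.even) : OreLocalization.OreSet (Submonoid.powers (f : A)) where
  ore_right_cancel r₁ r₂ s h := ⟨s, by
    have hs : (s : A) ∈ A.even := by
      obtain ⟨n, hn⟩ := s.2
      exact hn ▸ A.even.pow_mem f.2 n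
    rw [A.even_comm _ hs, A.even_comm _ hs, h]⟩
  oreNum r _ := r
  oreDenom _ s := s
  ore_eq r s := by
    obtain ⟨n, hn⟩ := s.2
    exact A.even_comm _ (hn ▸ A.even.pow_mem f.2 n) r

/-- The underlying algebra of `A_f`: fractions with denominators the powers of `f`. -/
abbrev LocCarrier (A : SuperAlg) (f : A.even) : Type :=
  OreLocalization (Submonoid.powers (f : A)) A

/-- `a ↦ a / 1`. -/
def locMk (A : SuperAlg) (f : A.even) : A →ₐ[ℂ] LocCarrier A f :=
  { (OreLocalization.numeratorRingHom : A →+* LocCarrier A f) with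
    commutes' := fun _ => rfl }

theorem locMk_even_comm (A : SuperAlg) (f : A.even) {c : A} (hc : c ∈ A.even) (a : A) :
    Commute (locMk A f c) (locMk A f a) := by
  rw [Commute, SemiconjBy, ← map_mul, ← map_mul, A.even_comm c hc]

theorem powers_even (A : SuperAlg) (f : A.even) (s : Submonoid.powers (f : A)) :
    (s : A) ∈ A.even := by
  obtain ⟨n, hn⟩ := s.2
  exact hn ▸ A.even.pow_mem f.2 n

theorem locInv_comm_mk (A : SuperAlg) (f : A.even) (s : Submonoid.powers (f : A)) (a : A) :
    Commute (OreLocalization.oreDiv 1 s : LocCarrier A f) (locMk A f a) :=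
  Commute.units_inv_left (u := OreLocalization.numeratorUnit s)
    (locMk_even_comm A f (powers_even A f s) a)

theorem locInv_comm_inv (A : SuperAlg) (f : A.even) (s t : Submonoid.powers (f : A)) :
    Commute (OreLocalization.oreDiv 1 s : LocCarrier A f) (OreLocalization.oreDiv 1 t) :=
  Commute.units_inv_right (u := OreLocalization.numeratorUnit t) (locInv_comm_mk A f s t)

theorem loc_eq (A : SuperAlg) (f : A.even) (a : A) (s : Submonoid.powers (f : A)) :
    (OreLocalization.oreDiv a s : LocCarrier A f) = OreLocalization.oreDiv 1 s * locMk A f a := by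
  refine Eq.trans ?_ OreLocalization.mul_div_one.symm
  rw [one_mul]

theorem locInv_comm (A : SuperAlg) (f : A.even) (s : Submonoid.powers (f : A))
    (x : LocCarrier A f) : Commute (OreLocalization.oreDiv 1 s : LocCarrier A f) x := by
  induction x using OreLocalization.ind with | _ a t
  rw [loc_eq A f a t]
  exact (locInv_comm_inv A f s t).mul_right (locInv_comm_mk A f s a)

theorem isUnit_locMk (A : SuperAlg) (f : A.even) : IsUnit (locMk A f f) :=
  (OreLocalization.numeratorUnit
    (⟨(f : A), Submonoid.mem_powers _⟩ : Submonoid.powers (f : A))).isUnit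

/-- The algebra homomorphism out of `A_f` induced by one that makes `f` invertible. -/
def locLift (A : SuperAlg) (f : A.even) {R : Type} [Ring R] [Algebra ℂ R] (F : A →ₐ[ℂ] R)
    (h : IsUnit (F f)) : LocCarrier A f →ₐ[ℂ] R :=
  { OreLocalization.universalHom (F : A →+* R)
      (IsUnit.liftRight ((F : A →* R).comp (Submonoid.powers (f : A)).subtype) (by
        rintro ⟨_, n, rfl⟩
        simpa using h.pow n)) (fun _ => rfl) with
    commutes' := fun c =>
      (OreLocalization.universalHom_commutes (F : A →+* R) _ (fun _ => rfl)).trans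
        (F.commutes c) }

theorem locLift_mk (A : SuperAlg) (f : A.even) {R : Type} [Ring R] [Algebra ℂ R] (F : A →ₐ[ℂ] R)
    (h : IsUnit (F f)) (a : A) : locLift A f F h (locMk A f a) = F a :=
  OreLocalization.universalHom_commutes (F : A →+* R) _ (fun _ => rfl)

theorem locHom_ext (A : SuperAlg) (f : A.even) {R : Type} [Ring R] [Algebra ℂ R]
    {F G : LocCarrier A f →ₐ[ℂ] R} (h : ∀ a, F (locMk A f a) = G (locMk A f a)) : F = G := by
  ext x
  induction x using OreLocalization.ind with | _ a s
  have h1 : locMk A f (s : A) * (OreLocalization.oreDiv 1 s : LocCarrier A f) = 1 :=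
    (OreLocalization.numeratorUnit s).mul_inv
  have h2 : (OreLocalization.oreDiv 1 s : LocCarrier A f) * locMk A f (s : A) = 1 :=
    (OreLocalization.numeratorUnit s).inv_mul
  have h3 : F (OreLocalization.oreDiv 1 s) = G (OreLocalization.oreDiv 1 s) := by
    refine left_inv_eq_right_inv (a := F (locMk A f (s : A))) ?_ ?_
    · rw [← map_mul, h2, map_one]
    · rw [h, ← map_mul, h1, map_one]
  rw [loc_eq, map_mul, map_mul, h3, h]

/-- The parity involution of `A_f`: `a / fⁿ ↦ (a₀ - a₁) / fⁿ`. -/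
def locSign (A : SuperAlg) (f : A.even) : LocCarrier A f →ₐ[ℂ] LocCarrier A f :=
  locLift A f ((locMk A f).comp A.parity) (by
    rw [AlgHom.comp_apply, parity_even f.2]
    exact isUnit_locMk A f)

theorem locSign_mk (A : SuperAlg) (f : A.even) (a : A) :
    locSign A f (locMk A f a) = locMk A f (A.parity a) :=
  locLift_mk A f _ _ a

theorem locSign_inv (A : SuperAlg) (f : A.even) (s : Submonoid.powers (f : A)) :
    locSign A f (OreLocalization.oreDiv 1 s) = OreLocalization.oreDiv 1 s := by
  have h1 : locMk A f (s : A) * (OreLocalization.oreDiv 1 s : LocCarrier A f) = 1 :=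
    (OreLocalization.numeratorUnit s).mul_inv
  have h2 : (OreLocalization.oreDiv 1 s : LocCarrier A f) * locMk A f (s : A) = 1 :=
    (OreLocalization.numeratorUnit s).inv_mul
  refine left_inv_eq_right_inv (a := locMk A f (s : A)) ?_ h1
  have h3 := congrArg (locSign A f) h2
  rwa [map_mul, locSign_mk, parity_even (powers_even A f s), map_one] at h3

/-- The localization `A_f` of a superalgebra at (the powers of) an even element `f`, graded by
`(A_f)ᵢ = {a / fⁿ | a ∈ Aᵢ}`. -/
def loc (A : SuperAlg) (f : A.even) : SuperAlg :=
  ofInvolution (LocCarrier A f) (locSign A f)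
    (fun x => by
      have h : (locSign A f).comp (locSign A f) = AlgHom.id ℂ _ :=
        locHom_ext A f fun a => by
          rw [AlgHom.comp_apply, locSign_mk, locSign_mk, parity_parity, AlgHom.id_apply]
      exact congrArg (fun F => F x) h)
    (fun x y => by
      induction x using OreLocalization.ind with | _ a s
      induction y using OreLocalization.ind with | _ b t
      rw [loc_eq, loc_eq A f b t, map_mul, locSign_inv, locSign_mk, ← mul_add, ← map_add]
      exact ((locInv_comm A f s _).mul_left ((locInv_comm A f t _).symm.mul_right
        (locMk_even_comm A f (A.add_parity_mem a) b))).eq)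
    (fun x y => by
      induction x using OreLocalization.ind with | _ a s
      induction y using OreLocalization.ind with | _ b t
      rw [loc_eq, loc_eq A f b t, map_mul, map_mul, locSign_inv, locSign_inv, locSign_mk,
        locSign_mk, ← mul_sub, ← mul_sub, ← map_sub, ← map_sub,
        (locInv_comm A f t _).symm.mul_mul_mul_comm, (locInv_comm A f s _).symm.mul_mul_mul_comm,
        ← map_mul, ← map_mul, A.odd_anticomm _ (A.sub_parity_mem a) _ (A.sub_parity_mem b),
        map_neg, mul_neg, (locInv_comm_inv A f s t).eq])

/-- The localization morphism `A → A_f`. -/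
def toLoc (A : SuperAlg) (f : A.even) : A ⟶ loc A f where
  toAlgHom := locMk A f
  map_even a ha := (locSign_mk A f a).trans (congrArg _ (parity_even ha))
  map_odd a ha := by
    change locSign A f (locMk A f a) + locMk A f a = 0
    rw [locSign_mk, parity_odd ha, map_neg, neg_add_cancel]

/-- The morphism `A_f → B` induced by a morphism `A → B` that makes `f` invertible. -/
def locDesc (A : SuperAlg) (f : A.even) {B : SuperAlg} (φ : A ⟶ B) (h : IsUnit (hom φ f)) :
    loc A f ⟶ B :=
  have key : (locLift A f (hom φ) h).comp (locSign A f)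
      = B.parity.comp (locLift A f (hom φ) h) :=
    locHom_ext A f fun a => by
      obtain ⟨b, hb, c, hc, rfl⟩ := A.exists_add a
      rw [AlgHom.comp_apply, AlgHom.comp_apply, locSign_mk, locLift_mk, locLift_mk, map_add,
        parity_even hb, parity_odd hc, map_add, map_add, map_add, map_neg,
        parity_even (hom_even φ hb), parity_odd (hom_odd φ hc)]
  have key' : ∀ x, locLift A f (hom φ) h (locSign A f x)
      = B.parity (locLift A f (hom φ) h x) := fun x => congrArg (fun F => F x) key
  { toAlgHom := locLift A f (hom φ) h
    map_even := fun a ha => B.mem_even_of_parity ((key' a).symm.trans (congrArg _ ha))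
    map_odd := fun a ha => B.mem_odd_of_parity ((key' a).symm.trans
      ((congrArg _ (eq_neg_of_add_eq_zero_left ha)).trans (map_neg _ (_ : LocCarrier A f)))) }

theorem toLoc_desc (A : SuperAlg) (f : A.even) {B : SuperAlg} (φ : A ⟶ B)
    (h : IsUnit (hom φ f)) : toLoc A f ≫ locDesc A f φ h = φ :=
  hom_ext (AlgHom.ext fun a => locLift_mk A f (hom φ) h a)

theorem isUnit_toLoc_of_dvd (A : SuperAlg) (f g : A.even) (h : f ∣ g) :
    IsUnit (hom (toLoc A g) f) := by
  obtain ⟨c, rfl⟩ := h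
  have h1 : IsUnit (hom (toLoc A (f * c)) (f : A) * hom (toLoc A (f * c)) (c : A)) := by
    rw [← map_mul]
    exact isUnit_locMk A (f * c)
  have h2 : Commute (hom (toLoc A (f * c)) (f : A)) (hom (toLoc A (f * c)) (c : A)) :=
    (loc A (f * c)).even_comm _ (hom_even _ f.2) _
  exact (h2.isUnit_mul_iff.1 h1).1

/-- The restriction morphism `A_f → A_g` for `f ∣ g`. -/
def locRes (A : SuperAlg) (f g : A.even) (h : f ∣ g) : loc A f ⟶ loc A g :=
  locDesc A f (toLoc A g) (isUnit_toLoc_of_dvd A f g h)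

end SuperAlg

/-! ### Local functors and sheafification -/

/-- A functor `F` from commutative superalgebras to sets is local if for all even elements
`f₁, …, f_s` of a superalgebra `A` that generate the unit ideal of `A₀`, the diagram
`F(A) → ∏ F(A_{fᵢ}) ⇉ ∏ F(A_{fᵢfⱼ})` is exact. -/
def IsLocal (F : SuperAlg ⥤ Type) : Prop :=
  ∀ (A : SuperAlg) (s : ℕ) (f : Fin s → A.even), Ideal.span (Set.range f) = ⊤ →
    ∀ x : ∀ i, F.obj (A.loc (f i)),
      (∀ i j, F.map (A.locRes (f i) (f i * f j) (dvd_mul_right _ _)) (x i)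
        = F.map (A.locRes (f j) (f i * f j) (dvd_mul_left _ _)) (x j)) →
      ∃! y : F.obj A, ∀ i, F.map (A.toLoc (f i)) y = x i

/-- `η : F ⟶ F'` exhibits `F'` as the sheafification of `F`: the functor `F'` is local, and `η` is
universal among the natural transformations from `F` to local functors. -/
def IsSheafification {F F' : SuperAlg ⥤ Type} (η : F ⟶ F') : Prop :=
  IsLocal F' ∧ ∀ (L : SuperAlg ⥤ Type), IsLocal L → ∀ θ : F ⟶ L, ∃! θ' : F' ⟶ L, η ≫ θ' = θ

/-! ### Supermatrices -/

/-- The index set of `m` even and `n` odd basis vectors. -/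
abbrev Idx (m n : ℕ) : Type := Fin m ⊕ Fin n

/-- `(m+n) × (m+n)` matrices with entries in `A`, in block form `(p q; r s)`. -/
abbrev Mat (m n : ℕ) (A : SuperAlg) : Type := Matrix (Idx m n) (Idx m n) A

/-- The part of `A` where the entry at the place `(i, j)` of an even supermatrix lies. -/
def slot {m n : ℕ} (A : SuperAlg) : Idx m n → Idx m n → Submodule ℂ A
  | Sum.inl _, Sum.inl _ => Subalgebra.toSubmodule A.even
  | Sum.inl _, Sum.inr _ => A.odd
  | Sum.inr _, Sum.inl _ => A.odd
  | Sum.inr _, Sum.inr _ => Subalgebra.toSubmodule A.even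

theorem slot_mul {m n : ℕ} (A : SuperAlg) {i j k : Idx m n} {a b : A}
    (ha : a ∈ slot A i j) (hb : b ∈ slot A j k) : a * b ∈ slot A i k := by
  rcases i with i | i <;> rcases j with j | j <;> rcases k with k | k
  · exact A.even.mul_mem ha hb
  · exact A.even_mul_odd _ ha _ hb
  · exact A.odd_mul_odd _ ha _ hb
  · exact A.odd_mul_even ha hb
  · exact A.odd_mul_even ha hb
  · exact A.odd_mul_odd _ ha _ hb
  · exact A.even_mul_odd _ ha _ hb
  · exact A.even.mul_mem ha hb

theorem slot_hom {m n : ℕ} {A B : SuperAlg} (φ : A ⟶ B) {i j : Idx m n} {a : A}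
    (ha : a ∈ slot A i j) : SuperAlg.hom φ a ∈ slot B i j := by
  rcases i with i | i <;> rcases j with j | j
  · exact SuperAlg.hom_even φ ha
  · exact SuperAlg.hom_odd φ ha
  · exact SuperAlg.hom_odd φ ha
  · exact SuperAlg.hom_even φ ha

theorem slot_one {m n : ℕ} (A : SuperAlg) (i : Idx m n) (c : ℂ) :
    algebraMap ℂ A c ∈ slot A i i := by
  rcases i with i | i <;> exact A.even.algebraMap_mem c

/-- `𝔤𝔩_{m|n}(A)`: the even supermatrices `(p q; r s)`, where `p`, `s` have even entries and
`q`, `r` have odd entries. -/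
def gl (m n : ℕ) (A : SuperAlg) : Subalgebra ℂ (Mat m n A) where
  carrier := {M | ∀ i j, M i j ∈ slot A i j}
  mul_mem' {M N} hM hN i j := by
    rw [Matrix.mul_apply]
    exact Submodule.sum_mem _ fun k _ => slot_mul A (hM i k) (hN k j)
  add_mem' {M N} hM hN i j := Submodule.add_mem _ (hM i j) (hN i j)
  algebraMap_mem' c i j := by
    rw [Matrix.algebraMap_matrix_apply]
    split_ifs with h
    · subst h
      exact slot_one A i c
    · exact Submodule.zero_mem _

/-- `GL_{m|n}(A)`: the invertible even supermatrices. -/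
abbrev GLmn (m n : ℕ) (A : SuperAlg) : Type := (gl m n A)ˣ

/-- Base change of supermatrices. -/
def glMap {m n : ℕ} {A B : SuperAlg} (φ : A ⟶ B) : gl m n A →ₐ[ℂ] gl m n B :=
  ((SuperAlg.hom φ).mapMatrix.comp (gl m n A).val).codRestrict (gl m n B)
    (fun M i j => slot_hom φ (M.2 i j))

theorem glMap_coe {m n : ℕ} {A B : SuperAlg} (φ : A ⟶ B) (M : gl m n A) :
    (glMap φ M : Mat m n B) = (M : Mat m n A).map (SuperAlg.hom φ) := rfl

/-- The base change `GL_{m|n}(A) → GL_{m|n}(B)`. -/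
def GLmnMap {m n : ℕ} {A B : SuperAlg} (φ : A ⟶ B) (g : GLmn m n A) : GLmn m n B :=
  Units.map (glMap φ).toRingHom.toMonoidHom g

/-- The supertrace `tr p - tr s`. -/
def str {m n : ℕ} {A : SuperAlg} (M : Mat m n A) : A :=
  ∑ i, M (Sum.inl i) (Sum.inl i) - ∑ a, M (Sum.inr a) (Sum.inr a)

/-- The Berezinian `det (p - q s⁻¹ r) det (s⁻¹)` of an invertible even supermatrix. The
determinants are taken in the commutative ring `A₀`, where all the entries concerned lie. -/
def ber {m n : ℕ} {A : SuperAlg} (M : Mat m n A) : A.even :=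
  let s : Matrix (Fin n) (Fin n) A.even := M.toBlocks₂₂.map A.ev
  let t : Matrix (Fin m) (Fin m) A :=
    M.toBlocks₁₁ - M.toBlocks₁₂ * (s⁻¹).map (fun x => (x : A)) * M.toBlocks₂₁
  (t.map A.ev).det * (s⁻¹).det

/-- The supertranspose `(p q; r s) ↦ (pᵀ rᵀ; -qᵀ sᵀ)`. -/
def superTranspose {m n : ℕ} {A : SuperAlg} (M : Mat m n A) : Mat m n A :=
  Matrix.fromBlocks M.toBlocks₁₁.transpose M.toBlocks₂₁.transpose
    (-M.toBlocks₁₂.transpose) M.toBlocks₂₂.transpose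

/-- The Gram matrix of the standard supersymmetric bilinear form on `ℂ^{m|n}` (`n` even): on `ℂ^m`
the symmetric form with ones on the antidiagonal, on `ℂ^n` the alternating form with entries `1` on
the upper half and `-1` on the lower half of the antidiagonal. -/
def form (m n : ℕ) (A : SuperAlg) : Mat m n A :=
  Matrix.fromBlocks
    (Matrix.of fun i j => if j = i.rev then 1 else 0) 0 0
    (Matrix.of fun a b => if b = a.rev then (if a < b then 1 else -1) else 0)

/-- The two series of supergroups and Lie superalgebras. -/
inductive Series
  | sl
  | osp

/-- The supergroups `SL_{m|n}` and `OSp_{m|n}`, as subfunctors of `GL_{m|n}`: the condition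
`Ber g = 1`, respectively that `g` preserves the form. -/
def InGroup {m n : ℕ} {A : SuperAlg} : Series → Mat m n A → Prop
  | Series.sl, g => ber g = 1
  | Series.osp, g => superTranspose g * form m n A * g = form m n A

/-- The linear expressions in the entries of a supermatrix `M` whose vanishing defines `𝔰𝔩_{m|n}`
(the supertrace) and `𝔬𝔰𝔭_{m|n}` (the entries of `Mˢᵗ J + J M`). -/
def lieEquations {m n : ℕ} {A : SuperAlg} : Series → Mat m n A → Set A
  | Series.sl, M => {str M}
  | Series.osp, M =>
      {x | ∃ i j, x = (superTranspose M * form m n A + form m n A * M) i j}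

/-- The `A`-points `G(A)` of `G = SL_{m|n}` or `G = OSp_{m|n}`. -/
abbrev Grp (t : Series) (m n : ℕ) (A : SuperAlg) : Type :=
  {g : GLmn m n A // InGroup t (g : gl m n A).1}

/-- The `A`-points `𝔤(A)` of `𝔤 = 𝔰𝔩_{m|n}` or `𝔤 = 𝔬𝔰𝔭_{m|n}`. -/
abbrev Lie (t : Series) (m n : ℕ) (A : SuperAlg) : Type :=
  {X : gl m n A // ∀ x ∈ lieEquations t (X : Mat m n A), x = 0}

/-! Functoriality of these conditions. -/

theorem str_map {m n : ℕ} {A B : SuperAlg} (φ : A ⟶ B) (M : Mat m n A) :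
    str (M.map (SuperAlg.hom φ)) = SuperAlg.hom φ (str M) := by
  simp [str]

theorem superTranspose_map {m n : ℕ} {A B : SuperAlg} (φ : A ⟶ B) (M : Mat m n A) :
    superTranspose (M.map (SuperAlg.hom φ)) = (superTranspose M).map (SuperAlg.hom φ) := by
  ext i j
  rcases i with i | i <;> rcases j with j | j <;>
    simp [superTranspose, Matrix.toBlocks₁₁, Matrix.toBlocks₁₂, Matrix.toBlocks₂₁,
      Matrix.toBlocks₂₂]

theorem form_map {m n : ℕ} {A B : SuperAlg} (φ : A ⟶ B) :
    (form m n A).map (SuperAlg.hom φ) = form m n B := by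
  ext i j
  rcases i with i | i <;> rcases j with j | j <;>
    simp [form, apply_ite (SuperAlg.hom φ)]

theorem lieEquations_map {t : Series} {m n : ℕ} {A B : SuperAlg} (φ : A ⟶ B) (M : Mat m n A) :
    lieEquations t (M.map (SuperAlg.hom φ)) = SuperAlg.hom φ '' lieEquations t M := by
  cases t with
  | sl => simp [lieEquations, str_map]
  | osp =>
    have h : superTranspose (M.map (SuperAlg.hom φ)) * form m n B
        + form m n B * M.map (SuperAlg.hom φ)
        = (superTranspose M * form m n A + form m n A * M).map (SuperAlg.hom φ) := by
      rw [Matrix.map_add _ (map_add _), Matrix.map_mul, Matrix.map_mul, superTranspose_map,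
        form_map]
    ext x
    simp only [lieEquations, h, Set.mem_ofPred_eq, Set.mem_image, Matrix.map_apply]
    constructor
    · rintro ⟨i, j, rfl⟩
      exact ⟨_, ⟨i, j, rfl⟩, rfl⟩
    · rintro ⟨_, ⟨i, j, rfl⟩, rfl⟩
      exact ⟨i, j, rfl⟩

/-- A product of two odd elements is nilpotent, hence zero in the reduction of `A₀`. -/
theorem odd_mul_nilpotent (A : SuperAlg) {a b : A} (ha : a ∈ A.odd) (hb : b ∈ A.odd) :
    IsNilpotent (⟨a * b, A.odd_mul_odd a ha b hb⟩ : A.even) := by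
  refine ⟨2, Subtype.ext ?_⟩
  have h1 : a * a = 0 := by
    have h2 : a * a + a * a = 0 := eq_neg_iff_add_eq_zero.1 (A.odd_anticomm a ha a ha)
    rw [← two_smul ℂ] at h2
    exact (smul_eq_zero.1 h2).resolve_left two_ne_zero
  change (a * b) ^ 2 = 0
  rw [pow_two, mul_assoc, ← mul_assoc b, A.odd_anticomm b hb a ha, neg_mul, mul_neg, mul_assoc a b,
    ← mul_assoc a a, h1, zero_mul, neg_zero]

theorem isUnit_det_block (m n : ℕ) (A : SuperAlg) (g : GLmn m n A) :
    IsUnit ((g : gl m n A).1.toBlocks₂₂.map A.ev).det := by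
  set M : Mat m n A := (g : gl m n A).1 with hM
  set N : Mat m n A := ((g⁻¹ : GLmn m n A) : gl m n A).1 with hN
  have hMN : M * N = 1 := congrArg Subtype.val g.mul_inv
  have hr : ∀ a i, M (Sum.inr a) (Sum.inl i) ∈ A.odd := fun a i => (g : gl m n A).2 (Sum.inr a) (Sum.inl i)
  have hq : ∀ i b, N (Sum.inl i) (Sum.inr b) ∈ A.odd :=
    fun i b => ((g⁻¹ : GLmn m n A) : gl m n A).2 (Sum.inl i) (Sum.inr b)
  have hs : ∀ a b, M (Sum.inr a) (Sum.inr b) ∈ A.even := fun a b => (g : gl m n A).2 (Sum.inr a) (Sum.inr b)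
  have hs' : ∀ a b, N (Sum.inr a) (Sum.inr b) ∈ A.even :=
    fun a b => ((g⁻¹ : GLmn m n A) : gl m n A).2 (Sum.inr a) (Sum.inr b)
  let Q : Matrix (Fin n) (Fin n) A.even := fun a b =>
    ∑ i, ⟨M (Sum.inr a) (Sum.inl i) * N (Sum.inl i) (Sum.inr b),
      A.odd_mul_odd _ (hr a i) _ (hq i b)⟩
  have key : M.toBlocks₂₂.map A.ev * N.toBlocks₂₂.map A.ev = 1 - Q := by
    ext a b
    have h1 := congrFun (congrFun hMN (Sum.inr a)) (Sum.inr b)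
    rw [Matrix.mul_apply, Fintype.sum_sum_type] at h1
    have e1 : ∀ c, (A.ev (M (Sum.inr a) (Sum.inr c)) : A) = M (Sum.inr a) (Sum.inr c) :=
      fun c => congrArg Subtype.val (A.ev_even ⟨_, hs a c⟩)
    have e2 : ∀ c, (A.ev (N (Sum.inr c) (Sum.inr b)) : A) = N (Sum.inr c) (Sum.inr b) :=
      fun c => congrArg Subtype.val (A.ev_even ⟨_, hs' c b⟩)
    have h2 : ((1 : Matrix (Fin n) (Fin n) A.even) a b : A) = (1 : Mat m n A) (Sum.inr a) (Sum.inr b) := by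
      simp [Matrix.one_apply, apply_ite (Subtype.val : A.even → A)]
    have h3 : (Q a b : A) = ∑ i, M (Sum.inr a) (Sum.inl i) * N (Sum.inl i) (Sum.inr b) := by
      simp [Q]
    simp only [Matrix.mul_apply, Matrix.map_apply, Matrix.toBlocks₂₂, Matrix.of_apply,
      Matrix.sub_apply, AddSubgroupClass.coe_sub, AddSubmonoidClass.coe_finsetSum,
      MulMemClass.coe_mul, e1, e2, h2, h3, ← h1]
    abel
  have hnil : ∀ a b, Q a b ∈ nilradical A.even := fun a b =>
    Ideal.sum_mem _ fun i _ => mem_nilradical.2 (odd_mul_nilpotent A (hr a i) (hq i b))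
  have hdet : IsUnit (1 - Q).det := by
    have h1 : IsUnit (Ideal.Quotient.mk (nilradical A.even) (1 - Q).det) := by
      rw [RingHom.map_det, map_sub, map_one]
      have h2 : (Ideal.Quotient.mk (nilradical A.even)).mapMatrix Q = 0 := by
        ext a b
        exact Ideal.Quotient.eq_zero_iff_mem.2 (hnil a b)
      rw [h2, sub_zero, Matrix.det_one]
      exact isUnit_one
    have := isLocalHom_of_le_jacobson_bot (nilradical A.even) Ideal.radical_le_jacobson
    exact isUnit_of_map_unit _ _ h1
  rw [← key, Matrix.det_mul] at hdet
  exact isUnit_of_mul_isUnit_left hdet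

theorem ber_map {m n : ℕ} {A B : SuperAlg} (φ : A ⟶ B) (g : GLmn m n A) :
    ber ((g : gl m n A).1.map (SuperAlg.hom φ)) = SuperAlg.evenHom φ (ber (g : gl m n A).1) := by
  have hu := isUnit_det_block m n A g
  generalize (g : gl m n A).1 = M at hu
  have hs : ((M.map (SuperAlg.hom φ)).toBlocks₂₂.map B.ev)
      = (M.toBlocks₂₂.map A.ev).map (SuperAlg.evenHom φ) := by
    ext a b
    exact congrArg Subtype.val (SuperAlg.evenHom_ev φ _).symm
  have hinv : ((M.toBlocks₂₂.map A.ev).map (SuperAlg.evenHom φ))⁻¹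
      = (M.toBlocks₂₂.map A.ev)⁻¹.map (SuperAlg.evenHom φ) := by
    apply Matrix.inv_eq_right_inv
    rw [← Matrix.map_mul, Matrix.mul_nonsing_inv _ hu]
    exact Matrix.map_one _ (map_zero _) (map_one _)
  simp only [ber, hs, hinv, map_mul, RingHom.map_det]
  congr 2
  generalize (M.toBlocks₂₂.map A.ev)⁻¹ = s
  have ht : (M.map (SuperAlg.hom φ)).toBlocks₁₁ - (M.map (SuperAlg.hom φ)).toBlocks₁₂
        * (s.map (SuperAlg.evenHom φ)).map (fun x => (x : B))
        * (M.map (SuperAlg.hom φ)).toBlocks₂₁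
      = (M.toBlocks₁₁ - M.toBlocks₁₂ * s.map (fun x => (x : A)) * M.toBlocks₂₁).map
          (SuperAlg.hom φ) := by
    rw [Matrix.map_sub _ (map_sub _), Matrix.map_mul, Matrix.map_mul]
    rfl
  rw [ht]
  ext i j
  exact congrArg Subtype.val (SuperAlg.evenHom_ev φ _).symm

theorem inGroup_map {t : Series} {m n : ℕ} {A B : SuperAlg} (φ : A ⟶ B) (g : GLmn m n A)
    (h : InGroup t (g : gl m n A).1) : InGroup t (GLmnMap φ g : gl m n B).1 := by
  have e : (GLmnMap φ g : gl m n B).1 = (g : gl m n A).1.map (SuperAlg.hom φ) := rfl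
  rw [e]
  cases t with
  | sl =>
    change ber _ = 1
    rw [ber_map, show ber (g : gl m n A).1 = 1 from h, map_one]
  | osp =>
    have h' : superTranspose (g : gl m n A).1 * form m n A * (g : gl m n A).1 = form m n A := h
    change superTranspose _ * form m n B * _ = form m n B
    rw [superTranspose_map, ← form_map φ, ← Matrix.map_mul, ← Matrix.map_mul, h']

/-- The base change `G(A) → G(B)`. -/
def grpMap {t : Series} {m n : ℕ} {A B : SuperAlg} (φ : A ⟶ B) (g : Grp t m n A) :
    Grp t m n B :=
  ⟨GLmnMap φ g.1, inGroup_map φ g.1 g.2⟩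

/-- The base change `𝔤(A) → 𝔤(B)`. -/
def lieMap {t : Series} {m n : ℕ} {A B : SuperAlg} (φ : A ⟶ B) (X : Lie t m n A) :
    Lie t m n B :=
  ⟨glMap φ X.1, by
    rw [glMap_coe, lieEquations_map]
    rintro _ ⟨x, hx, rfl⟩
    rw [X.2 x hx, map_zero]⟩

/-! ### The adjoint action -/

theorem str_mul_comm {m n : ℕ} {A : SuperAlg} (M N : gl m n A) :
    str (M.1 * N.1) = str (N.1 * M.1) := by
  simp only [str, Matrix.mul_apply, Fintype.sum_sum_type, Finset.sum_add_distrib]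
  have h1 : ∑ i, ∑ j, M.1 (Sum.inl i) (Sum.inl j) * N.1 (Sum.inl j) (Sum.inl i)
      = ∑ i, ∑ j, N.1 (Sum.inl i) (Sum.inl j) * M.1 (Sum.inl j) (Sum.inl i) := by
    rw [Finset.sum_comm]
    exact Finset.sum_congr rfl fun i _ => Finset.sum_congr rfl fun j _ =>
      A.even_comm _ (M.2 (Sum.inl j) (Sum.inl i)) _
  have h2 : ∑ i, ∑ j, M.1 (Sum.inr i) (Sum.inr j) * N.1 (Sum.inr j) (Sum.inr i)
      = ∑ i, ∑ j, N.1 (Sum.inr i) (Sum.inr j) * M.1 (Sum.inr j) (Sum.inr i) := by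
    rw [Finset.sum_comm]
    exact Finset.sum_congr rfl fun i _ => Finset.sum_congr rfl fun j _ =>
      A.even_comm _ (M.2 (Sum.inr j) (Sum.inr i)) _
  have h3 : ∑ i, ∑ j, M.1 (Sum.inl i) (Sum.inr j) * N.1 (Sum.inr j) (Sum.inl i)
      = -∑ i, ∑ j, N.1 (Sum.inr i) (Sum.inl j) * M.1 (Sum.inl j) (Sum.inr i) := by
    rw [Finset.sum_comm, ← Finset.sum_neg_distrib]
    refine Finset.sum_congr rfl fun i _ => ?_
    rw [← Finset.sum_neg_distrib]
    exact Finset.sum_congr rfl fun j _ =>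
      A.odd_anticomm _ (M.2 (Sum.inl j) (Sum.inr i)) _ (N.2 (Sum.inr i) (Sum.inl j))
  have h4 : ∑ i, ∑ j, M.1 (Sum.inr i) (Sum.inl j) * N.1 (Sum.inl j) (Sum.inr i)
      = -∑ i, ∑ j, N.1 (Sum.inl i) (Sum.inr j) * M.1 (Sum.inr j) (Sum.inl i) := by
    rw [Finset.sum_comm, ← Finset.sum_neg_distrib]
    refine Finset.sum_congr rfl fun i _ => ?_
    rw [← Finset.sum_neg_distrib]
    exact Finset.sum_congr rfl fun j _ =>
      A.odd_anticomm _ (M.2 (Sum.inr j) (Sum.inl i)) _ (N.2 (Sum.inl i) (Sum.inr j))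
  rw [h1, h2, h3, h4]
  abel

theorem superTranspose_mul {m n : ℕ} {A : SuperAlg} (M N : gl m n A) :
    superTranspose (M.1 * N.1) = superTranspose N.1 * superTranspose M.1 := by
  ext i j
  rcases i with i | i <;> rcases j with j | j <;>
    simp only [superTranspose, Matrix.toBlocks₁₁, Matrix.toBlocks₁₂, Matrix.toBlocks₂₁,
      Matrix.toBlocks₂₂, Matrix.mul_apply, Fintype.sum_sum_type, Matrix.fromBlocks_apply₁₁,
      Matrix.fromBlocks_apply₁₂, Matrix.fromBlocks_apply₂₁, Matrix.fromBlocks_apply₂₂,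
      Matrix.transpose_apply, Matrix.of_apply, Matrix.neg_apply, neg_add, ← Finset.sum_neg_distrib]
  · refine congrArg₂ (· + ·) (Finset.sum_congr rfl fun k _ => ?_)
      (Finset.sum_congr rfl fun k _ => ?_)
    · exact A.even_comm _ (M.2 (Sum.inl j) (Sum.inl k)) _
    · rw [A.odd_anticomm _ (M.2 (Sum.inl j) (Sum.inr k)) _ (N.2 (Sum.inr k) (Sum.inl i)), mul_neg]
  · refine congrArg₂ (· + ·) (Finset.sum_congr rfl fun k _ => ?_)
      (Finset.sum_congr rfl fun k _ => ?_)
    · exact (A.even_comm _ (N.2 (Sum.inl k) (Sum.inl i)) _).symm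
    · exact A.even_comm _ (M.2 (Sum.inr j) (Sum.inr k)) _
  · refine congrArg₂ (· + ·) (Finset.sum_congr rfl fun k _ => ?_)
      (Finset.sum_congr rfl fun k _ => ?_)
    · rw [A.even_comm _ (M.2 (Sum.inl j) (Sum.inl k)) _, neg_mul]
    · rw [← A.even_comm _ (N.2 (Sum.inr k) (Sum.inr i)) _, mul_neg]
  · refine congrArg₂ (· + ·) (Finset.sum_congr rfl fun k _ => ?_)
      (Finset.sum_congr rfl fun k _ => ?_)
    · rw [A.odd_anticomm _ (M.2 (Sum.inr j) (Sum.inl k)) _ (N.2 (Sum.inl k) (Sum.inr i)), neg_mul]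
    · exact A.even_comm _ (M.2 (Sum.inr j) (Sum.inr k)) _

theorem superTranspose_one (m n : ℕ) (A : SuperAlg) : superTranspose (1 : Mat m n A) = 1 := by
  ext i j
  rcases i with i | i <;> rcases j with j | j <;>
    simp [superTranspose, Matrix.toBlocks₁₁, Matrix.toBlocks₁₂, Matrix.toBlocks₂₁,
      Matrix.toBlocks₂₂, Matrix.one_apply, eq_comm]

/-- The conjugate `g X g⁻¹`. -/
def conj {m n : ℕ} {A : SuperAlg} (g : GLmn m n A) (X : gl m n A) : gl m n A :=
  (g : gl m n A) * X * ((g⁻¹ : GLmn m n A) : gl m n A)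

theorem conj_mem {t : Series} {m n : ℕ} {A : SuperAlg} (g : GLmn m n A) (X : gl m n A)
    (hg : InGroup t (g : gl m n A).1) (hX : ∀ x ∈ lieEquations t X.1, x = 0) :
    ∀ x ∈ lieEquations t (conj g X).1, x = 0 := by
  cases t with
  | sl =>
    have h1 : str X.1 = 0 := hX _ rfl
    rintro _ rfl
    have h2 := str_mul_comm ((g : gl m n A) * X) ((g⁻¹ : GLmn m n A) : gl m n A)
    have h3 : ((g⁻¹ : GLmn m n A) : gl m n A) * ((g : gl m n A) * X) = X := by
      rw [← mul_assoc, Units.inv_mul, one_mul]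
    have h4 := congrArg Subtype.val h3
    exact h2.trans ((congrArg str h4).trans h1)
  | osp =>
    have hX' : superTranspose X.1 * form m n A + form m n A * X.1 = 0 := by
      ext i j
      exact hX _ ⟨i, j, rfl⟩
    have hg' : superTranspose (g : gl m n A).1 * form m n A * (g : gl m n A).1 = form m n A := hg
    have h1 : (g : gl m n A).1 * ((g⁻¹ : GLmn m n A) : gl m n A).1 = 1 :=
      congrArg Subtype.val g.mul_inv
    have h2 := superTranspose_mul (g : gl m n A) ((g⁻¹ : GLmn m n A) : gl m n A)
    have h3 := superTranspose_mul ((g : gl m n A) * X) ((g⁻¹ : GLmn m n A) : gl m n A)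
    have h4 := superTranspose_mul (g : gl m n A) X
    have e1 : (conj g X).1 = (g : gl m n A).1 * X.1 * ((g⁻¹ : GLmn m n A) : gl m n A).1 := rfl
    have e2 : ((g : gl m n A) * X).1 = (g : gl m n A).1 * X.1 := rfl
    rw [h1, superTranspose_one] at h2
    rw [e2, h4] at h3
    rintro _ ⟨i, j, rfl⟩
    rw [e1, h3]
    generalize (g : gl m n A).1 = a at *
    generalize ((g⁻¹ : GLmn m n A) : gl m n A).1 = b at *
    generalize superTranspose a = a' at *
    generalize superTranspose b = b' at *
    generalize superTranspose X.1 = x' at *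
    generalize form m n A = J at *
    have h5 : b' * (x' * a') * J = b' * (x' * J) * b := by
      calc b' * (x' * a') * J = b' * x' * (a' * J * (a * b)) := by
            rw [h1, mul_one]; simp only [mul_assoc]
        _ = b' * x' * (a' * J * a) * b := by simp only [mul_assoc]
        _ = b' * (x' * J) * b := by rw [hg']; simp only [mul_assoc]
    have h6 : J * (a * X.1 * b) = b' * (J * X.1) * b := by
      calc J * (a * X.1 * b) = (b' * a') * J * (a * X.1 * b) := by rw [← h2, one_mul]
        _ = b' * (a' * J * a) * X.1 * b := by simp only [mul_assoc]
        _ = b' * (J * X.1) * b := by rw [hg']; simp only [mul_assoc]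
    rw [h5, h6, ← add_mul, ← mul_add, hX', mul_zero, zero_mul, Matrix.zero_apply]

/-- The adjoint action `Ad_g X = g X g⁻¹` of `G(A)` on `𝔤(A)`. -/
def Ad {t : Series} {m n : ℕ} {A : SuperAlg} (g : Grp t m n A) (X : Lie t m n A) : Lie t m n A :=
  ⟨conj g.1 X.1, conj_mem g.1 X.1 g.2 X.2⟩

theorem lieMap_Ad {t : Series} {m n : ℕ} {A B : SuperAlg} (φ : A ⟶ B) (g : Grp t m n A)
    (X : Lie t m n A) : lieMap φ (Ad g X) = Ad (grpMap φ g) (lieMap φ X) := by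
  apply Subtype.ext
  change glMap φ (conj g.1 X.1) = conj (GLmnMap φ g.1) (glMap φ X.1)
  rw [conj, map_mul, map_mul]
  rfl

theorem lieMap_comp {t : Series} {m n : ℕ} {A B C : SuperAlg} (φ : A ⟶ B) (ψ : B ⟶ C)
    (X : Lie t m n A) : lieMap (φ ≫ ψ) X = lieMap ψ (lieMap φ X) := rfl

theorem lieMap_id {t : Series} {m n : ℕ} {A : SuperAlg} (X : Lie t m n A) :
    lieMap (𝟙 A) X = X := rfl

/-! ### The orbit functor -/

/-- The orbit functor `A ↦ {Ad_g X₀ | g ∈ G(A)}` of `X₀ ∈ 𝔤(ℂ)`, where `X₀` is viewed in `𝔤(A)`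
through the unit map `ℂ → A`. -/
def orbitFunctor {t : Series} {m n : ℕ} (X₀ : Lie t m n SuperAlg.base) : SuperAlg ⥤ Type where
  obj A := {Y : Lie t m n A // ∃ g : Grp t m n A, Y = Ad g (lieMap A.unit X₀)}
  map {A B} φ := TypeCat.ofHom fun Y => ⟨lieMap φ Y.1, by
    obtain ⟨g, hg⟩ := Y.2
    exact ⟨grpMap φ g, by rw [hg, lieMap_Ad, ← lieMap_comp, SuperAlg.unit_comp]⟩⟩

/-! ### Coordinate superalgebras -/

/-- The even generators `x_{ij}`, `y_{ab}` of `ℂ[𝔤𝔩_{m|n}]`. -/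
abbrev EvenGen (m n : ℕ) : Type := (Fin m × Fin m) ⊕ (Fin n × Fin n)

/-- The odd generators `ξ_{ib}`, `γ_{aj}` of `ℂ[𝔤𝔩_{m|n}]`. -/
abbrev OddGen (m n : ℕ) : Type := (Fin m × Fin n) ⊕ (Fin n × Fin m)

/-- The coordinate superalgebra `ℂ[𝔤𝔩_{m|n}] = ℂ[x_{ij}, y_{ab}, ξ_{ib}, γ_{aj}]`. -/
def glCoord (m n : ℕ) : SuperAlg := SuperAlg.free (EvenGen m n) (OddGen m n)

/-- The place in the matrix of indeterminates `(x ξ; γ y)` where a generator stands. -/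
def place {m n : ℕ} : EvenGen m n ⊕ OddGen m n → Idx m n × Idx m n
  | Sum.inl (Sum.inl (i, j)) => (Sum.inl i, Sum.inl j)
  | Sum.inl (Sum.inr (a, b)) => (Sum.inr a, Sum.inr b)
  | Sum.inr (Sum.inl (i, b)) => (Sum.inl i, Sum.inr b)
  | Sum.inr (Sum.inr (a, j)) => (Sum.inr a, Sum.inl j)

/-- The generator at a given place. -/
def genAt {m n : ℕ} : Idx m n → Idx m n → EvenGen m n ⊕ OddGen m n
  | Sum.inl i, Sum.inl j => Sum.inl (Sum.inl (i, j))
  | Sum.inr a, Sum.inr b => Sum.inl (Sum.inr (a, b))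
  | Sum.inl i, Sum.inr b => Sum.inr (Sum.inl (i, b))
  | Sum.inr a, Sum.inl j => Sum.inr (Sum.inr (a, j))

/-- The matrix of indeterminates `(x ξ; γ y)`. -/
def generic (m n : ℕ) : Mat m n (glCoord m n) :=
  Matrix.of fun i j => (SuperAlg.gen (genAt i j) : SuperAlg.FreeCarrier (EvenGen m n) (OddGen m n))

/-- The morphism `ℂ[𝔤𝔩_{m|n}] → A` given by a matrix in `𝔤𝔩_{m|n}(A)`. -/
def glPoint {m n : ℕ} {A : SuperAlg} (M : gl m n A) : glCoord m n ⟶ A :=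
  SuperAlg.freeDesc (fun x => M.1 (place x).1 (place x).2)
    (by
      rintro (⟨i, j⟩ | ⟨i, j⟩)
      · exact M.2 (Sum.inl i) (Sum.inl j)
      · exact M.2 (Sum.inr i) (Sum.inr j))
    (by
      rintro (⟨i, j⟩ | ⟨i, j⟩)
      · exact M.2 (Sum.inl i) (Sum.inr j)
      · exact M.2 (Sum.inr i) (Sum.inl j))

theorem generic_map {m n : ℕ} {A : SuperAlg} (M : gl m n A) :
    (generic m n).map (SuperAlg.hom (glPoint M)) = M.1 := by
  ext i j
  refine (SuperAlg.freeDesc_gen _ _ _ _).trans ?_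
  rcases i with i | i <;> rcases j with j | j <;> rfl

/-- The coordinate superalgebra `ℂ[𝔤]`: the quotient of `ℂ[𝔤𝔩_{m|n}]` by the equations of `𝔤`. -/
def coord (t : Series) (m n : ℕ) : SuperAlg :=
  SuperAlg.quot (glCoord m n) (lieEquations t (generic m n))

/-- The morphism `ℂ[𝔤] → A` that corresponds to `X ∈ 𝔤(A)`: the evaluation of polynomials on `𝔤`
at `X`. -/
def point {t : Series} {m n : ℕ} {A : SuperAlg} (X : Lie t m n A) : coord t m n ⟶ A :=
  SuperAlg.quotDesc _ _ (glPoint X.1) (by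
    intro s hs
    refine X.2 _ ?_
    rw [← generic_map X.1, lieEquations_map]
    exact ⟨s, hs, rfl⟩)

/-- The value `p(X)` of a polynomial `p ∈ ℂ[𝔤]` at `X ∈ 𝔤(A)`. -/
def value {t : Series} {m n : ℕ} {A : SuperAlg} (p : coord t m n) (X : Lie t m n A) : A :=
  SuperAlg.hom (point X) p

/-- `p` is invariant: `p(Ad_g X) = p(X)` for every superalgebra `A`, `g ∈ G(A)`, `X ∈ 𝔤(A)`. -/
def IsInvariantPoly {t : Series} {m n : ℕ} (p : coord t m n) : Prop :=
  ∀ (A : SuperAlg) (g : Grp t m n A) (X : Lie t m n A), value p (Ad g X) = value p X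

/-- The complex number `p(X)`, for `X ∈ 𝔤(ℂ)`. -/
def cvalue {t : Series} {m n : ℕ} (p : coord t m n) (X : Lie t m n SuperAlg.base) : ℂ :=
  value p X

/-- The ideal, in `ℂ[𝔤°] = ℂ[𝔤]/(odd part)`, of the orbit `{Ad_g X₀ | g ∈ G(ℂ)}`: the functions
that vanish at all points of the orbit. -/
def orbitIdeal {t : Series} {m n : ℕ} (X₀ : Lie t m n SuperAlg.base) :
    Ideal (coord t m n).Red :=
  ⨅ g : Grp t m n SuperAlg.base, RingHom.ker (SuperAlg.redEval (point (Ad g X₀)))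

/-- The complex matrix underlying `X ∈ 𝔤(ℂ)`. -/
def cmatrix {t : Series} {m n : ℕ} (X : Lie t m n SuperAlg.base) :
    Matrix (Idx m n) (Idx m n) ℂ := X.1.1

/-- The complex `(m+n) × (m+n)` matrix `X₀ ∈ 𝔤(ℂ)` has `m + n` distinct eigenvalues. -/
def HasDistinctEigenvalues {t : Series} {m n : ℕ} (X₀ : Lie t m n SuperAlg.base) : Prop :=
  (cmatrix X₀).charpoly.roots.Nodup

/-- The superalgebra `A_{X₀} = ℂ[𝔤]/(p̂₁ - c₁, …, p̂_l - c_l)`, where `cᵢ = p̂ᵢ(X₀)`. -/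
def orbitAlg {t : Series} {m n l : ℕ} (p : Fin l → coord t m n)
    (X₀ : Lie t m n SuperAlg.base) : SuperAlg :=
  SuperAlg.quot (coord t m n)
    (Set.range fun i => p i - algebraMap ℂ (coord t m n) (cvalue (p i) X₀))

end SuperOrbit

end

open SuperOrbit

/-! Evaluation embeds the orbit functor in the functor corepresented by `orbitAlg p X₀`: invariance
makes the `p i` constant on orbits over every superalgebra, and a point of `𝔤` is determined by its
coordinates. A corepresentable functor is local (`isLocal_coyoneda`), and a subfunctor that contains
the universal point over some Zariski cover has it as sheafification (`isSheafification_of_cover`).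
What remains is `exists_cover`: a point `Y` of `𝔤(A)` at which every `p i` takes the value `cᵢ` is,
locally on `A₀`, of the form `Ad_g X₀`.

The coefficients of the characteristic polynomials of the two diagonal blocks are constant on the
complex orbit, so up to constants they lie in the ideal generated by the `pᵢ - cᵢ`. Hence, modulo
odd elements, the blocks of `Y` have the characteristic polynomials of the blocks of `X₀`
(`charpoly_block_eq`). By Cayley–Hamilton `∏ (Y - λₖ)` is nilpotent, and the Chinese remainder
theorem provides polynomials `eₖ` for which the `eₖ(Y)` are spectral idempotents. Near a maximal
ideal of `A₀`, eigenvectors over the residue field are lifted and projected by the `eₖ(Y)`; this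
gives an invertible `h` with `h⁻¹ Y h = diag(d)` and `dₖ - λₖ` nilpotent (`exists_frame`,
`exists_diagonal_of_frame`).

Let `h₀` diagonalize `X₀`. A diagonal matrix `z` is chosen so that `g = h z h₀⁻¹` lies in `G(A)`
(`exists_inGroup`). For `SL` one diagonal entry corrects the Berezinian. For `OSp` the form pairs
the eigenvectors of `λ` and `-λ`, through an involution `σ` of the indices, and the Gram matrices of
the two frames are matched by solving `zᵢ z_{σ(i)} = uᵢ`. A square root is needed only at the
eigenvalue `0`. Comparing determinants of the even blocks shows that `uᵢ` is then a square modulo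
nilpotents, hence a square because `2` is invertible; so a Zariski cover suffices
(`exists_sq_eq_mk_of_gram`, `exists_rescaling`).

Finally `g⁻¹ Y g = h₀ diag(d) h₀⁻¹` satisfies the same invariant equations and has even entries
only. The characteristic polynomials of its blocks are therefore equal to those of `X₀` over `A₀`
itself, nilpotents included, and distinctness of the `λₖ` forces `d = λ` (`eigenvalue_rigid`), that
is, `Y = Ad_g X₀` (`exists_eq_ad`). -/

noncomputable section

namespace SuperOrbit

namespace SuperAlg

/-! ### Gluing elements along localizations -/

theorem hom_toLoc_eq_zero_iff (A : SuperAlg) (f : A.even) (a : A) :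
    hom (A.toLoc f) a = 0 ↔ ∃ k : ℕ, f ^ k • a = 0 := by
  change locMk A f a = 0 ↔ _
  have h0 : locMk A f a = OreLocalization.oreDiv a 1 := rfl
  rw [h0, OreLocalization.zero_def, OreLocalization.oreDiv_eq_iff]
  constructor
  · rintro ⟨⟨_, k, rfl⟩, v, h1, h2⟩
    refine ⟨k, ?_⟩
    have h3 : (f : A) ^ k = v := by simpa using h2
    have h4 : v * a = 0 := by simpa using h1.symm
    rw [Subalgebra.smul_def]
    simpa [h3] using h4
  · rintro ⟨k, hk⟩
    refine ⟨⟨_, k, rfl⟩, (f : A) ^ k, ?_, by simp⟩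
    rw [Subalgebra.smul_def] at hk
    simpa using hk.symm

theorem exists_pow_mul_eq (A : SuperAlg) (f : A.even) (x : A.loc f) :
    ∃ (k : ℕ) (a : A), hom (A.toLoc f) f ^ k * x = hom (A.toLoc f) a := by
  induction x using OreLocalization.ind with | _ a s
  obtain ⟨_, k, rfl⟩ := s
  refine ⟨k, a, ?_⟩
  rw [← map_pow]
  change locMk A f _ * _ = locMk A f a
  rw [loc_eq, ← mul_assoc]
  have h1 : locMk A f ((f : A) ^ k) * (OreLocalization.oreDiv 1 ⟨(f : A) ^ k, k, rfl⟩ : LocCarrier A f) = 1 :=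
    (OreLocalization.numeratorUnit (⟨(f : A) ^ k, k, rfl⟩ : Submonoid.powers (f : A))).mul_inv
  exact (congrArg (· * locMk A f a) h1).trans (one_mul _)

theorem isUnit_hom_toLoc (A : SuperAlg) (f : A.even) : IsUnit (hom (A.toLoc f) f) :=
  isUnit_locMk A f

theorem locRes_toLoc (A : SuperAlg) (f g : A.even) (h : f ∣ g) (a : A) :
    hom (A.locRes f g h) (hom (A.toLoc f) a) = hom (A.toLoc g) a :=
  congrArg (fun φ => hom φ a) (toLoc_desc A f (A.toLoc g) (isUnit_toLoc_of_dvd A f g h))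

theorem hom_smul {A B : SuperAlg} (φ : A ⟶ B) (f : A.even) (a : A) :
    hom φ (f • a) = hom φ f * hom φ a := by
  rw [Subalgebra.smul_def, smul_eq_mul, map_mul]

/-- Regarding `A` as a module over the commutative ring `A₀` reduces this to the usual fact about
submodules, applied to the zero submodule. -/
theorem eq_zero_of_cover (A : SuperAlg) {s : ℕ} (f : Fin s → A.even)
    (hf : Ideal.span (Set.range f) = ⊤) (a : A) (h : ∀ i, hom (A.toLoc (f i)) a = 0) : a = 0 := by
  choose k hk using fun i => (hom_toLoc_eq_zero_iff A (f i) a).1 (h i)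
  refine Submodule.mem_of_span_eq_top_of_smul_pow_mem (R := A.even) (⊥ : Submodule A.even A) _ hf a ?_
  rintro ⟨_, i, rfl⟩
  exact ⟨k i, hk i⟩

theorem ext_of_cover (A : SuperAlg) {s : ℕ} (f : Fin s → A.even)
    (hf : Ideal.span (Set.range f) = ⊤) {a b : A}
    (h : ∀ i, hom (A.toLoc (f i)) a = hom (A.toLoc (f i)) b) : a = b :=
  sub_eq_zero.1 (eq_zero_of_cover A f hf _ fun i => by rw [map_sub, h, sub_self])

/-- The partition of unity argument for modules over a commutative ring works because all
denominators are even, hence central. -/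
theorem exists_glue (A : SuperAlg) {s : ℕ} (f : Fin s → A.even)
    (hf : Ideal.span (Set.range f) = ⊤) (x : ∀ i, A.loc (f i))
    (hx : ∀ i j, hom (A.locRes (f i) (f i * f j) (dvd_mul_right _ _)) (x i)
      = hom (A.locRes (f j) (f i * f j) (dvd_mul_left _ _)) (x j)) :
    ∃ a : A, ∀ i, hom (A.toLoc (f i)) a = x i := by
  obtain ⟨N, a, ha⟩ : ∃ (N : ℕ) (a : Fin s → A),
      ∀ i, hom (A.toLoc (f i)) (f i) ^ N * x i = hom (A.toLoc (f i)) (a i) := by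
    choose k a ha using fun i => exists_pow_mul_eq A (f i) (x i)
    refine ⟨∑ i, k i, fun i => f i ^ (∑ i, k i - k i) • a i, fun i => ?_⟩
    have h1 : k i ≤ ∑ i, k i := Finset.single_le_sum (fun _ _ => Nat.zero_le _) (Finset.mem_univ i)
    rw [hom_smul, ← ha, ← mul_assoc, SubmonoidClass.coe_pow, map_pow, ← pow_add,
      Nat.sub_add_cancel h1]
  have hz : ∀ i j, ∃ M : ℕ, (f i * f j) ^ M • (f j ^ N • a i - f i ^ N • a j) = 0 := by
    intro i j
    rw [← hom_toLoc_eq_zero_iff]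
    have h1 := congrArg (hom (A.locRes (f i) (f i * f j) (dvd_mul_right _ _))) (ha i)
    have h2 := congrArg (hom (A.locRes (f j) (f i * f j) (dvd_mul_left _ _))) (ha j)
    rw [map_mul, map_pow, locRes_toLoc, locRes_toLoc] at h1 h2
    have h3 : Commute (hom (A.toLoc (f i * f j)) (f i)) (hom (A.toLoc (f i * f j)) (f j)) :=
      (A.loc (f i * f j)).even_comm _ (hom_even _ (f i).2) _
    rw [map_sub, hom_smul, hom_smul, SubmonoidClass.coe_pow, SubmonoidClass.coe_pow, map_pow,
      map_pow, ← h1, ← h2, hx i j, ← mul_assoc, ← mul_assoc, (h3.pow_pow N N).eq, sub_self]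
  -- The sum of all the exponents serves as a common bound, as it did for `N`.
  obtain ⟨M, hM⟩ : ∃ M : ℕ, ∀ i j, (f i * f j) ^ M • (f j ^ N • a i - f i ^ N • a j) = 0 := by
    choose k hk using hz
    refine ⟨∑ i, ∑ j, k i j, fun i j => ?_⟩
    have h1 : k i j ≤ ∑ i, ∑ j, k i j :=
      (Finset.single_le_sum (f := fun j => k i j) (fun _ _ => Nat.zero_le _)
        (Finset.mem_univ j)).trans
      (Finset.single_le_sum (f := fun i => ∑ j, k i j) (fun _ _ => Nat.zero_le _)
        (Finset.mem_univ i))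
    rw [← Nat.sub_add_cancel h1, pow_add, mul_smul, hk, smul_zero]
  have htop : Ideal.span (Set.range fun i => f i ^ (N + M)) = ⊤ := by
    have := Ideal.span_pow_eq_top _ hf (N + M)
    rwa [← Set.range_comp] at this
  obtain ⟨g, hg⟩ := Ideal.mem_span_range_iff_exists_fun.1 ((Ideal.eq_top_iff_one _).1 htop)
  -- Formally `xᵢ = aᵢ / fᵢ^N` and `1 = ∑ gᵢ fᵢ^(N+M)`, so the glued element should be `∑ gᵢ
  -- fᵢ^(N+M) xᵢ = ∑ gᵢ fᵢ^M aᵢ`.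
  refine ⟨∑ i, (g i * f i ^ M) • a i, fun j => ?_⟩
  have key : f j ^ (N + M) • ∑ i, (g i * f i ^ M) • a i = f j ^ M • a j := by
    rw [Finset.smul_sum]
    have h1 : ∀ i, f j ^ (N + M) • (g i * f i ^ M) • a i
        = (g i * f i ^ (N + M)) • f j ^ M • a j := by
      intro i
      have h2 := hM i j
      rw [smul_sub, sub_eq_zero, smul_smul, smul_smul] at h2
      have h3 : f j ^ (N + M) • (g i * f i ^ M) • a i
          = g i • ((f i * f j) ^ M * f j ^ N) • a i := by
        rw [smul_smul, smul_smul]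
        congr 1
        ring
      rw [h3, h2, smul_smul, smul_smul]
      congr 1
      ring
    rw [Finset.sum_congr rfl fun i _ => h1 i, ← Finset.sum_smul, hg, one_smul]
  have h1 := congrArg (hom (A.toLoc (f j))) key
  rw [hom_smul, hom_smul, ← ha j, SubmonoidClass.coe_pow, SubmonoidClass.coe_pow, map_pow, map_pow,
    ← mul_assoc, ← pow_add, add_comm M N] at h1
  exact ((isUnit_hom_toLoc A (f j)).pow (N + M)).mul_left_cancel h1

/-! ### Locality of corepresentable functors, and base change of covers -/

theorem hom_parity {A B : SuperAlg} (φ : A ⟶ B) (a : A) :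
    hom φ (A.parity a) = B.parity (hom φ a) := by
  obtain ⟨b, hb, c, hc, rfl⟩ := A.exists_add a
  simp [parity_even hb, parity_odd hc, parity_even (hom_even φ hb), parity_odd (hom_odd φ hc)]

/-- Morphisms are glued element by element. Uniqueness of glued elements makes the result an algebra
homomorphism that commutes with `parity`, and commuting with `parity` is the same as preserving the
grading. -/
theorem isLocal_coyoneda (P : SuperAlg) : IsLocal (coyoneda.obj (Opposite.op P)) := by
  intro A s f hf x hx
  change ∀ i, P ⟶ A.loc (f i) at x
  have hx' : ∀ i j, x i ≫ A.locRes (f i) (f i * f j) (dvd_mul_right _ _)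
      = x j ≫ A.locRes (f j) (f i * f j) (dvd_mul_left _ _) := hx
  choose y hy using fun a : P => exists_glue A f hf (fun i => hom (x i) a)
    (fun i j => congrArg (fun φ => hom φ a) (hx' i j))
  have ext : ∀ a b : A, (∀ i, hom (A.toLoc (f i)) a = hom (A.toLoc (f i)) b) → a = b :=
    fun _ _ => ext_of_cover A f hf
  have hpar : ∀ a, y (P.parity a) = A.parity (y a) := fun a => ext _ _ fun i => by
    rw [hy, hom_parity, hom_parity, hy]
  let F : P →ₐ[ℂ] A :=
    { toFun := y
      map_one' := ext _ _ fun i => by rw [hy, map_one, map_one]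
      map_mul' := fun a b => ext _ _ fun i => by rw [hy, map_mul, map_mul, hy, hy]
      map_zero' := ext _ _ fun i => by rw [hy, map_zero, map_zero]
      map_add' := fun a b => ext _ _ fun i => by rw [hy, map_add, map_add, hy, hy]
      commutes' := fun c => ext _ _ fun i => by rw [hy, AlgHom.commutes, AlgHom.commutes] }
  let φ : P ⟶ A :=
    { toAlgHom := F
      map_even := fun a ha => A.mem_even_of_parity ((hpar a).symm.trans (congrArg y (parity_even ha)))
      map_odd := fun a ha => A.mem_odd_of_parity ((hpar a).symm.trans
        ((congrArg y (parity_odd ha)).trans (map_neg F a))) }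
  refine ⟨φ, fun i => hom_ext (AlgHom.ext fun a => hy a i), fun ψ hψ => ?_⟩
  refine hom_ext (AlgHom.ext fun a => ext _ _ fun i => ?_)
  have h1 : ψ ≫ A.toLoc (f i) = x i := hψ i
  exact (congrArg (fun χ => hom χ a) h1).trans (hy a i).symm

/-- The morphism `A_f → B_{φ(f)}` induced by `φ : A → B`. -/
def locMap {A B : SuperAlg} (φ : A ⟶ B) (f : A.even) : A.loc f ⟶ B.loc (evenHom φ f) :=
  locDesc A f (φ ≫ B.toLoc (evenHom φ f)) (isUnit_hom_toLoc B (evenHom φ f))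

theorem toLoc_locMap {A B : SuperAlg} (φ : A ⟶ B) (f : A.even) :
    A.toLoc f ≫ locMap φ f = φ ≫ B.toLoc (evenHom φ f) :=
  toLoc_desc A f _ _

theorem span_evenHom {A B : SuperAlg} (φ : A ⟶ B) {s : ℕ} (f : Fin s → A.even)
    (hf : Ideal.span (Set.range f) = ⊤) :
    Ideal.span (Set.range fun i => evenHom φ (f i)) = ⊤ := by
  have := congrArg (Ideal.map (evenHom φ)) hf
  rwa [Ideal.map_span, Ideal.map_top, ← Set.range_comp] at this

end SuperAlg

open SuperAlg

/-! ### Sheafification of subfunctors of corepresentable functors -/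

theorem IsLocal.ext {L : SuperAlg ⥤ Type} (hL : IsLocal L) {A : SuperAlg} {s : ℕ}
    (f : Fin s → A.even) (hf : Ideal.span (Set.range f) = ⊤) {a b : L.obj A}
    (h : ∀ i, L.map (A.toLoc (f i)) a = L.map (A.toLoc (f i)) b) : a = b := by
  have hr : ∀ (c g : A.even) (hcg : c ∣ g), L.map (A.locRes c g hcg) (L.map (A.toLoc c) b)
      = L.map (A.toLoc g) b := fun c g hcg => by
    rw [← ConcreteCategory.comp_apply, ← L.map_comp]
    exact congrArg (fun φ => L.map φ b) (toLoc_desc A c (A.toLoc g) (isUnit_toLoc_of_dvd A c g hcg))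
  exact (hL A s f hf (fun i => L.map (A.toLoc (f i)) b) fun i j => by rw [hr, hr]).unique h
    fun i => rfl

/-- A subfunctor of a corepresentable functor `Hom(P, -)` that contains the universal point
locally has `Hom(P, -)` as its sheafification. -/
theorem isSheafification_of_cover {F : SuperAlg ⥤ Type} {P : SuperAlg}
    (η : F ⟶ coyoneda.obj (Opposite.op P)) (hinj : ∀ A, Function.Injective (η.app A))
    {s : ℕ} (f : Fin s → P.even) (hf : Ideal.span (Set.range f) = ⊤)
    (y : ∀ i, F.obj (P.loc (f i))) (hy : ∀ i, η.app _ (y i) = P.toLoc (f i)) :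
    IsSheafification η := by
  refine ⟨isLocal_coyoneda P, fun L hL θ => ?_⟩
  have hη : ∀ {A B : SuperAlg} (φ : A ⟶ B) (x : F.obj A),
      η.app B (F.map φ x) = (show P ⟶ A from η.app A x) ≫ φ := fun φ x =>
    congrArg (fun ψ => ψ x) (congrArg ConcreteCategory.hom (η.naturality φ))
  have hθ : ∀ {A B : SuperAlg} (φ : A ⟶ B) (x : F.obj A),
      θ.app B (F.map φ x) = L.map φ (θ.app A x) := fun φ x =>
    congrArg (fun ψ => ψ x) (congrArg ConcreteCategory.hom (θ.naturality φ))
  have hcomp : ∀ {A B C : SuperAlg} (φ : A ⟶ B) (ψ : B ⟶ C) (x : L.obj A),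
      L.map (φ ≫ ψ) x = L.map ψ (L.map φ x) := fun φ ψ x => by
    rw [L.map_comp, ConcreteCategory.comp_apply]
  have hy' : ∀ i, (show P ⟶ P.loc (f i) from η.app _ (y i)) = P.toLoc (f i) := hy
  -- By Yoneda, a transformation from `Hom(P, -)` to `L` is an element `u` of `L(P)`, and `θ`
  -- prescribes it on the cover. The prescriptions agree on overlaps because the restrictions of the
  -- `y i` do: `η` is injective and sends both to the localization of `P` at `f i * f j`.
  obtain ⟨u, hu, -⟩ := hL P s f hf (fun i => θ.app _ (y i)) fun i j => by
    rw [← hθ, ← hθ]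
    congr 1
    apply hinj
    rw [hη, hη, hy', hy']
    exact (toLoc_desc _ _ _ _).trans (toLoc_desc _ _ _ _).symm
  let θ' : coyoneda.obj (Opposite.op P) ⟶ L :=
    { app := fun A => TypeCat.ofHom fun φ : P ⟶ A => L.map φ u
      naturality := fun A B φ => by
        ext ψ
        exact hcomp (show P ⟶ A from ψ) φ u }
  refine ⟨θ', ?_, fun θ'' h'' => ?_⟩
  · ext A x
    change L.map (show P ⟶ A from η.app A x) u = θ.app A x
    generalize hφ : (show P ⟶ A from η.app A x) = φ
    -- The cover of `P` is pushed along `φ` to a cover of `A`; on its `i`-th piece `x` becomes the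
    -- base change of `y i`, again by injectivity of `η`.
    refine hL.ext _ (span_evenHom φ f hf) fun i => ?_
    rw [← hcomp, ← toLoc_locMap, hcomp, hu, ← hθ, ← hθ]
    congr 1
    apply hinj
    rw [hη, hη, hy', toLoc_locMap, hφ]
  -- A transformation out of `Hom(P, -)` is determined by its value at the identity, and locality of
  -- `L` lets this value be compared with `u` on the cover.
  · have h1 : θ''.app P (𝟙 P) = u := by
      refine hL.ext f hf fun i => ?_
      have h2 : L.map (P.toLoc (f i)) (θ''.app P (𝟙 P))
          = θ''.app _ ((coyoneda.obj (Opposite.op P)).map (P.toLoc (f i)) (𝟙 P)) :=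
        (congrArg (fun ψ => ψ (𝟙 P)) (congrArg ConcreteCategory.hom
          (θ''.naturality (P.toLoc (f i))))).symm
      have h3 : (coyoneda.obj (Opposite.op P)).map (P.toLoc (f i)) (𝟙 P) = η.app _ (y i) := by
        rw [hy]
        exact Category.id_comp (P.toLoc (f i))
      rw [h2, h3, hu, ← h'']
      rfl
    ext A φ
    change P ⟶ A at φ
    change θ''.app A φ = L.map φ u
    rw [← h1]
    have h2 := congrArg (fun ψ => ψ (𝟙 P)) (congrArg ConcreteCategory.hom (θ''.naturality φ))
    refine Eq.trans ?_ h2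
    exact congrArg (θ''.app A) (Category.id_comp φ).symm

end SuperOrbit

end

noncomputable section

namespace SuperOrbit

open SuperAlg

/-! ### Ring homomorphisms that vanish on the odd part -/

namespace SuperAlg

theorem ev_coe (A : SuperAlg) {a : A} (h : a ∈ A.even) : (A.ev a : A) = a :=
  congrArg Subtype.val (A.ev_even ⟨a, h⟩)

theorem map_ev {A : SuperAlg} {R : Type*} [Ring R] (F : A →+* R) (hF : ∀ a ∈ A.odd, F a = 0)
    (a : A) : F (A.ev a) = F a :=
  (sub_eq_zero.1 ((map_sub F _ _).symm.trans (hF _ (A.sub_ev_mem a)))).symm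

/-- The ring homomorphism `A → K`, `a₀ + a₁ ↦ ρ(a₀)`, into a reduced ring `K`. -/
def evHom (A : SuperAlg) {K : Type*} [CommRing K] [IsReduced K] (ρ : A.even →+* K) : A →+* K where
  toFun a := ρ (A.ev a)
  map_one' := by
    rw [show A.ev 1 = 1 from A.ev_even 1, map_one]
  map_zero' := by rw [map_zero, map_zero]
  map_add' a b := by rw [map_add, map_add]
  map_mul' x y := by
    obtain ⟨a, ha, b, hb, rfl⟩ := A.exists_add x
    obtain ⟨c, hc, d, hd, rfl⟩ := A.exists_add y
    have e1 : A.ev a = ⟨a, ha⟩ := A.ev_even ⟨a, ha⟩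
    have e2 : A.ev c = ⟨c, hc⟩ := A.ev_even ⟨c, hc⟩
    have e3 : A.ev (a * c) = ⟨a, ha⟩ * ⟨c, hc⟩ := A.ev_even (⟨a, ha⟩ * ⟨c, hc⟩)
    have e4 : A.ev (b * d) = ⟨b * d, A.odd_mul_odd b hb d hd⟩ := A.ev_even ⟨b * d, _⟩
    -- Multiplicativity rests on this: a product of two odd elements is nilpotent, so it vanishes in
    -- the reduced ring `K`.
    have e5 : ρ (⟨b * d, A.odd_mul_odd b hb d hd⟩) = 0 :=
      ((odd_mul_nilpotent A hb hd).map ρ).eq_zero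
    simp only [add_mul, mul_add, map_add, e1, e2, e3, e4, e5, A.ev_odd hb, A.ev_odd hd,
      A.ev_odd (A.even_mul_odd a ha d hd), A.ev_odd (A.odd_mul_even hb hc), map_mul, map_zero,
      add_zero]

section evHom

variable (A : SuperAlg) {K : Type*} [CommRing K] [IsReduced K] (ρ : A.even →+* K)

theorem evHom_apply (a : A) : A.evHom ρ a = ρ (A.ev a) := rfl

theorem evHom_coe (a : A.even) : A.evHom ρ a = ρ a := congrArg ρ (A.ev_even a)

theorem evHom_odd {a : A} (h : a ∈ A.odd) : A.evHom ρ a = 0 := by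
  rw [evHom_apply, A.ev_odd h, map_zero]

end evHom

/-- The factorization through `A°` of a ring homomorphism that vanishes on the odd part. -/
def redLift {A : SuperAlg} {R : Type} [CommRing R] (F : A →+* R) (hF : ∀ a ∈ A.odd, F a = 0) :
    Red A →+* R :=
  RingQuot.lift (r := fun a b : A => a ∈ A.odd ∧ b = 0) ⟨F, by
    rintro a b ⟨ha, rfl⟩
    rw [map_zero, hF a ha]⟩

theorem redLift_toRed {A : SuperAlg} {R : Type} [CommRing R] (F : A →+* R)
    (hF : ∀ a ∈ A.odd, F a = 0) (a : A) : redLift F hF (toRed A a) = F a :=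
  RingQuot.lift_mkRingHom_apply F _ a

end SuperAlg

/-- Since `A` is not commutative, the characteristic polynomial is formed from the even parts of the
entries. A homomorphism that kills odd elements does not see the difference. -/
theorem map_charpoly_coeff {A : SuperAlg} {R : Type*} [CommRing R] (F : A →+* R)
    (hF : ∀ a ∈ A.odd, F a = 0) {κ : Type*} [Fintype κ] [DecidableEq κ] (M : Matrix κ κ A)
    (k : ℕ) : F ((M.map A.ev).charpoly.coeff k : A.even) = (M.map F).charpoly.coeff k := by
  let ψ : A.even →+* R :=
    { toFun := fun a => F a
      map_one' := map_one F
      map_mul' := fun a b => map_mul F (a : A) (b : A)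
      map_zero' := map_zero F
      map_add' := fun a b => map_add F (a : A) (b : A) }
  have h1 : M.map F = (M.map A.ev).map ψ := by
    ext i j
    exact (map_ev F hF _).symm
  rw [h1, Matrix.charpoly_map, Polynomial.coeff_map]
  rfl

/-! ### The two diagonal blocks -/

/-- The embedding `b` of indices singles out a diagonal block of supermatrices. -/
structure IsBlock {m n : ℕ} {κ : Type*} (b : κ → Idx m n) : Prop where
  inj : Function.Injective b
  even : ∀ (A : SuperAlg) i j, slot A (b i) (b j) = Subalgebra.toSubmodule A.even
  odd : ∀ (A : SuperAlg) i j, j ∉ Set.range b → slot A (b i) j = A.odd ∧ slot A j (b i) = A.odd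

theorem isBlock_inl (m n : ℕ) : IsBlock (Sum.inl : Fin m → Idx m n) where
  inj := Sum.inl_injective
  even _ _ _ := rfl
  odd A i j hj := by
    rcases j with j | j
    · exact absurd ⟨j, rfl⟩ hj
    · exact ⟨rfl, rfl⟩

theorem isBlock_inr (m n : ℕ) : IsBlock (Sum.inr : Fin n → Idx m n) where
  inj := Sum.inr_injective
  even _ _ _ := rfl
  odd A i j hj := by
    rcases j with j | j
    · exact ⟨rfl, rfl⟩
    · exact absurd ⟨j, rfl⟩ hj

namespace IsBlock

variable {m n : ℕ} {κ : Type*} {b : κ → Idx m n} {A : SuperAlg}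

theorem mem_even (hb : IsBlock b) (M : gl m n A) (i j : κ) : M.1 (b i) (b j) ∈ A.even := by
  have h := M.2 (b i) (b j)
  rwa [hb.even] at h

/-- The terms of the matrix product that leave the block are products of odd entries, which `F`
kills. -/
theorem map_mul [Fintype κ] (hb : IsBlock b) {R : Type*} [Ring R] (F : A →+* R) (hF : ∀ a ∈ A.odd, F a = 0)
    (M N : gl m n A) :
    ((M.1 * N.1).submatrix b b).map F
      = (M.1.submatrix b b).map F * (N.1.submatrix b b).map F := by
  ext i j
  simp only [Matrix.map_apply, Matrix.submatrix_apply, Matrix.mul_apply, map_sum, _root_.map_mul]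
  refine (Fintype.sum_of_injective b hb.inj _ _ (fun k hk => ?_) fun k => rfl).symm
  have h := M.2 (b i) k
  rw [(hb.odd A i k hk).1] at h
  rw [hF _ h, zero_mul]

theorem map_one [DecidableEq κ] (hb : IsBlock b) {R : Type*} [Ring R] (F : A →+* R) :
    ((1 : gl m n A).1.submatrix b b).map F = 1 := by
  ext i j
  simp [Matrix.one_apply, hb.inj.eq_iff, apply_ite F]

end IsBlock

/-! ### Coordinates -/

theorem SuperAlg.hom_toQuot_eq_zero (P : SuperAlg) (S : Set P) {s : P} (hs : s ∈ S) :
    hom (toQuot P S) s = 0 := by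
  have h := congrArg₂ (· + ·) (quotMk_sub_ev P S hs) (quotMk_ev P S hs)
  exact (congrArg (quotMk P S) (sub_add_cancel s (P.ev s : P)).symm).trans
    ((map_add _ _ _).trans (h.trans (add_zero _)))

/-- The matrix of the coordinate functions on `𝔤`. -/
def coordMatrix (t : Series) (m n : ℕ) : Mat m n (coord t m n) :=
  (generic m n).map (hom (toQuot (glCoord m n) (lieEquations t (generic m n))))

theorem coordMatrix_map {t : Series} {m n : ℕ} {A : SuperAlg} (X : Lie t m n A) :
    (coordMatrix t m n).map (hom (point X)) = X.1.1 := by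
  rw [← generic_map X.1]
  ext i j
  exact congrArg (fun φ => hom φ (generic m n i j)) (toQuot_desc _ _ (glPoint X.1) _)

theorem coord_hom_ext {t : Series} {m n : ℕ} {A : SuperAlg} {φ ψ : coord t m n ⟶ A}
    (h : (coordMatrix t m n).map (hom φ) = (coordMatrix t m n).map (hom ψ)) : φ = ψ := by
  refine hom_ext (AlgHom.ext fun x => ?_)
  obtain ⟨x, rfl⟩ := quotMk_surjective _ _ x
  refine free_induction (fun a => hom φ (quotMk (glCoord m n) _ a)
    = hom ψ (quotMk (glCoord m n) _ a)) ?_ ?_ ?_ ?_ x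
  · intro c
    have h1 : quotMk (glCoord m n) (lieEquations t (generic m n)) (algebraMap ℂ _ c)
      = algebraMap ℂ (coord t m n) c := AlgHom.commutes _ c
    exact (congrArg (hom φ) h1).trans (((hom φ).commutes c).trans
      (((hom ψ).commutes c).symm.trans (congrArg (hom ψ) h1.symm)))
  · intro x
    have h1 := congrFun (congrFun h (place x).1) (place x).2
    rcases x with (⟨i, j⟩ | ⟨i, j⟩) | (⟨i, j⟩ | ⟨i, j⟩) <;> exact h1
  · intro a b h1 h2
    have e := map_mul (quotMk (glCoord m n) (lieEquations t (generic m n))) a b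
    refine (congrArg (hom φ) e).trans (((map_mul (hom φ) _ _).trans ?_).trans
      (congrArg (hom ψ) e).symm)
    exact (congrArg₂ (· * ·) h1 h2).trans (map_mul (hom ψ) _ _).symm
  · intro a b h1 h2
    have e := map_add (quotMk (glCoord m n) (lieEquations t (generic m n))) a b
    refine (congrArg (hom φ) e).trans (((map_add (hom φ) _ _).trans ?_).trans
      (congrArg (hom ψ) e).symm)
    exact (congrArg₂ (· + ·) h1 h2).trans (map_add (hom ψ) _ _).symm

theorem point_lieMap {t : Series} {m n : ℕ} {A B : SuperAlg} (φ : A ⟶ B) (X : Lie t m n A) :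
    point (lieMap φ X) = point X ≫ φ := by
  refine coord_hom_ext ?_
  rw [coordMatrix_map]
  change X.1.1.map (hom φ) = _
  rw [← coordMatrix_map X]
  rfl

theorem point_injective {t : Series} {m n : ℕ} {A : SuperAlg} :
    Function.Injective (point : Lie t m n A → (coord t m n ⟶ A)) := fun X Y h => by
  apply Subtype.ext
  apply Subtype.ext
  rw [← coordMatrix_map X, h, coordMatrix_map]

theorem coordMatrix_mem (t : Series) (m n : ℕ) : coordMatrix t m n ∈ gl m n (coord t m n) := by
  intro i j
  refine slot_hom _ ?_
  rcases i with i | i <;> rcases j with j | j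
  · exact freeSign_even _
  · exact (congrArg (· + _) (freeSign_odd _)).trans (neg_add_cancel _)
  · exact (congrArg (· + _) (freeSign_odd _)).trans (neg_add_cancel _)
  · exact freeSign_even _

/-- The point of `𝔤(A)` given by a morphism `ℂ[𝔤] → A`. -/
def ofPoint {t : Series} {m n : ℕ} {A : SuperAlg} (φ : coord t m n ⟶ A) : Lie t m n A :=
  ⟨⟨(coordMatrix t m n).map (hom φ), fun i j => slot_hom φ (coordMatrix_mem t m n i j)⟩, by
    intro x hx
    change x ∈ lieEquations t ((coordMatrix t m n).map (hom φ)) at hx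
    rw [lieEquations_map] at hx
    obtain ⟨y, hy, rfl⟩ := hx
    obtain ⟨s, hs, rfl⟩ := (Set.ext_iff.1 (lieEquations_map (t := t)
      (toQuot (glCoord m n) (lieEquations t (generic m n))) (generic m n)) y).1 hy
    have h2 : hom (toQuot (glCoord m n) (lieEquations t (generic m n))) s = 0 :=
      hom_toQuot_eq_zero _ _ hs
    rw [h2]
    exact map_zero (hom φ)⟩

theorem point_ofPoint {t : Series} {m n : ℕ} {A : SuperAlg} (φ : coord t m n ⟶ A) :
    point (ofPoint φ) = φ :=
  coord_hom_ext (coordMatrix_map _)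

/-- The identity of `ℂ`, as a ring homomorphism. -/
def idBase : SuperAlg.base →+* ℂ := RingHom.id ℂ

/-- The block of `g⁻¹` is inverse to the block of `g` after applying `F`, so the block of `Ad g X`
is a conjugate of the block of `X`. -/
theorem charpoly_block_conj {t : Series} {m n : ℕ} (g : Grp t m n SuperAlg.base)
    (X : Lie t m n SuperAlg.base) {κ : Type} [Fintype κ] [DecidableEq κ] {b : κ → Idx m n}
    (hb : IsBlock b) {R : Type*} [CommRing R] (F : SuperAlg.base →+* R)
    (hF : ∀ a ∈ SuperAlg.base.odd, F a = 0) :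
    (((Ad g X).1.1.submatrix b b).map F).charpoly = ((X.1.1.submatrix b b).map F).charpoly := by
  let u : (Matrix κ κ R)ˣ :=
    ⟨(g.1.1.1.submatrix b b).map F, ((g.1⁻¹).1.1.submatrix b b).map F, by
      rw [← hb.map_mul F hF, ← hb.map_one F]
      exact congrArg (fun M : gl m n base => (M.1.submatrix b b).map F) g.1.mul_inv, by
      rw [← hb.map_mul F hF, ← hb.map_one F]
      exact congrArg (fun M : gl m n base => (M.1.submatrix b b).map F) g.1.inv_mul⟩
  rw [← Matrix.charpoly_units_conj u ((X.1.1.submatrix b b).map F)]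
  congr 1
  change (((g.1.1 * X.1).1 * (g.1⁻¹).1.1).submatrix b b).map F = _
  rw [hb.map_mul F hF]
  change (((g.1.1).1 * X.1.1).submatrix b b).map F * _ = _
  rw [hb.map_mul F hF, ← Matrix.coe_units_inv]
  rfl

/-- On the zero locus of `p₁ - c₁, …, p_l - c_l` the characteristic polynomials of the diagonal
blocks agree, modulo the odd coordinates, with those of `X₀`. -/
theorem charpoly_block_eq {t : Series} {m n l : ℕ} {X₀ : Lie t m n SuperAlg.base}
    {p : Fin l → coord t m n}
    (hideal : orbitIdeal X₀ = Ideal.span (Set.range fun i =>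
      (coord t m n).toRed (p i - algebraMap ℂ (coord t m n) (cvalue (p i) X₀))))
    {R : Type} [CommRing R] (Φ : coord t m n →+* R) (hΦ : ∀ a ∈ (coord t m n).odd, Φ a = 0)
    (hp : ∀ i, Φ (p i) = Φ (algebraMap ℂ (coord t m n) (cvalue (p i) X₀)))
    {κ : Type} [Fintype κ] [DecidableEq κ] {b : κ → Idx m n} (hb : IsBlock b) :
    (((coordMatrix t m n).submatrix b b).map Φ).charpoly
      = ((cmatrix X₀).submatrix b b).charpoly.map (Φ.comp (algebraMap ℂ (coord t m n))) := by
  -- The hypothesis on the orbit ideal turns vanishing at the complex points of the orbit into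
  -- vanishing under `Φ`, whatever the ring `R`, even when it is not reduced.
  have hker : orbitIdeal X₀ ≤ RingHom.ker (redLift Φ hΦ) := by
    rw [hideal, Ideal.span_le]
    rintro _ ⟨i, rfl⟩
    rw [SetLike.mem_coe, RingHom.mem_ker, redLift_toRed, map_sub, sub_eq_zero, hp]
  ext k
  let a : coord t m n := (((coordMatrix t m n).submatrix b b).map (coord t m n).ev).charpoly.coeff k
    - algebraMap ℂ (coord t m n) (((cmatrix X₀).submatrix b b).charpoly.coeff k)
  have ha : (coord t m n).toRed a ∈ orbitIdeal X₀ := by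
    refine (Submodule.mem_iInf _).2 fun g => ?_
    rw [RingHom.mem_ker, redEval_toRed, map_sub, sub_eq_zero,
      map_charpoly_coeff _ (fun a ha => baseHom_odd _ ha)]
    have h1 : ((coordMatrix t m n).submatrix b b).map (baseHom (point (Ad g X₀)))
        = ((Ad g X₀).1.1.submatrix b b).map idBase := by
      rw [← coordMatrix_map (Ad g X₀)]
      rfl
    rw [h1, charpoly_block_conj g X₀ hb idBase (fun a ha => ha)]
    exact ((hom (point (Ad g X₀))).commutes _).symm
  have h1 := hker ha
  rw [RingHom.mem_ker, redLift_toRed, map_sub, sub_eq_zero, map_charpoly_coeff _ hΦ] at h1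
  rw [h1, Polynomial.coeff_map]
  rfl

end SuperOrbit

end

noncomputable section

namespace SuperOrbit

open SuperAlg

/-! ### Nilpotent and invertible supermatrices -/

namespace SuperAlg

instance (A : SuperAlg) : IsReduced (A.even ⧸ nilradical A.even) :=
  (Ideal.isRadical_iff_quotient_reduced _).1 (Ideal.radical_isRadical _)

/-- The projection of `A` to the reduction of `A₀`. -/
def nilHom (A : SuperAlg) : A →+* A.even ⧸ nilradical A.even :=
  A.evHom (Ideal.Quotient.mk _)

theorem nilHom_odd (A : SuperAlg) (a : A) (h : a ∈ A.odd) : A.nilHom a = 0 :=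
  A.evHom_odd _ h

theorem nilHom_coe (A : SuperAlg) (a : A.even) :
    A.nilHom a = Ideal.Quotient.mk (nilradical A.even) a :=
  A.evHom_coe _ a

theorem nilHom_eq_zero_iff (A : SuperAlg) (a : A) : A.nilHom a = 0 ↔ IsNilpotent (A.ev a) :=
  Ideal.Quotient.eq_zero_iff_mem.trans mem_nilradical

theorem isUnit_of_isUnit_mk_nilradical {R : Type*} [CommRing R] {a : R}
    (h : IsUnit (Ideal.Quotient.mk (nilradical R) a)) : IsUnit a := by
  have := isLocalHom_of_le_jacobson_bot (nilradical R) Ideal.radical_le_jacobson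
  exact isUnit_of_map_unit _ _ h

theorem mul_mem_smul_top {A : SuperAlg} {I J : Ideal A.even} {a b : A}
    (ha : a ∈ (I • ⊤ : Submodule A.even A)) (hb : b ∈ (J • ⊤ : Submodule A.even A)) :
    a * b ∈ ((I * J) • ⊤ : Submodule A.even A) := by
  induction ha using Submodule.smul_induction_on' with
  | smul i hi x _ =>
    induction hb using Submodule.smul_induction_on' with
    | smul j hj y _ =>
      have h : i • x * j • y = (i * j) • (x * y) := by
        simp only [Subalgebra.smul_def, smul_eq_mul, MulMemClass.coe_mul]
        rw [mul_assoc, ← mul_assoc x, ← A.even_comm _ j.2 x]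
        simp only [mul_assoc]
      rw [h]
      exact Submodule.smul_mem_smul (Ideal.mul_mem_mul hi hj) trivial
    | add y _ z _ h1 h2 => rw [mul_add]; exact Submodule.add_mem _ h1 h2
  | add y _ z _ h1 h2 => rw [add_mul]; exact Submodule.add_mem _ h1 h2

theorem pow_apply_mem {A : SuperAlg} {I : Ideal A.even} {ι : Type*} [Fintype ι] [DecidableEq ι]
    {M : Matrix ι ι A} (hM : ∀ i j, M i j ∈ (I • ⊤ : Submodule A.even A)) (k : ℕ) (i j : ι) :
    (M ^ k) i j ∈ (I ^ k • ⊤ : Submodule A.even A) := by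
  induction k generalizing i j with
  | zero => simp
  | succ k ih =>
    rw [pow_succ M, pow_succ I, Matrix.mul_apply]
    exact Submodule.sum_mem _ fun l _ => mul_mem_smul_top (ih i l) (hM l j)

end SuperAlg

theorem gl_even_or_odd {m n : ℕ} {A : SuperAlg} (M : gl m n A) (i j : Idx m n) :
    M.1 i j ∈ A.even ∨ M.1 i j ∈ A.odd := by
  rcases i with i | i <;> rcases j with j | j
  · exact Or.inl (M.2 (Sum.inl i) (Sum.inl j))
  · exact Or.inr (M.2 (Sum.inl i) (Sum.inr j))
  · exact Or.inr (M.2 (Sum.inr i) (Sum.inl j))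
  · exact Or.inl (M.2 (Sum.inr i) (Sum.inr j))

/-- The entries of `M` need not commute, and the odd ones lie in no ideal of `A₀`, so `M ^ 2` is
considered instead. Its entries lie in `I • A`, where `I` is generated by the even entries and the
even products of two entries. Being finitely generated inside the nilradical, `I` is nilpotent. -/
theorem gl_isNilpotent {m n : ℕ} {A : SuperAlg} (M : gl m n A)
    (h : ∀ i j, A.nilHom (M.1 i j) = 0) : IsNilpotent M := by
  let I : Ideal A.even := Ideal.span
    (Set.range (fun x : Idx m n × Idx m n => A.ev (M.1 x.1 x.2)) ∪
      Set.range fun x : Idx m n × Idx m n × Idx m n => A.ev (M.1 x.1 x.2.1 * M.1 x.2.1 x.2.2))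
  have hI : IsNilpotent I := by
    refine (Ideal.FG.isNilpotent_iff_le_nilradical ?_).2 ?_
    · exact Submodule.fg_span ((Set.finite_range _).union (Set.finite_range _))
    · refine Ideal.span_le.2 (Set.union_subset ?_ ?_)
      · rintro _ ⟨x, rfl⟩
        exact mem_nilradical.2 ((A.nilHom_eq_zero_iff _).1 (h _ _))
      · rintro _ ⟨x, rfl⟩
        refine mem_nilradical.2 ((A.nilHom_eq_zero_iff _).1 ?_)
        rw [map_mul, h, zero_mul]
  have hmul : ∀ i j k, M.1 i j * M.1 j k ∈ (I • ⊤ : Submodule A.even A) := by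
    intro i j k
    rcases gl_even_or_odd M i j with h1 | h1
    · have h2 : M.1 i j * M.1 j k = A.ev (M.1 i j) • M.1 j k := by
        rw [Subalgebra.smul_def, A.ev_coe h1, smul_eq_mul]
      rw [h2]
      exact Submodule.smul_mem_smul (Ideal.subset_span (Or.inl ⟨(i, j), rfl⟩)) trivial
    rcases gl_even_or_odd M j k with h2 | h2
    · have h3 : M.1 i j * M.1 j k = A.ev (M.1 j k) • M.1 i j := by
        rw [Subalgebra.smul_def, A.ev_coe h2, smul_eq_mul, A.even_comm _ h2]
      rw [h3]
      exact Submodule.smul_mem_smul (Ideal.subset_span (Or.inl ⟨(j, k), rfl⟩)) trivial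
    · have h3 : M.1 i j * M.1 j k = A.ev (M.1 i j * M.1 j k) • (1 : A) := by
        rw [Subalgebra.smul_def, A.ev_coe (A.odd_mul_odd _ h1 _ h2), smul_eq_mul, mul_one]
      rw [h3]
      exact Submodule.smul_mem_smul (Ideal.subset_span (Or.inr ⟨(i, j, k), rfl⟩)) trivial
  obtain ⟨N, hN⟩ := hI
  refine ⟨2 * N, Subtype.ext ?_⟩
  ext i j
  have h1 := pow_apply_mem (I := I) (M := M.1 ^ 2)
    (fun i j => by
      rw [pow_two, Matrix.mul_apply]
      exact Submodule.sum_mem _ fun k _ => hmul i k j) N i j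
  rw [hN, ← pow_mul] at h1
  simpa using h1

/-- The block diagonal supermatrix with given blocks. -/
def blockDiag {m n : ℕ} {A : SuperAlg} (a : Matrix (Fin m) (Fin m) A.even)
    (d : Matrix (Fin n) (Fin n) A.even) : gl m n A :=
  ⟨Matrix.fromBlocks (a.map fun x => (x : A)) 0 0 (d.map fun x => (x : A)), by
    rintro (i | i) (j | j)
    · exact (a i j).2
    · exact A.odd.zero_mem
    · exact A.odd.zero_mem
    · exact (d i j).2⟩

theorem gl_map_inl_inr {m n : ℕ} {A : SuperAlg} (M : gl m n A) (i : Fin m) (j : Fin n) :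
    M.1 (Sum.inl i) (Sum.inr j) ∈ A.odd := M.2 (Sum.inl i) (Sum.inr j)

theorem gl_map_inr_inl {m n : ℕ} {A : SuperAlg} (M : gl m n A) (i : Fin n) (j : Fin m) :
    M.1 (Sum.inr i) (Sum.inl j) ∈ A.odd := M.2 (Sum.inr i) (Sum.inl j)

theorem gl_isNilpotent_of_blocks {m n : ℕ} {A : SuperAlg} (M : gl m n A)
    (h1 : (M.1.submatrix Sum.inl Sum.inl).map A.nilHom = 0)
    (h2 : (M.1.submatrix Sum.inr Sum.inr).map A.nilHom = 0) : IsNilpotent M := by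
  refine gl_isNilpotent M ?_
  rintro (i | i) (j | j)
  · exact congrFun (congrFun h1 i) j
  · exact A.nilHom_odd _ (gl_map_inl_inr M i j)
  · exact A.nilHom_odd _ (gl_map_inr_inl M i j)
  · exact congrFun (congrFun h2 i) j

theorem map_ev_map_mk {A : SuperAlg} {κ : Type*} (M : Matrix κ κ A) :
    (M.map A.ev).map (Ideal.Quotient.mk (nilradical A.even)) = M.map A.nilHom := rfl

theorem blockDiag_inl {m n : ℕ} {A : SuperAlg} (a : Matrix (Fin m) (Fin m) A.even)
    (d : Matrix (Fin n) (Fin n) A.even) :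
    (blockDiag a d).1.submatrix Sum.inl Sum.inl = a.map fun x => (x : A) := rfl

theorem blockDiag_inr {m n : ℕ} {A : SuperAlg} (a : Matrix (Fin m) (Fin m) A.even)
    (d : Matrix (Fin n) (Fin n) A.even) :
    (blockDiag a d).1.submatrix Sum.inr Sum.inr = d.map fun x => (x : A) := rfl

theorem map_coe_map_nilHom {A : SuperAlg} {κ : Type*} (M : Matrix κ κ A.even) :
    (M.map fun x => (x : A)).map A.nilHom = M.map (Ideal.Quotient.mk (nilradical A.even)) :=
  Matrix.ext fun _ _ => A.nilHom_coe _

theorem gl_isUnit_of_blocks {m n : ℕ} {A : SuperAlg} (M : gl m n A)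
    (h1 : (M.1.submatrix Sum.inl Sum.inl).map A.nilHom = 1)
    (h2 : (M.1.submatrix Sum.inr Sum.inr).map A.nilHom = 1) : IsUnit M := by
  have hone : ∀ {κ : Type} [DecidableEq κ] (b : κ → Idx m n), IsBlock b →
      (M.1.submatrix b b).map A.nilHom = 1 → ((M - 1).1.submatrix b b).map A.nilHom = 0 := by
    intro κ _ b hb hX
    have h3 : ((M - 1).1.submatrix b b).map A.nilHom = (M.1.submatrix b b).map A.nilHom
        - ((1 : gl m n A).1.submatrix b b).map A.nilHom := by
      ext i j
      exact map_sub A.nilHom _ _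
    rw [h3, hb.map_one, hX, sub_self]
  rw [← sub_add_cancel M 1]
  exact IsNilpotent.isUnit_add_one (gl_isNilpotent_of_blocks _ (hone _ (isBlock_inl m n) h1)
    (hone _ (isBlock_inr m n) h2))

theorem isUnit_of_isUnit_mul_mul {R : Type*} [Monoid R] {x y : R} (h1 : IsUnit (x * y))
    (h2 : IsUnit (y * x)) : IsUnit x := by
  obtain ⟨u, hu⟩ := h1
  obtain ⟨v, hv⟩ := h2
  have hr : x * (y * ↑u⁻¹) = 1 := by rw [← mul_assoc, ← hu, Units.mul_inv]
  have hl : (↑v⁻¹ * y) * x = 1 := by rw [mul_assoc, ← hv, Units.inv_mul]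
  have h3 := left_inv_eq_right_inv hl hr
  exact ⟨⟨x, y * ↑u⁻¹, hr, by rw [← h3, hl]⟩, rfl⟩

/-- An even supermatrix whose diagonal blocks are invertible is invertible. -/
theorem gl_isUnit {m n : ℕ} {A : SuperAlg} (M : gl m n A)
    (h1 : IsUnit ((M.1.submatrix Sum.inl Sum.inl).map A.ev).det)
    (h2 : IsUnit ((M.1.submatrix Sum.inr Sum.inr).map A.ev).det) : IsUnit M := by
  -- With the block diagonal matrix of inverse blocks, both `M * C` and `C * M` have identity blocks
  -- modulo nilpotents, so each is the identity plus a nilpotent matrix.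
  obtain ⟨C, c1, c2⟩ : ∃ C : gl m n A,
      (C.1.submatrix Sum.inl Sum.inl).map A.nilHom
        = (((M.1.submatrix Sum.inl Sum.inl).map A.ev)⁻¹).map
          (Ideal.Quotient.mk (nilradical A.even)) ∧
      (C.1.submatrix Sum.inr Sum.inr).map A.nilHom
        = (((M.1.submatrix Sum.inr Sum.inr).map A.ev)⁻¹).map
          (Ideal.Quotient.mk (nilradical A.even)) :=
    ⟨blockDiag ((M.1.submatrix Sum.inl Sum.inl).map A.ev)⁻¹
      ((M.1.submatrix Sum.inr Sum.inr).map A.ev)⁻¹,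
      by rw [blockDiag_inl, map_coe_map_nilHom], by rw [blockDiag_inr, map_coe_map_nilHom]⟩
  have hMC : IsUnit (M * C) := by
    refine gl_isUnit_of_blocks _ ?_ ?_
    · refine ((isBlock_inl m n).map_mul A.nilHom A.nilHom_odd M C).trans ?_
      rw [c1, ← map_ev_map_mk, ← Matrix.map_mul, Matrix.mul_nonsing_inv _ h1,
        Matrix.map_one _ (map_zero _) (map_one _)]
    · refine ((isBlock_inr m n).map_mul A.nilHom A.nilHom_odd M C).trans ?_
      rw [c2, ← map_ev_map_mk, ← Matrix.map_mul, Matrix.mul_nonsing_inv _ h2,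
        Matrix.map_one _ (map_zero _) (map_one _)]
  have hCM : IsUnit (C * M) := by
    refine gl_isUnit_of_blocks _ ?_ ?_
    · refine ((isBlock_inl m n).map_mul A.nilHom A.nilHom_odd C M).trans ?_
      rw [c1, ← map_ev_map_mk, ← Matrix.map_mul, Matrix.nonsing_inv_mul _ h1,
        Matrix.map_one _ (map_zero _) (map_one _)]
    · refine ((isBlock_inr m n).map_mul A.nilHom A.nilHom_odd C M).trans ?_
      rw [c2, ← map_ev_map_mk, ← Matrix.map_mul, Matrix.nonsing_inv_mul _ h2,
        Matrix.map_one _ (map_zero _) (map_one _)]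
  exact isUnit_of_isUnit_mul_mul hMC hCM

theorem IsBlock.isUnit_det_map {m n : ℕ} {κ : Type*} [Fintype κ] [DecidableEq κ]
    {b : κ → Idx m n} (hb : IsBlock b) {A : SuperAlg} (g : GLmn m n A) {R : Type*} [CommRing R]
    (F : A →+* R) (hF : ∀ a ∈ A.odd, F a = 0) : IsUnit ((g.1.1.submatrix b b).map F).det := by
  have h : (g.1.1.submatrix b b).map F * ((g⁻¹).1.1.submatrix b b).map F = 1 := by
    rw [← hb.map_mul F hF, ← hb.map_one F]
    exact congrArg (fun M : gl m n A => (M.1.submatrix b b).map F) g.mul_inv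
  exact IsUnit.of_mul_eq_one _ ((Matrix.det_mul _ _).symm.trans ((congrArg _ h).trans Matrix.det_one))

theorem IsBlock.isUnit_det {m n : ℕ} {κ : Type*} [Fintype κ] [DecidableEq κ]
    {b : κ → Idx m n} (hb : IsBlock b) {A : SuperAlg} (g : GLmn m n A) :
    IsUnit ((g.1.1.submatrix b b).map A.ev).det := by
  refine isUnit_of_isUnit_mk_nilradical ?_
  rw [RingHom.map_det]
  exact hb.isUnit_det_map g A.nilHom A.nilHom_odd

/-! ### The Berezinian -/

/-- The projection to the even part is not multiplicative, because two odd factors have an even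
product, but it is linear over `A₀`. -/
theorem SuperAlg.ev_mul_even (A : SuperAlg) (x : A) {a : A} (ha : a ∈ A.even) :
    A.ev (x * a) = A.ev x * A.ev a := by
  obtain ⟨b, hb, c, hc, rfl⟩ := A.exists_add x
  have e1 : A.ev b = ⟨b, hb⟩ := A.ev_even ⟨b, hb⟩
  have e2 : A.ev a = ⟨a, ha⟩ := A.ev_even ⟨a, ha⟩
  have e3 : A.ev (b * a) = ⟨b, hb⟩ * ⟨a, ha⟩ := A.ev_even (⟨b, hb⟩ * ⟨a, ha⟩)
  rw [add_mul, map_add, map_add, e1, e2, e3, A.ev_odd hc, A.ev_odd (A.odd_mul_even hc ha),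
    add_zero, add_zero]

theorem map_ev_mul {A : SuperAlg} {ι : Type*} [Fintype ι] (M N : Matrix ι ι A)
    (hN : ∀ i j, N i j ∈ A.even) : (M * N).map A.ev = M.map A.ev * N.map A.ev := by
  ext i j
  simp [Matrix.mul_apply, map_sum, ev_mul_even, hN]

theorem map_coe_map_ev {A : SuperAlg} {ι : Type*} (N : Matrix ι ι A)
    (hN : ∀ i j, N i j ∈ A.even) : (N.map A.ev).map (fun x => (x : A)) = N := by
  ext i j
  exact A.ev_coe (hN i j)

theorem map_coe_mul {A : SuperAlg} {ι : Type*} [Fintype ι] (M N : Matrix ι ι A.even) :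
    (M * N).map (fun x => (x : A)) = M.map (fun x => (x : A)) * N.map (fun x => (x : A)) := by
  ext i j
  simp [Matrix.mul_apply]

/-- The Berezinian is multiplicative when the second factor is block diagonal. -/
theorem ber_mul_blockDiag {m n : ℕ} {A : SuperAlg} (M : gl m n A) (N : GLmn m n A)
    (h1 : N.1.1.toBlocks₁₂ = 0) (h2 : N.1.1.toBlocks₂₁ = 0) :
    ber (M * N.1).1 = ber M.1 * ber N.1.1 := by
  have hd : ∀ i j, N.1.1.toBlocks₂₂ i j ∈ A.even := fun i j => N.1.2 (Sum.inr i) (Sum.inr j)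
  have ha : ∀ i j, N.1.1.toBlocks₁₁ i j ∈ A.even := fun i j => N.1.2 (Sum.inl i) (Sum.inl j)
  have hdu := isUnit_det_block m n A N
  have hN : N.1.1 = Matrix.fromBlocks N.1.1.toBlocks₁₁ 0 0 N.1.1.toBlocks₂₂ := by
    conv_lhs => rw [← Matrix.fromBlocks_toBlocks N.1.1, h1, h2]
  have hMN : (M * N.1).1 = Matrix.fromBlocks (M.1.toBlocks₁₁ * N.1.1.toBlocks₁₁)
      (M.1.toBlocks₁₂ * N.1.1.toBlocks₂₂) (M.1.toBlocks₂₁ * N.1.1.toBlocks₁₁)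
      (M.1.toBlocks₂₂ * N.1.1.toBlocks₂₂) := by
    change M.1 * N.1.1 = _
    conv_lhs => rw [← Matrix.fromBlocks_toBlocks M.1, hN, Matrix.fromBlocks_multiply]
    simp
  have hdd : N.1.1.toBlocks₂₂ * ((N.1.1.toBlocks₂₂.map A.ev)⁻¹).map (fun x => (x : A)) = 1 := by
    conv_lhs => rw [← map_coe_map_ev _ hd]
    rw [← map_coe_mul, map_coe_map_ev _ hd, Matrix.mul_nonsing_inv _ hdu]
    ext i j
    simp [Matrix.one_apply, apply_ite (fun x : A.even => (x : A))]
  rw [ber, ber, ber, hMN]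
  simp only [Matrix.toBlocks_fromBlocks₁₁, Matrix.toBlocks_fromBlocks₁₂,
    Matrix.toBlocks_fromBlocks₂₁, Matrix.toBlocks_fromBlocks₂₂, h1, Matrix.zero_mul, sub_zero]
  generalize N.1.1.toBlocks₂₂ = d at *
  generalize N.1.1.toBlocks₁₁ = a at *
  rw [map_ev_mul _ _ hd, Matrix.mul_inv_rev, map_coe_mul]
  -- The inner factor `d d⁻¹` cancels, and the Schur complement of the product is that of `M` times
  -- `a`.
  have h3 : M.1.toBlocks₁₁ * a - M.1.toBlocks₁₂ * d * (((d.map A.ev)⁻¹).map (fun x => (x : A))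
      * ((M.1.toBlocks₂₂.map A.ev)⁻¹).map (fun x => (x : A))) * (M.1.toBlocks₂₁ * a)
      = (M.1.toBlocks₁₁ - M.1.toBlocks₁₂ * ((M.1.toBlocks₂₂.map A.ev)⁻¹).map (fun x => (x : A))
        * M.1.toBlocks₂₁) * a := by
    rw [Matrix.sub_mul, Matrix.mul_assoc M.1.toBlocks₁₂ d, ← Matrix.mul_assoc d, hdd,
      Matrix.one_mul]
    simp only [Matrix.mul_assoc]
  rw [h3, map_ev_mul _ _ ha, Matrix.det_mul, Matrix.det_mul]
  ring

/-- Modulo nilpotents the correction `q s⁻¹ r` disappears, and the Schur complement becomes the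
upper diagonal block, which is invertible. -/
theorem isUnit_ber {m n : ℕ} {A : SuperAlg} (g : GLmn m n A) : IsUnit (ber g.1.1) := by
  have hs := isUnit_det_block m n A g
  refine IsUnit.mul ?_ ?_
  · refine isUnit_of_isUnit_mk_nilradical ?_
    rw [RingHom.map_det]
    have h := (isBlock_inl m n).isUnit_det_map g A.nilHom A.nilHom_odd
    convert h using 2
    ext i j
    change A.nilHom _ = A.nilHom _
    rw [Matrix.sub_apply, map_sub, Matrix.mul_apply, map_sum]
    have h2 : ∀ k, A.nilHom ((g.1.1.toBlocks₁₂ *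
        (((g.1.1.toBlocks₂₂).map A.ev)⁻¹).map (fun x => (x : A))) i k * g.1.1.toBlocks₂₁ k j) = 0 :=
      fun k => by
        have h3 : g.1.1.toBlocks₂₁ k j ∈ A.odd := gl_map_inr_inl g.1 k j
        rw [map_mul, A.nilHom_odd _ h3, mul_zero]
    rw [Finset.sum_eq_zero fun k _ => h2 k, sub_zero]
    rfl
  · exact Matrix.isUnit_nonsing_inv_det _ hs

end SuperOrbit

end

noncomputable section

namespace SuperOrbit

open SuperAlg Polynomial

/-! ### Spectral idempotents -/

/-- Chinese remainder theorem for the pairwise coprime polynomials `(X - λₖ) ^ N`. The power `N`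
absorbs the nilpotent error in the equation satisfied by a matrix over `A`. -/
theorem exists_idempotent_polynomials {ι : Type*} [Finite ι] {lam : ι → ℂ}
    (hlam : Function.Injective lam) (N : ℕ) :
    ∃ e : ι → ℂ[X], (∀ k, (X - C (lam k)) ^ N ∣ e k - 1) ∧
      ∀ k l, l ≠ k → (X - C (lam l)) ^ N ∣ e k := by
  classical
  cases nonempty_fintype ι
  have hcop : ∀ k l, l ≠ k → IsCoprime ((X - C (lam k)) ^ N) ((X - C (lam l)) ^ N) :=
    fun k l h => (isCoprime_X_sub_C_of_isUnit_sub
      (sub_ne_zero.2 fun h' => h (hlam h').symm).isUnit).pow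
  have h : ∀ k, ∃ e : ℂ[X], (X - C (lam k)) ^ N ∣ e - 1 ∧
      ∀ l, l ≠ k → (X - C (lam l)) ^ N ∣ e := by
    intro k
    have hk : IsCoprime ((X - C (lam k)) ^ N) (∏ l ∈ Finset.univ.erase k, (X - C (lam l)) ^ N) :=
      IsCoprime.prod_right fun l hl => hcop k l (Finset.ne_of_mem_erase hl)
    obtain ⟨a, b, hab⟩ := hk
    refine ⟨b * ∏ l ∈ Finset.univ.erase k, (X - C (lam l)) ^ N, ⟨-a, ?_⟩, fun l hl => ?_⟩
    · rw [← hab]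
      ring
    · exact Dvd.dvd.mul_left
        (Finset.dvd_prod_of_mem _ (Finset.mem_erase.2 ⟨hl, Finset.mem_univ l⟩)) b
  choose e h1 h2 using h
  exact ⟨e, h1, h2⟩

section spectral

variable {ι : Type*} [Fintype ι] {lam : ι → ℂ} {N : ℕ} {e : ι → ℂ[X]} {S : Type*} [Ring S]
  [Algebra ℂ S] {y : S}

theorem aeval_eq_zero_of_dvd (hlam : Function.Injective lam)
    (hy : aeval y (∏ k, (X - C (lam k))) ^ N = 0) {q : ℂ[X]}
    (hq : ∀ k, (X - C (lam k)) ^ N ∣ q) : aeval y q = 0 := by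
  have h : (∏ k, (X - C (lam k))) ^ N ∣ q := by
    rw [← Finset.prod_pow]
    refine Finset.prod_dvd_of_coprime (fun k _ l _ h => ?_) fun k _ => hq k
    exact (isCoprime_X_sub_C_of_isUnit_sub (sub_ne_zero.2 fun h' => h (hlam h')).isUnit).pow
  obtain ⟨r, rfl⟩ := h
  rw [map_mul, map_pow, hy, zero_mul]

theorem aeval_idempotent_mul (hlam : Function.Injective lam)
    (h2 : ∀ k l, l ≠ k → (X - C (lam l)) ^ N ∣ e k)
    (hy : aeval y (∏ k, (X - C (lam k))) ^ N = 0) {k l : ι} (h : k ≠ l) : aeval y (e k) * aeval y (e l) = 0 := by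
  rw [← map_mul]
  refine aeval_eq_zero_of_dvd hlam hy fun j => ?_
  by_cases hj : j = k
  · exact Dvd.dvd.mul_left (h2 l j (hj ▸ h)) _
  · exact Dvd.dvd.mul_right (h2 k j hj) _

theorem aeval_idempotent_sq (hlam : Function.Injective lam)
    (h1 : ∀ k, (X - C (lam k)) ^ N ∣ e k - 1)
    (h2 : ∀ k l, l ≠ k → (X - C (lam l)) ^ N ∣ e k)
    (hy : aeval y (∏ k, (X - C (lam k))) ^ N = 0) (k : ι) : aeval y (e k) * aeval y (e k) = aeval y (e k) := by
  rw [← sub_eq_zero, ← map_mul, ← map_sub]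
  refine aeval_eq_zero_of_dvd hlam hy fun j => ?_
  have h3 : e k * e k - e k = e k * (e k - 1) := by ring
  rw [h3]
  by_cases hj : j = k
  · exact Dvd.dvd.mul_left (hj ▸ h1 j) _
  · exact Dvd.dvd.mul_right (h2 k j hj) _

/-- On the image of the `k`-th idempotent, `y` acts as `λₖ` plus a nilpotent; this bounds how far
the eigenvalues of a frame can be from those of `X₀`. -/
theorem sub_pow_mul_aeval_idempotent (hlam : Function.Injective lam)
    (h2 : ∀ k l, l ≠ k → (X - C (lam l)) ^ N ∣ e k)
    (hy : aeval y (∏ k, (X - C (lam k))) ^ N = 0) (k : ι) :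
    (y - algebraMap ℂ S (lam k)) ^ N * aeval y (e k) = 0 := by
  have h3 : y - algebraMap ℂ S (lam k) = aeval y (X - C (lam k)) := by simp
  rw [h3, ← map_pow, ← map_mul]
  refine aeval_eq_zero_of_dvd hlam hy fun j => ?_
  by_cases hj : j = k
  · exact hj ▸ dvd_mul_right _ _
  · exact Dvd.dvd.mul_left (h2 k j hj) _

end spectral

theorem aeval_mul_of_mul_eq {S : Type*} [Ring S] [Algebra ℂ S] {y w d : S} (h : y * w = w * d)
    (q : ℂ[X]) : aeval y q * w = w * aeval d q := by
  induction q using Polynomial.induction_on' with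
  | add p q hp hq => rw [map_add, map_add, add_mul, mul_add, hp, hq]
  | monomial k a =>
    rw [aeval_monomial, aeval_monomial, mul_assoc, ← mul_assoc w, ← Algebra.commutes a w,
      mul_assoc]
    congr 1
    exact (SemiconjBy.pow_right (show SemiconjBy w d y from h.symm) k).eq.symm

/-! ### Diagonalization over a field -/

theorem exists_eigenbasis {K κ : Type*} [Field K] [Fintype κ] [DecidableEq κ] (P : Matrix κ κ K)
    {lam : κ → K} (hlam : Function.Injective lam) (hP : P.charpoly = ∏ i, (X - C (lam i))) :
    ∃ W : Matrix κ κ K, IsUnit W.det ∧ P * W = W * Matrix.diagonal lam := by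
  have hev : ∀ i, ∃ v, Module.End.HasEigenvector (Matrix.toLin' P) (lam i) v := fun i => by
    refine Module.End.HasEigenvalue.exists_hasEigenvector ?_
    rw [Module.End.hasEigenvalue_iff_isRoot_charpoly, Matrix.charpoly_toLin', hP, IsRoot, eval_prod]
    exact Finset.prod_eq_zero (Finset.mem_univ i) (by simp)
  choose v hv using hev
  have hli := Module.End.eigenvectors_linearIndependent' _ lam hlam v hv
  refine ⟨(Matrix.of v).transpose, ?_, ?_⟩
  · rw [← Matrix.isUnit_iff_isUnit_det, ← Matrix.linearIndependent_cols_iff_isUnit]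
    exact hli
  · ext i j
    have h := congrFun (hv j).apply_eq_smul i
    rw [Matrix.toLin'_apply] at h
    rw [Matrix.mul_diagonal, mul_comm]
    exact h

end SuperOrbit

end

noncomputable section

namespace SuperOrbit

open SuperAlg Polynomial

/-! ### Frames of eigenvectors -/

/-- `evHom` as a homomorphism of algebras. -/
def SuperAlg.evAlgHom (A : SuperAlg) {K : Type*} [CommRing K] [IsReduced K] [Algebra ℂ K]
    (ρ : A.even →ₐ[ℂ] K) : A →ₐ[ℂ] K :=
  { A.evHom ρ.toRingHom with
    commutes' := fun c => (A.evHom_coe ρ.toRingHom (algebraMap ℂ A.even c)).trans (ρ.commutes c) }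

/-- The diagonal even supermatrices. -/
def diagGl {m n : ℕ} {A : SuperAlg} : (Idx m n → A.even) →ₐ[ℂ] gl m n A where
  toFun z := ⟨Matrix.diagonal fun i => (z i : A), fun i j => by
    by_cases h : i = j
    · subst h
      rw [Matrix.diagonal_apply_eq]
      rcases i with i | i <;> exact (z _).2
    · rw [Matrix.diagonal_apply_ne _ h]
      exact Submodule.zero_mem _⟩
  map_one' := Subtype.ext Matrix.diagonal_one
  map_mul' z w := Subtype.ext (Matrix.diagonal_mul_diagonal _ _).symm
  map_zero' := Subtype.ext Matrix.diagonal_zero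
  map_add' z w := Subtype.ext (Matrix.diagonal_add _ _).symm
  commutes' c := Subtype.ext rfl

theorem diagGl_coe {m n : ℕ} {A : SuperAlg} (z : Idx m n → A.even) :
    (diagGl z).1 = Matrix.diagonal fun i => (z i : A) := rfl

theorem diagGl_injective {m n : ℕ} {A : SuperAlg} :
    Function.Injective (diagGl : (Idx m n → A.even) → gl m n A) := fun z w h => by
  funext i
  have h1 := congrFun (congrFun (congrArg Subtype.val h) i) i
  rw [diagGl_coe, diagGl_coe, Matrix.diagonal_apply_eq, Matrix.diagonal_apply_eq] at h1
  exact Subtype.ext h1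

theorem glMap_diagGl {m n : ℕ} {A B : SuperAlg} (φ : A ⟶ B) (z : Idx m n → A.even) :
    glMap φ (diagGl z) = diagGl fun i => evenHom φ (z i) := by
  apply Subtype.ext
  rw [glMap_coe, diagGl_coe, diagGl_coe, Matrix.diagonal_map (map_zero _)]
  rfl

/-- The matrix over `R` that underlies an even supermatrix, for `A → R`. -/
def glToMat {m n : ℕ} {A : SuperAlg} {R : Type*} [CommRing R] [Algebra ℂ R] (F : A →ₐ[ℂ] R) :
    gl m n A →ₐ[ℂ] Matrix (Idx m n) (Idx m n) R :=
  F.mapMatrix.comp (gl m n A).val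

theorem glToMat_eq {m n : ℕ} {A : SuperAlg} {R : Type*} [CommRing R] [Algebra ℂ R] (F : A →ₐ[ℂ] R)
    (hF : ∀ a ∈ A.odd, F a = 0) (Y : gl m n A) :
    glToMat F Y = Matrix.fromBlocks ((Y.1.submatrix Sum.inl Sum.inl).map F) 0 0
      ((Y.1.submatrix Sum.inr Sum.inr).map F) := by
  ext i j
  rcases i with i | i <;> rcases j with j | j
  · rfl
  · exact hF _ (gl_map_inl_inr Y i j)
  · exact hF _ (gl_map_inr_inl Y i j)
  · rfl

/-- After dividing out the odd part, the diagonal blocks of `Y` have the characteristic polynomials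
`∏ (X - λᵢ)`. -/
def HasBlockSpectrum {m n : ℕ} {A : SuperAlg} (Y : gl m n A) (lam : Idx m n → ℂ) : Prop :=
  ∀ (R : Type) [CommRing R] [Algebra ℂ R] (F : A →ₐ[ℂ] R), (∀ a ∈ A.odd, F a = 0) →
    ((Y.1.submatrix Sum.inl Sum.inl).map F).charpoly
        = ∏ i, (X - C (algebraMap ℂ R (lam (Sum.inl i)))) ∧
      ((Y.1.submatrix Sum.inr Sum.inr).map F).charpoly
        = ∏ i, (X - C (algebraMap ℂ R (lam (Sum.inr i))))

/-- Cayley–Hamilton over the reduction of `A₀`, where `Y` becomes block diagonal: all entries of the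
value vanish there, and `gl_isNilpotent` applies. -/
theorem HasBlockSpectrum.isNilpotent {m n : ℕ} {A : SuperAlg} {Y : gl m n A} {lam : Idx m n → ℂ}
    (hY : HasBlockSpectrum Y lam) : IsNilpotent (aeval Y (∏ k, (X - C (lam k)))) := by
  let F : A →ₐ[ℂ] A.even ⧸ nilradical A.even :=
    A.evAlgHom (Ideal.Quotient.mkₐ ℂ (nilradical A.even))
  have hF : ∀ a ∈ A.odd, F a = 0 := A.nilHom_odd
  refine gl_isNilpotent _ fun i j => ?_
  have h1 : (glToMat F Y).charpoly
      = (∏ k, (X - C (lam k))).map (algebraMap ℂ (A.even ⧸ nilradical A.even)) := by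
    rw [glToMat_eq F hF, Matrix.charpoly_fromBlocks_zero₁₂, (hY _ F hF).1, (hY _ F hF).2,
      Polynomial.map_prod, Fintype.prod_sum_type]
    simp
  have h2 : glToMat F (aeval Y (∏ k, (X - C (lam k)))) = 0 := by
    rw [← aeval_algHom_apply, ← aeval_map_algebraMap (A.even ⧸ nilradical A.even), ← h1,
      Matrix.aeval_self_charpoly]
  exact congrFun (congrFun h2 i) j

/-- Eigenvectors of the blocks over the field `K` are lifted arbitrarily to the columns of a matrix
`W`, and the `k`-th column is projected by `eₖ(Y)`. The projections place the columns in the images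
of the idempotents. Over `K` they change nothing, so the block determinants stay nonzero there. -/
theorem exists_frame {m n : ℕ} {A : SuperAlg} {Y : gl m n A} {lam : Idx m n → ℂ}
    (hlam : Function.Injective lam) {N : ℕ} (hN : N ≠ 0) {e : Idx m n → ℂ[X]}
    (h1 : ∀ k, (X - C (lam k)) ^ N ∣ e k - 1) (h2 : ∀ k l, l ≠ k → (X - C (lam l)) ^ N ∣ e k)
    (hy : aeval Y (∏ k, (X - C (lam k))) ^ N = 0) (hY : HasBlockSpectrum Y lam)
    {K : Type} [Field K] [Algebra ℂ K] (ρ : A.even →ₐ[ℂ] K) (hρ : Function.Surjective ρ) :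
    ∃ h : gl m n A, (∀ k, aeval Y (e k) * h = h * diagGl (Pi.single k 1)) ∧
      ρ ((h.1.submatrix Sum.inl Sum.inl).map A.ev).det ≠ 0 ∧
      ρ ((h.1.submatrix Sum.inr Sum.inr).map A.ev).det ≠ 0 := by
  let F : A →ₐ[ℂ] K := A.evAlgHom ρ
  have hF : ∀ a ∈ A.odd, F a = 0 := fun a ha => A.evHom_odd ρ.toRingHom ha
  have hFc : ∀ a : A.even, F a = ρ a := fun a => A.evHom_coe ρ.toRingHom a
  have hinj := (algebraMap ℂ K).injective
  obtain ⟨W₁, hW₁, hP₁⟩ := exists_eigenbasis _ (hinj.comp (hlam.comp Sum.inl_injective))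
    (hY K F hF).1
  obtain ⟨W₂, hW₂, hP₂⟩ := exists_eigenbasis _ (hinj.comp (hlam.comp Sum.inr_injective))
    (hY K F hF).2
  choose s hs using hρ
  let W : gl m n A := blockDiag (W₁.map s) (W₂.map s)
  have hW : glToMat F W = Matrix.fromBlocks W₁ 0 0 W₂ := by
    rw [glToMat_eq F hF]
    congr 1
    · ext i j
      exact (hFc _).trans (hs _)
    · ext i j
      exact (hFc _).trans (hs _)
  have hYW : glToMat F Y * glToMat F W
      = glToMat F W * Matrix.diagonal fun k => algebraMap ℂ K (lam k) := by
    have hd : (Matrix.diagonal fun k => algebraMap ℂ K (lam k))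
        = Matrix.fromBlocks (Matrix.diagonal (algebraMap ℂ K ∘ lam ∘ Sum.inl)) 0 0
          (Matrix.diagonal (algebraMap ℂ K ∘ lam ∘ Sum.inr)) := by
      rw [Matrix.fromBlocks_diagonal]
      congr 1
      funext k
      rcases k with k | k <;> rfl
    rw [hW, glToMat_eq F hF, hd, Matrix.fromBlocks_multiply, Matrix.fromBlocks_multiply, hP₁, hP₂]
    simp
  have hsingle : ∀ k, glToMat F (diagGl (Pi.single k 1))
      = Matrix.diagonal (Pi.single k 1 : Idx m n → K) := by
    intro k
    change ((diagGl (Pi.single k 1)).1).map F = _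
    rw [diagGl_coe, Matrix.diagonal_map (map_zero F)]
    congr 1
    funext i
    by_cases hi : i = k
    · subst hi
      simp
    · simp [hi]
  let h : gl m n A := ∑ k, aeval Y (e k) * W * diagGl (Pi.single k 1)
  have hh : glToMat F h = Matrix.fromBlocks W₁ 0 0 W₂ := by
    have hterm : ∀ k, glToMat F (aeval Y (e k) * W * diagGl (Pi.single k 1))
        = glToMat F W * Matrix.diagonal (Pi.single k 1 : Idx m n → K) := by
      intro k
      rw [map_mul, map_mul, ← aeval_algHom_apply, aeval_mul_of_mul_eq hYW, hsingle, mul_assoc]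
      congr 1
      have hda : aeval (Matrix.diagonal fun k => algebraMap ℂ K (lam k)) (e k)
          = Matrix.diagonal (aeval (fun k => algebraMap ℂ K (lam k)) (e k)) :=
        aeval_algHom_apply (Matrix.diagonalAlgHom ℂ (n := Idx m n) (α := K)) _ _
      rw [hda, Matrix.diagonal_mul_diagonal]
      congr 1
      funext i
      by_cases hi : i = k
      · subst hi
        obtain ⟨q, hq⟩ := h1 i
        -- Here `N ≠ 0` is needed: a congruence modulo the zeroth power would say nothing about the
        -- value at `λᵢ`.
        have he : (e i).eval (lam i) = 1 := by
          have h3 := congrArg (Polynomial.eval (lam i)) hq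
          rw [eval_sub, eval_one, eval_mul, eval_pow, eval_sub, eval_X, eval_C, sub_self,
            zero_pow hN, zero_mul] at h3
          exact sub_eq_zero.1 h3
        have h4 : (aeval (fun k => algebraMap ℂ K (lam k)) (e i)) i
            = aeval (algebraMap ℂ K (lam i)) (e i) :=
          (aeval_algHom_apply (Pi.evalAlgHom ℂ (fun _ : Idx m n => K) i) _ _).symm
        rw [h4, aeval_algebraMap_apply, aeval_def, eval₂_eq_eval_map, Algebra.algebraMap_self,
          Polynomial.map_id, he]
        simp
      · simp [hi]
    rw [map_sum, Finset.sum_congr rfl fun k _ => hterm k, ← Finset.mul_sum, ← hW]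
    have h5 : ∑ k, Matrix.diagonal (Pi.single k 1 : Idx m n → K) = 1 := by
      have h6 := map_sum (Matrix.diagonalAddMonoidHom (Idx m n) K)
        (fun k => (Pi.single k 1 : Idx m n → K)) Finset.univ
      refine h6.symm.trans ?_
      rw [Finset.univ_sum_single (fun _ : Idx m n => (1 : K))]
      exact Matrix.diagonal_one
    rw [h5, mul_one]
  refine ⟨h, fun k => ?_, ?_, ?_⟩
  · rw [Finset.mul_sum, Finset.sum_mul, Finset.sum_eq_single k, Finset.sum_eq_single k]
    · rw [← mul_assoc, ← mul_assoc, aeval_idempotent_sq hlam h1 h2 hy, mul_assoc _ (diagGl _),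
        ← map_mul, ← Pi.single_mul, one_mul]
    · intro l _ hl
      have h3 : (Pi.single l 1 * Pi.single k 1 : Idx m n → A.even) = 0 := by
        funext i
        by_cases hi : i = k
        · subst hi
          simp [hl.symm]
        · simp [hi]
      rw [mul_assoc, ← map_mul, h3, map_zero, mul_zero]
    · simp
    · intro l _ hl
      rw [← mul_assoc, ← mul_assoc, aeval_idempotent_mul hlam h2 hy hl.symm, zero_mul, zero_mul]
    · simp
  · have h3 : (((h.1.submatrix Sum.inl Sum.inl).map A.ev).map ρ) = W₁ := by
      have := congrArg (fun M => M.submatrix Sum.inl Sum.inl) hh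
      exact this
    rw [AlgHom.map_det]
    exact (congrArg Matrix.det h3).trans_ne hW₁.ne_zero
  · have h3 : (((h.1.submatrix Sum.inr Sum.inr).map A.ev).map ρ) = W₂ := by
      have := congrArg (fun M => M.submatrix Sum.inr Sum.inr) hh
      exact this
    rw [AlgHom.map_det]
    exact (congrArg Matrix.det h3).trans_ne hW₂.ne_zero

/-- In the frame `h` the spectral idempotents become the diagonal matrix units. Since `Y` commutes
with its own polynomials, `h⁻¹ Y h` commutes with all these units and is diagonal. -/
theorem exists_diagonal_of_frame {m n : ℕ} {A : SuperAlg} {Y : gl m n A} {lam : Idx m n → ℂ}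
    (hlam : Function.Injective lam) {N : ℕ} {e : Idx m n → ℂ[X]}
    (h2 : ∀ k l, l ≠ k → (X - C (lam l)) ^ N ∣ e k)
    (hy : aeval Y (∏ k, (X - C (lam k))) ^ N = 0) (h : GLmn m n A)
    (hh : ∀ k, aeval Y (e k) * h.1 = h.1 * diagGl (Pi.single k 1)) :
    ∃ d : Idx m n → A.even, Y * h.1 = h.1 * diagGl d ∧
      ∀ k, (d k - algebraMap ℂ A.even (lam k)) ^ N = 0 := by
  obtain ⟨D, hD⟩ : ∃ D : gl m n A, D = (h⁻¹).1 * Y * h.1 := ⟨_, rfl⟩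
  have hYh : Y * h.1 = h.1 * D := by
    rw [hD, ← mul_assoc, ← mul_assoc, Units.mul_inv, one_mul]
  have hcancel : ∀ {a b : gl m n A}, h.1 * a = h.1 * b → a = b := fun {a b} hab =>
    (Units.mul_right_inj h).1 hab
  have hcomm : ∀ k, D * diagGl (Pi.single k 1) = diagGl (Pi.single k 1) * D := fun k => by
    apply hcancel
    have h3 : Y * aeval Y (e k) = aeval Y (e k) * Y := by
      have := (Commute.all X (e k)).map (aeval Y)
      rwa [aeval_X] at this
    rw [← mul_assoc, ← hYh, mul_assoc, ← hh, ← mul_assoc, h3, mul_assoc, hYh, ← mul_assoc, hh,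
      mul_assoc]
  have hoff : ∀ i j, i ≠ j → D.1 i j = 0 := fun i j hij => by
    have h3 := congrFun (congrFun (congrArg Subtype.val (hcomm j)) i) j
    change (D.1 * (diagGl (Pi.single j 1)).1 : Mat m n A) i j
      = ((diagGl (Pi.single j 1)).1 * D.1 : Mat m n A) i j at h3
    rw [diagGl_coe, Matrix.mul_diagonal, Matrix.diagonal_mul] at h3
    simpa [hij] using h3
  have hev : ∀ i, D.1 i i ∈ A.even := by
    rintro (i | i)
    · exact D.2 (Sum.inl i) (Sum.inl i)
    · exact D.2 (Sum.inr i) (Sum.inr i)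
  let d : Idx m n → A.even := fun i => ⟨D.1 i i, hev i⟩
  have hDd : D = diagGl d := by
    apply Subtype.ext
    ext i j
    rw [diagGl_coe]
    by_cases hij : i = j
    · subst hij
      rw [Matrix.diagonal_apply_eq]
    · rw [Matrix.diagonal_apply_ne _ hij, hoff i j hij]
  refine ⟨d, hDd ▸ hYh, fun k => ?_⟩
  have h3 : aeval Y ((X - C (lam k)) ^ N) * h.1 = h.1 * aeval D ((X - C (lam k)) ^ N) :=
    aeval_mul_of_mul_eq hYh _
  have h4 : aeval D ((X - C (lam k)) ^ N) * diagGl (Pi.single k 1) = 0 := by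
    apply hcancel
    have h5 := sub_pow_mul_aeval_idempotent hlam h2 hy k
    rw [← mul_assoc, ← h3, mul_assoc, ← hh, ← mul_assoc, mul_zero]
    have h6 : aeval Y ((X - C (lam k)) ^ N) = (Y - algebraMap ℂ (gl m n A) (lam k)) ^ N := by simp
    rw [h6, h5, zero_mul]
  rw [hDd, aeval_algHom_apply, ← map_mul] at h4
  have h7 := congrFun (diagGl_injective (h4.trans (map_zero _).symm)) k
  simpa using h7

end SuperOrbit

end

noncomputable section

namespace SuperOrbit

open SuperAlg Polynomial

/-! ### The spectrum of `X₀` -/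

theorem exists_charpoly_eq_prod {k : ℕ} (P : Matrix (Fin k) (Fin k) ℂ) :
    ∃ μ : Fin k → ℂ, P.charpoly = ∏ i, (X - C (μ i)) := by
  have hs := IsAlgClosed.splits P.charpoly
  obtain ⟨l, hl⟩ := Quotient.exists_rep P.charpoly.roots
  have hl' : (l : Multiset ℂ) = P.charpoly.roots := hl
  have hprod : P.charpoly = (l.map fun a => X - C a).prod := by
    have h1 := hs.eq_prod_roots_of_monic (Matrix.charpoly_monic P)
    rw [← hl'] at h1
    simpa using h1
  have hlen : l.length = k := by
    have h1 := congrArg natDegree hprod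
    rw [Matrix.charpoly_natDegree_eq_dim, Fintype.card_fin] at h1
    have h2 := natDegree_multiset_prod_X_sub_C_eq_card (l : Multiset ℂ)
    simp only [Multiset.map_coe, Multiset.prod_coe, Multiset.coe_card] at h2
    exact h2.symm.trans h1.symm
  refine ⟨fun i => l.get (i.cast hlen.symm), ?_⟩
  rw [hprod, ← Fin.prod_univ_fun_getElem l fun a => X - C a]
  exact Fintype.prod_equiv (finCongr hlen) _ _ fun i => rfl

/-- As `ℂ` has no odd elements, `X₀` is block diagonal, and its eigenvalues can be labelled by the
parity of their eigenvectors. -/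
theorem exists_spectrum {t : Series} {m n : ℕ} {X₀ : Lie t m n SuperAlg.base}
    (hX₀ : HasDistinctEigenvalues X₀) :
    ∃ lam : Idx m n → ℂ, Function.Injective lam ∧
      ((cmatrix X₀).submatrix Sum.inl Sum.inl).charpoly = ∏ i, (X - C (lam (Sum.inl i))) ∧
      ((cmatrix X₀).submatrix Sum.inr Sum.inr).charpoly = ∏ i, (X - C (lam (Sum.inr i))) := by
  obtain ⟨μ, hμ⟩ := exists_charpoly_eq_prod ((cmatrix X₀).submatrix Sum.inl Sum.inl)
  obtain ⟨ν, hν⟩ := exists_charpoly_eq_prod ((cmatrix X₀).submatrix Sum.inr Sum.inr)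
  refine ⟨Sum.elim μ ν, ?_, hμ, hν⟩
  have h1 : cmatrix X₀ = Matrix.fromBlocks ((cmatrix X₀).submatrix Sum.inl Sum.inl) 0 0
      ((cmatrix X₀).submatrix Sum.inr Sum.inr) := by
    ext i j
    rcases i with i | i <;> rcases j with j | j
    · rfl
    · exact gl_map_inl_inr X₀.1 i j
    · exact gl_map_inr_inl X₀.1 i j
    · rfl
  have h2 : (cmatrix X₀).charpoly = ∏ k, (X - C (Sum.elim μ ν k)) := by
    rw [h1, Matrix.charpoly_fromBlocks_zero₁₂, hμ, hν, Fintype.prod_sum_type]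
    rfl
  have h3 : (Multiset.map (Sum.elim μ ν) Finset.univ.val).Nodup := by
    have h4 : (cmatrix X₀).charpoly.roots.Nodup := hX₀
    rw [h2] at h4
    have h5 := roots_multiset_prod_X_sub_C (Multiset.map (Sum.elim μ ν) Finset.univ.val)
    rw [Multiset.map_map] at h5
    rw [← h5]
    exact h4
  exact fun a b h => Multiset.inj_on_of_nodup_map h3 a (Finset.mem_univ a) b (Finset.mem_univ b) h

theorem hasBlockSpectrum_of_value {t : Series} {m n l : ℕ} {X₀ : Lie t m n SuperAlg.base}
    {p : Fin l → coord t m n}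
    (hideal : orbitIdeal X₀ = Ideal.span (Set.range fun i =>
      (coord t m n).toRed (p i - algebraMap ℂ (coord t m n) (cvalue (p i) X₀))))
    {lam : Idx m n → ℂ}
    (h1 : ((cmatrix X₀).submatrix Sum.inl Sum.inl).charpoly = ∏ i, (X - C (lam (Sum.inl i))))
    (h2 : ((cmatrix X₀).submatrix Sum.inr Sum.inr).charpoly = ∏ i, (X - C (lam (Sum.inr i))))
    {A : SuperAlg} (Y : Lie t m n A)
    (hY : ∀ i, value (p i) Y = algebraMap ℂ A (cvalue (p i) X₀)) : HasBlockSpectrum Y.1 lam := by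
  intro R _ _ F hF
  let Φ : coord t m n →ₐ[ℂ] R := F.comp (hom (point Y))
  have hΦ : ∀ a ∈ (coord t m n).odd, Φ.toRingHom a = 0 := fun a ha => hF _ (hom_odd _ ha)
  have hp : ∀ i, Φ.toRingHom (p i)
      = Φ.toRingHom (algebraMap ℂ (coord t m n) (cvalue (p i) X₀)) := fun i =>
    congrArg F ((hY i).trans ((hom (point Y)).commutes _).symm)
  have h4 : Φ.toRingHom.comp (algebraMap ℂ (coord t m n)) = algebraMap ℂ R := Φ.comp_algebraMap
  have h5 : ∀ {κ : Type} (b : κ → Idx m n),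
      ((coordMatrix t m n).submatrix b b).map Φ.toRingHom = (Y.1.1.submatrix b b).map F :=
    fun b => by
      rw [← coordMatrix_map Y]
      rfl
  constructor
  · rw [← h5, charpoly_block_eq hideal Φ.toRingHom hΦ hp (isBlock_inl m n), h1, h4,
      Polynomial.map_prod]
    simp
  · rw [← h5, charpoly_block_eq hideal Φ.toRingHom hΦ hp (isBlock_inr m n), h2, h4,
      Polynomial.map_prod]
    simp

/-- The eigenvalues in `A₀`. -/
def constEven {m n : ℕ} (A : SuperAlg) (lam : Idx m n → ℂ) : Idx m n → A.even :=
  fun i => algebraMap ℂ A.even (lam i)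

/-- The frame construction over `ℂ`, where nonzero determinants are units and the nilpotent errors
of the eigenvalues vanish. -/
theorem exists_diagonalizer {m n : ℕ} {Y : gl m n SuperAlg.base} {lam : Idx m n → ℂ}
    (hlam : Function.Injective lam) (hY : HasBlockSpectrum Y lam) :
    ∃ h : GLmn m n SuperAlg.base, Y * h.1 = h.1 * diagGl (constEven SuperAlg.base lam) := by
  obtain ⟨N, hN⟩ := hY.isNilpotent
  have hN' : aeval Y (∏ k, (X - C (lam k))) ^ (N + 1) = 0 := by rw [pow_succ, hN, zero_mul]
  obtain ⟨e, h1, h2⟩ := exists_idempotent_polynomials hlam (N + 1)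
  let ρ : SuperAlg.base.even →ₐ[ℂ] ℂ := SuperAlg.base.even.val
  obtain ⟨h, hh, hu, hv⟩ := exists_frame hlam N.succ_ne_zero h1 h2 hN' hY ρ
    fun c => ⟨⟨c, trivial⟩, rfl⟩
  have hunit : ∀ a : SuperAlg.base.even, ρ a ≠ 0 → IsUnit a := fun a ha =>
    IsUnit.of_mul_eq_one ⟨((ρ a : ℂ)⁻¹ : ℂ), trivial⟩
      (Subtype.ext (mul_inv_cancel₀ (G₀ := ℂ) ha))
  obtain ⟨h, rfl⟩ := gl_isUnit h (hunit _ hu) (hunit _ hv)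
  obtain ⟨d, hd, hd'⟩ := exists_diagonal_of_frame hlam h2 hN' h hh
  refine ⟨h, ?_⟩
  rw [hd]
  congr 2
  funext k
  refine sub_eq_zero.1 (Subtype.ext ?_)
  have h3 := congrArg ρ (hd' k)
  rw [map_pow, map_zero] at h3
  exact eq_zero_of_pow_eq_zero (R := ℂ) h3

end SuperOrbit

end

noncomputable section

namespace SuperOrbit

open SuperAlg Polynomial

/-! ### Square roots -/

/-- Newton iteration lifts the root of `X² - u` along the nilradical: the derivative `2v` is a unit
because `2` is one and `v²` is a unit modulo nilpotents. -/
theorem exists_sq_eq_of_mk_nilradical {R : Type*} [CommRing R] [Algebra ℂ R] {u : R}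
    (hu : IsUnit u) {s : R ⧸ nilradical R} (hs : s ^ 2 = Ideal.Quotient.mk (nilradical R) u) :
    ∃ r : R, r * r = u := by
  obtain ⟨v, rfl⟩ := Ideal.Quotient.mk_surjective s
  have hn : IsNilpotent (v ^ 2 - u) := by
    rw [← mem_nilradical, ← Ideal.Quotient.eq_zero_iff_mem, map_sub, map_pow, hs, sub_self]
  have hv : IsUnit v := by
    refine (isUnit_pow_iff two_ne_zero).1 (isUnit_of_isUnit_mk_nilradical ?_)
    rw [map_pow, hs]
    exact hu.map _
  have h2 : IsUnit (2 : R) := by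
    have h := (IsUnit.mk0 (2 : ℂ) two_ne_zero).map (algebraMap ℂ R)
    rwa [map_ofNat] at h
  obtain ⟨r, ⟨-, hr⟩, -⟩ := existsUnique_nilpotent_sub_and_aeval_eq_zero (P := (X ^ 2 - C u : R[X]))
    (x := v) (by simpa using hn) (by
      simp only [derivative_sub, derivative_X_pow, derivative_C, sub_zero]
      simpa using h2.mul hv)
  refine ⟨r, ?_⟩
  have h3 : r ^ 2 - u = 0 := by simpa using hr
  rw [← pow_two, sub_eq_zero.1 h3]

/-- Solving `z_i z_{σ(i)} = u_i` for an involution `σ`. -/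
theorem exists_mul_involution_eq {κ R : Type*} [LinearOrder κ] [CommRing R] {σ : κ → κ}
    (hσ : ∀ i, σ (σ i) = i) {u : κ → R} (hu : ∀ i, u (σ i) = u i)
    (hfix : ∀ i, σ i = i → ∃ r, r * r = u i) : ∃ z : κ → R, ∀ i, z i * z (σ i) = u i := by
  choose! r hr using hfix
  -- In each pair `{i, σ i}` the smaller index carries all of `u i` and the larger one carries `1`.
  refine ⟨fun i => if i < σ i then u i else if σ i = i then r i else 1, fun i => ?_⟩
  rcases lt_trichotomy i (σ i) with h | h | h
  · simp [hσ, h, h.not_gt, h.ne]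
  · have h1 := hr i h.symm
    simp only [← h, lt_irrefl, if_false, if_true]
    exact h1
  · simp [hσ, h, h.not_gt, h.ne, hu]

/-- If `u` is invariant under the involution `σ`, whose only fixed point is `i₀`, then `∏ u_i` is
`u_{i₀}` up to a square. -/
theorem exists_prod_eq_mul_sq {κ R : Type*} [Fintype κ] [LinearOrder κ] [CommRing R] {σ : κ → κ}
    (hσ : ∀ i, σ (σ i) = i) {u : κ → R} (hu : ∀ i, u (σ i) = u i) {i₀ : κ} (h₀ : σ i₀ = i₀)
    (hfix : ∀ i, σ i = i → i = i₀) : ∃ w : R, ∏ i, u i = u i₀ * w ^ 2 := by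
  -- `f` keeps one factor from each two-element orbit of `σ`; the other factor is the same by
  -- invariance, whence the square.
  let f : κ → R := fun i => if i < σ i then u i else 1
  refine ⟨∏ i, f i, ?_⟩
  have h1 : ∀ i, u i = (if i = i₀ then u i₀ else 1) * (f i * f (σ i)) := by
    intro i
    rcases lt_trichotomy i (σ i) with h | h | h
    · have hi : i ≠ i₀ := by
        rintro rfl
        exact h.ne h₀.symm
      simp [f, hσ, h, h.not_gt, hi]
    · have hi := hfix i h.symm
      subst hi
      simp [f, h₀]
    · have hi : i ≠ i₀ := by
        rintro rfl
        exact h.ne h₀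
      simp [f, hσ, h, h.not_gt, hi, hu]
  have h2 : ∏ i, f (σ i) = ∏ i, f i :=
    Equiv.prod_comp (Function.Involutive.toPerm σ hσ) f
  rw [Finset.prod_congr rfl fun i _ => h1 i, Finset.prod_mul_distrib, Finset.prod_mul_distrib, h2,
    Finset.prod_ite_eq' Finset.univ i₀ (fun _ => u i₀), if_pos (Finset.mem_univ _), pow_two]

/-! ### The supertranspose -/

theorem superTranspose_mem {m n : ℕ} {A : SuperAlg} (M : gl m n A) :
    superTranspose M.1 ∈ gl m n A := by
  rintro (i | i) (j | j)
  · exact M.2 (Sum.inl j) (Sum.inl i)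
  · exact M.2 (Sum.inr j) (Sum.inl i)
  · exact A.odd.neg_mem (M.2 (Sum.inl j) (Sum.inr i))
  · exact M.2 (Sum.inr j) (Sum.inr i)

theorem form_mem (m n : ℕ) (A : SuperAlg) : form m n A ∈ gl m n A := by
  rintro (i | i) (j | j)
  · change (if j = i.rev then (1 : A) else 0) ∈ A.even
    split_ifs
    · exact A.even.one_mem
    · exact A.even.zero_mem
  · exact A.odd.zero_mem
  · exact A.odd.zero_mem
  · change (if j = i.rev then (if i < j then (1 : A) else -1) else 0) ∈ A.even
    split_ifs
    · exact A.even.one_mem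
    · exact A.even.neg_mem A.even.one_mem
    · exact A.even.zero_mem

theorem form_mul_transpose (m n : ℕ) (A : SuperAlg) :
    form m n A * superTranspose (form m n A) = 1 := by
  rw [form, superTranspose, Matrix.toBlocks_fromBlocks₁₁, Matrix.toBlocks_fromBlocks₁₂,
    Matrix.toBlocks_fromBlocks₂₁, Matrix.toBlocks_fromBlocks₂₂, Matrix.fromBlocks_multiply]
  simp only [Matrix.transpose_zero, neg_zero, Matrix.mul_zero, Matrix.zero_mul, add_zero, zero_add]
  rw [← Matrix.fromBlocks_one]
  congr 1
  · ext i j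
    simp [Matrix.mul_apply, Matrix.one_apply, Fin.rev_inj, eq_comm]
  · ext i j
    simp only [Matrix.mul_apply, Matrix.transpose_apply, Matrix.of_apply, ite_mul, zero_mul,
      Finset.sum_ite_eq', Finset.mem_univ, if_true, Matrix.one_apply, Fin.rev_inj]
    by_cases h : i = j
    · subst h
      by_cases h1 : i < i.rev <;> simp [h1]
    · simp [h]

/-- The grading operator `diag(1, -1)`. -/
def grading (m n : ℕ) (A : SuperAlg) : Mat m n A := Matrix.fromBlocks 1 0 0 (-1)

theorem grading_mul_grading (m n : ℕ) (A : SuperAlg) : grading m n A * grading m n A = 1 := by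
  simp [grading, Matrix.fromBlocks_multiply]

theorem superTranspose_superTranspose {m n : ℕ} {A : SuperAlg} (M : Mat m n A) :
    superTranspose (superTranspose M) = grading m n A * M * grading m n A := by
  conv_rhs => rw [← Matrix.fromBlocks_toBlocks M]
  simp [superTranspose, grading, Matrix.fromBlocks_multiply]

theorem superTranspose_form {m n : ℕ} (hn : Even n) (A : SuperAlg) :
    superTranspose (form m n A) = form m n A * grading m n A := by
  rw [form, superTranspose, grading, Matrix.toBlocks_fromBlocks₁₁, Matrix.toBlocks_fromBlocks₁₂,
    Matrix.toBlocks_fromBlocks₂₁, Matrix.toBlocks_fromBlocks₂₂, Matrix.fromBlocks_multiply]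
  simp only [Matrix.transpose_zero, neg_zero, Matrix.mul_zero, add_zero, zero_add,
    Matrix.mul_one, Matrix.mul_neg]
  congr 1
  · ext i j
    simp only [Matrix.transpose_apply, Matrix.of_apply]
    congr 1
    rw [eq_iff_iff]
    constructor <;> (rintro rfl; exact (Fin.rev_rev _).symm)
  · ext i j
    simp only [Matrix.transpose_apply, Matrix.of_apply, Matrix.neg_apply]
    by_cases h : j = i.rev
    · subst h
      -- As `n` is even, no index is its own reversal, so exactly one of the inequalities holds and
      -- transposition changes the sign.
      have h1 : ¬ (i.rev < i ↔ i < i.rev) := by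
        obtain ⟨k, hk⟩ := hn
        rw [Fin.lt_def, Fin.lt_def, Fin.val_rev]
        omega
      by_cases h2 : i < i.rev
      · have h3 : ¬ i.rev < i := fun h3 => h1 (iff_of_true h3 h2)
        simp [h2, h3]
      · have h3 : i.rev < i := by
          by_contra h3
          exact h1 (iff_of_false h3 h2)
        simp [h2, h3]
    · have h1 : i ≠ j.rev := fun h1 => h (by rw [h1, Fin.rev_rev])
      simp [h, h1]

/-! ### Gram matrices and their symmetry -/

/-- The Gram matrix of the form with respect to the columns of `h`. -/
def gram {m n : ℕ} {A : SuperAlg} (h : Mat m n A) : Mat m n A :=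
  superTranspose h * form m n A * h

theorem gram_mem {m n : ℕ} {A : SuperAlg} (h : gl m n A) : gram h.1 ∈ gl m n A :=
  mul_mem (mul_mem (superTranspose_mem h) (form_mem m n A)) h.2

theorem gram_mul {m n : ℕ} {A : SuperAlg} (h k : gl m n A) :
    gram (h.1 * k.1) = superTranspose k.1 * gram h.1 * k.1 := by
  rw [gram, gram, superTranspose_mul]
  simp only [mul_assoc]

/-- Transposing twice conjugates by the grading operator, and transposing `J` produces one more
grading factor; two of the three cancel. On the blocks this is symmetry on even vectors and
antisymmetry on odd ones. -/
theorem superTranspose_gram {m n : ℕ} (hn : Even n) {A : SuperAlg} (h : gl m n A) :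
    superTranspose (gram h.1) = gram h.1 * grading m n A := by
  have h1 := superTranspose_mul (⟨superTranspose h.1, superTranspose_mem h⟩ * ⟨form m n A, form_mem m n A⟩) h
  have h2 := superTranspose_mul ⟨superTranspose h.1, superTranspose_mem h⟩ ⟨form m n A, form_mem m n A⟩
  refine h1.trans ?_
  change superTranspose h.1 * superTranspose (superTranspose h.1 * form m n A) = _
  rw [h2, superTranspose_form hn, superTranspose_superTranspose, gram]
  simp only [mul_assoc]
  rw [← mul_assoc (grading m n A) (grading m n A), grading_mul_grading, one_mul]

theorem gram_inl {m n : ℕ} (hn : Even n) {A : SuperAlg} (h : gl m n A) (i j : Fin m) :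
    gram h.1 (Sum.inl j) (Sum.inl i) = gram h.1 (Sum.inl i) (Sum.inl j) := by
  have h1 := congrFun (congrFun (superTranspose_gram hn h) (Sum.inl i)) (Sum.inl j)
  refine h1.trans ?_
  simp [Matrix.mul_apply, grading, Matrix.one_apply]

theorem gram_inr {m n : ℕ} (hn : Even n) {A : SuperAlg} (h : gl m n A) (i j : Fin n) :
    gram h.1 (Sum.inr j) (Sum.inr i) = -gram h.1 (Sum.inr i) (Sum.inr j) := by
  have h1 := congrFun (congrFun (superTranspose_gram hn h) (Sum.inr i)) (Sum.inr j)
  refine h1.trans ?_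
  simp [Matrix.mul_apply, grading, Matrix.one_apply]

theorem gram_mul_inv {m n : ℕ} {A : SuperAlg} (h : GLmn m n A) :
    ∃ C : Mat m n A, gram h.1.1 * C = 1 := by
  refine ⟨(h⁻¹).1.1 * superTranspose (form m n A) * superTranspose (h⁻¹).1.1, ?_⟩
  have h1 : h.1.1 * (h⁻¹).1.1 = 1 := congrArg Subtype.val h.mul_inv
  have h2 : (h⁻¹).1.1 * h.1.1 = 1 := congrArg Subtype.val h.inv_mul
  calc gram h.1.1 * ((h⁻¹).1.1 * superTranspose (form m n A) * superTranspose (h⁻¹).1.1)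
      = superTranspose h.1.1 * (form m n A * (h.1.1 * (h⁻¹).1.1) * superTranspose (form m n A))
        * superTranspose (h⁻¹).1.1 := by simp only [gram, mul_assoc]
    _ = 1 := by
      rw [h1, mul_one, form_mul_transpose, mul_one, ← superTranspose_mul, h2, superTranspose_one]

theorem superTranspose_diagGl {m n : ℕ} {A : SuperAlg} (z : Idx m n → A.even) :
    superTranspose (diagGl z).1 = (diagGl z).1 := by
  rw [diagGl_coe]
  ext i j
  rcases i with i | i <;> rcases j with j | j <;>
    simp [superTranspose, Matrix.toBlocks₁₁, Matrix.toBlocks₁₂, Matrix.toBlocks₂₁,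
      Matrix.toBlocks₂₂, Matrix.diagonal_apply, eq_comm]
  all_goals aesop

end SuperOrbit

end

noncomputable section

namespace SuperOrbit

open SuperAlg Polynomial

/-! ### Correcting the eigenframe by a diagonal matrix -/

/-- `Y` is skew for the form, so `dᵢ + dⱼ` kills the product of the `i`-th and `j`-th eigenvectors.
-/
theorem gram_eq_zero {m n : ℕ} {A : SuperAlg} (Y : Lie Series.osp m n A) (h : GLmn m n A)
    {d : Idx m n → A.even} (hd : Y.1 * h.1 = h.1 * diagGl d) {i j : Idx m n}
    (hij : IsUnit (d i + d j)) : gram h.1.1 i j = 0 := by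
  have hY : superTranspose Y.1.1 * form m n A + form m n A * Y.1.1 = 0 := by
    ext i j
    exact Y.2 _ ⟨i, j, rfl⟩
  have hd' : Y.1.1 * h.1.1 = h.1.1 * (diagGl d).1 := congrArg Subtype.val hd
  have h1 := superTranspose_mul Y.1 h.1
  have h2 := superTranspose_mul h.1 (diagGl d)
  rw [hd', h2, superTranspose_diagGl] at h1
  have h3 : (diagGl d).1 * gram h.1.1 + gram h.1.1 * (diagGl d).1 = 0 := by
    calc (diagGl d).1 * gram h.1.1 + gram h.1.1 * (diagGl d).1
        = ((diagGl d).1 * superTranspose h.1.1) * form m n A * h.1.1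
          + superTranspose h.1.1 * form m n A * (h.1.1 * (diagGl d).1) := by
          simp only [gram, mul_assoc]
      _ = superTranspose h.1.1 * (superTranspose Y.1.1 * form m n A + form m n A * Y.1.1)
          * h.1.1 := by
          rw [h1, ← hd']
          simp only [mul_add, add_mul, mul_assoc]
      _ = 0 := by rw [hY, mul_zero, zero_mul]
  have h4 := congrFun (congrFun h3 i) j
  rw [diagGl_coe, Matrix.add_apply, Matrix.diagonal_mul, Matrix.mul_diagonal,
    ← A.even_comm _ (d j).2, ← add_mul] at h4
  obtain ⟨v, hv⟩ := hij.exists_left_inv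
  have h5 : (v : A) * ((d i : A) + d j) = 1 := congrArg Subtype.val hv
  rw [← one_mul (gram h.1.1 i j), ← h5, mul_assoc, h4]
  exact mul_zero _

theorem isUnit_add_of_nilpotent {R : Type*} [CommRing R] [Algebra ℂ R] {a b : R} {x y : ℂ}
    (ha : IsNilpotent (a - algebraMap ℂ R x)) (hb : IsNilpotent (b - algebraMap ℂ R y))
    (h : x + y ≠ 0) : IsUnit (a + b) := by
  have h1 : IsUnit (algebraMap ℂ R (x + y)) := (IsUnit.mk0 _ h).map _
  have h2 := IsNilpotent.isUnit_add_left_of_commute ((Commute.all _ _).isNilpotent_add ha hb) h1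
    (Commute.all _ _)
  convert h2 using 1
  rw [map_add]
  ring

/-- An eigenvalue `λᵢ` is paired with the eigenvalue `-λᵢ` of an eigenvector of the same parity. -/
structure IsPairing {m n : ℕ} (lam : Idx m n → ℂ) (σ : Idx m n → Idx m n) : Prop where
  involutive : ∀ i, σ (σ i) = i
  add_ne_zero : ∀ i j, j ≠ σ i → lam i + lam j ≠ 0
  inl : ∀ i, ∃ j, σ (Sum.inl i) = Sum.inl j
  inr : ∀ i, ∃ j, σ (Sum.inr i) = Sum.inr j
  fixed : ∀ i j, σ i = i → σ j = j → i = j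

theorem IsPairing.slot_eq {m n : ℕ} {lam : Idx m n → ℂ} {σ : Idx m n → Idx m n}
    (hσ : IsPairing lam σ) (A : SuperAlg) (i : Idx m n) :
    slot A i (σ i) = Subalgebra.toSubmodule A.even := by
  rcases i with i | i
  · obtain ⟨j, hj⟩ := hσ.inl i
    rw [hj]
    rfl
  · obtain ⟨j, hj⟩ := hσ.inr i
    rw [hj]
    rfl

/-- The Gram matrix of a complex eigenframe is invertible, so each row has a nonzero entry. By
orthogonality it sits at the opposite eigenvalue, which occurs once. Mixed entries are odd, hence
zero over `ℂ`, so parity is preserved. A fixed index has eigenvalue `0`, so there is at most one. -/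
theorem exists_pairing {m n : ℕ} (X₀ : Lie Series.osp m n SuperAlg.base) {lam : Idx m n → ℂ}
    (hlam : Function.Injective lam) (h : GLmn m n SuperAlg.base)
    (hh : X₀.1 * h.1 = h.1 * diagGl (constEven SuperAlg.base lam)) :
    ∃ σ : Idx m n → Idx m n, IsPairing lam σ := by
  have hadd : ∀ i j, gram h.1.1 i j ≠ 0 → lam i + lam j = 0 := fun i j hij => by
    by_contra hne
    exact hij (gram_eq_zero X₀ h hh (isUnit_add_of_nilpotent
      (by rw [constEven, sub_self]; exact IsNilpotent.zero)
      (by rw [constEven, sub_self]; exact IsNilpotent.zero) hne))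
  have hrow : ∀ i, ∃ j, gram h.1.1 i j ≠ 0 := fun i => by
    by_contra! hz
    obtain ⟨C, hC⟩ := gram_mul_inv h
    have h1 := congrFun (congrFun hC i) i
    rw [Matrix.mul_apply, Finset.sum_eq_zero fun j _ => by rw [hz j, zero_mul],
      Matrix.one_apply_eq] at h1
    exact zero_ne_one (α := ℂ) h1
  choose σ hσ using hrow
  have hinv : ∀ i j, lam i + lam j = 0 → j = σ i := fun i j hij =>
    hlam (by linear_combination hij - hadd i _ (hσ i))
  refine ⟨σ, fun i => ?_, fun i j hij h0 => hij (hinv i j h0), fun i => ?_, fun i => ?_,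
    fun i j hi hj => hlam ?_⟩
  · exact (hinv (σ i) i (by rw [add_comm]; exact hadd i _ (hσ i))).symm
  · have h1 := hσ (Sum.inl i)
    rcases hj : σ (Sum.inl i) with j | j
    · exact ⟨j, rfl⟩
    · rw [hj] at h1
      exact absurd ((gram_mem h.1) (Sum.inl i) (Sum.inr j)) h1
  · have h1 := hσ (Sum.inr i)
    rcases hj : σ (Sum.inr i) with j | j
    · rw [hj] at h1
      exact absurd ((gram_mem h.1) (Sum.inr i) (Sum.inl j)) h1
    · exact ⟨j, rfl⟩
  · have h1 := hadd i _ (hσ i)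
    have h2 := hadd j _ (hσ j)
    rw [hi] at h1
    rw [hj] at h2
    linear_combination (h1 - h2) / 2

/-- Nilpotent changes of the eigenvalues keep the nonzero sums invertible, so the Gram matrix over
`A` is still supported on the pairing `σ`. Each row has a single possible nonzero entry, which must
be a unit because the matrix is invertible. -/
theorem exists_gram_units {m n : ℕ} {lam : Idx m n → ℂ} {σ : Idx m n → Idx m n}
    (hσ : IsPairing lam σ) {A : SuperAlg} (Y : Lie Series.osp m n A) (h : GLmn m n A)
    {d : Idx m n → A.even} (hd : Y.1 * h.1 = h.1 * diagGl d)
    (hnil : ∀ k, IsNilpotent (d k - algebraMap ℂ A.even (lam k))) :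
    (∀ i j, j ≠ σ i → gram h.1.1 i j = 0) ∧
      ∃ b : Idx m n → A.evenˣ, ∀ i, gram h.1.1 i (σ i) = (b i : A.even) := by
  have hz : ∀ i j, j ≠ σ i → gram h.1.1 i j = 0 := fun i j hij =>
    gram_eq_zero Y h hd (isUnit_add_of_nilpotent (hnil i) (hnil j) (hσ.add_ne_zero i j hij))
  refine ⟨hz, ?_⟩
  have hev : ∀ i, gram h.1.1 i (σ i) ∈ A.even := fun i => by
    have h1 := gram_mem h.1 i (σ i)
    rwa [hσ.slot_eq] at h1
  have hu : ∀ i, IsUnit (⟨gram h.1.1 i (σ i), hev i⟩ : A.even) := fun i => by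
    obtain ⟨C, hC⟩ := gram_mul_inv h
    have h1 := congrFun (congrFun hC i) i
    rw [Matrix.mul_apply, Finset.sum_eq_single (σ i) (fun j _ hj => by rw [hz i j hj, zero_mul])
      (fun hi => absurd (Finset.mem_univ _) hi), Matrix.one_apply_eq, A.even_comm _ (hev i)] at h1
    have h2 := A.ev_mul_even (C (σ i) i) (hev i)
    rw [h1, show A.ev 1 = 1 from A.ev_even 1,
      show A.ev (gram h.1.1 i (σ i)) = ⟨_, hev i⟩ from A.ev_even ⟨_, hev i⟩, mul_comm] at h2
    exact IsUnit.of_mul_eq_one _ h2.symm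
  exact ⟨fun i => (hu i).unit, fun i => rfl⟩

theorem map_gram_inl {m n : ℕ} {A : SuperAlg} (h : gl m n A) :
    ((gram h.1).submatrix Sum.inl Sum.inl).map A.nilHom
      = ((h.1.submatrix Sum.inl Sum.inl).map A.nilHom).transpose
        * ((form m n A).submatrix Sum.inl Sum.inl).map A.nilHom
        * (h.1.submatrix Sum.inl Sum.inl).map A.nilHom := by
  have h1 := (isBlock_inl m n).map_mul A.nilHom A.nilHom_odd
    (⟨superTranspose h.1, superTranspose_mem h⟩ * ⟨form m n A, form_mem m n A⟩) h
  have h2 := (isBlock_inl m n).map_mul A.nilHom A.nilHom_odd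
    ⟨superTranspose h.1, superTranspose_mem h⟩ ⟨form m n A, form_mem m n A⟩
  refine h1.trans ?_
  congr 1

theorem isUnit_det_form_inl (m n : ℕ) (A : SuperAlg) :
    IsUnit (((form m n A).submatrix Sum.inl Sum.inl : Matrix (Fin m) (Fin m) A).map A.nilHom).det := by
  have h1 := (isBlock_inl m n).map_mul A.nilHom A.nilHom_odd ⟨form m n A, form_mem m n A⟩
    ⟨_, superTranspose_mem ⟨form m n A, form_mem m n A⟩⟩
  change ((form m n A * superTranspose (form m n A)).submatrix _ _).map _ = _ at h1
  rw [form_mul_transpose] at h1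
  have h2 := ((isBlock_inl m n).map_one (A := A) A.nilHom).symm.trans h1
  have h3 := congrArg Matrix.det h2
  rw [Matrix.det_one, Matrix.det_mul] at h3
  exact IsUnit.of_mul_eq_one _ h3.symm

/-- Modulo nilpotents the determinants of the even blocks give `det(k)² det J = ∏ uⱼ · det(h)² det
J`. The indices other than `i` come in pairs, so `∏ uⱼ` is `uᵢ` times a square, and `uᵢ` is itself a
square. -/
theorem exists_sq_eq_mk_of_gram {m n : ℕ} {lam : Idx m n → ℂ} {σ : Idx m n → Idx m n}
    {A : SuperAlg} (h k : GLmn m n A) (hσ : IsPairing lam σ) {u : Idx m n → A.evenˣ}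
    (hu : ∀ i, u (σ i) = u i)
    (hgram : ∀ i j, gram k.1.1 i j = (u i : A.even) * gram h.1.1 i j) {i : Fin m}
    (hi : σ (Sum.inl i) = Sum.inl i) :
    ∃ s, s ^ 2 = Ideal.Quotient.mk (nilradical A.even) (u (Sum.inl i)) := by
  let mk := Ideal.Quotient.mk (nilradical A.even)
  choose τ hτ using hσ.inl
  obtain ⟨w, hw⟩ := exists_prod_eq_mul_sq (σ := τ) (u := fun j => mk (u (Sum.inl j))) (i₀ := i)
    (fun j => Sum.inl_injective (by rw [← hτ, ← hτ, hσ.involutive]))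
    (fun j => by rw [← hτ, hu]) (Sum.inl_injective (by rw [← hτ, hi]))
    (fun j hj => Sum.inl_injective (hσ.fixed _ _ (by rw [hτ, hj]) hi))
  have hdiag : ((gram k.1.1).submatrix Sum.inl Sum.inl).map A.nilHom
      = Matrix.diagonal (fun j => mk (u (Sum.inl j)))
        * ((gram h.1.1).submatrix Sum.inl Sum.inl).map A.nilHom := by
    ext a b
    rw [Matrix.diagonal_mul, Matrix.map_apply, Matrix.submatrix_apply, hgram, map_mul, nilHom_coe]
    rfl
  have hdet := congrArg Matrix.det hdiag
  rw [map_gram_inl, map_gram_inl, Matrix.det_mul, Matrix.det_mul, Matrix.det_mul, Matrix.det_mul,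
    Matrix.det_mul, Matrix.det_transpose, Matrix.det_transpose, Matrix.det_diagonal, hw] at hdet
  have hJ := isUnit_det_form_inl m n A
  have hh := (isBlock_inl m n).isUnit_det_map h A.nilHom A.nilHom_odd
  generalize (((form m n A).submatrix Sum.inl Sum.inl : Matrix (Fin m) (Fin m) A).map
    A.nilHom).det = J at hdet hJ
  generalize ((h.1.1.submatrix Sum.inl Sum.inl : Matrix (Fin m) (Fin m) A).map A.nilHom).det = H
    at hdet hh
  generalize ((k.1.1.submatrix Sum.inl Sum.inl : Matrix (Fin m) (Fin m) A).map A.nilHom).det = L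
    at hdet
  have hwu : IsUnit w := by
    refine (isUnit_pow_iff two_ne_zero).1 (isUnit_of_mul_isUnit_right (x := mk (u (Sum.inl i))) ?_)
    rw [← hw, IsUnit.prod_univ_iff]
    exact fun j => (Units.isUnit _).map mk
  obtain ⟨v, hv⟩ := (hh.mul hwu).exists_right_inv
  refine ⟨L * v, ?_⟩
  have h1 : J * L ^ 2 = J * (mk (u (Sum.inl i)) * (H * w) ^ 2) := by linear_combination hdet
  have h2 := hJ.mul_left_cancel h1
  rw [mul_pow, h2, mul_assoc, ← mul_pow, hv, one_pow, mul_one]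

/-- Two Gram matrices of eigenframes with the same pairing differ by a diagonal matrix. -/
theorem exists_rescaling {m n : ℕ} (hn : Even n) {lam : Idx m n → ℂ} {σ : Idx m n → Idx m n}
    (hσ : IsPairing lam σ) {A : SuperAlg} (h k : GLmn m n A)
    (hz : ∀ i j, j ≠ σ i → gram h.1.1 i j = 0) (kz : ∀ i j, j ≠ σ i → gram k.1.1 i j = 0)
    {b c : Idx m n → A.evenˣ} (hb : ∀ i, gram h.1.1 i (σ i) = (b i : A.even))
    (hc : ∀ i, gram k.1.1 i (σ i) = (c i : A.even)) :
    ∃ z : Idx m n → A.even, IsUnit z ∧ (diagGl z).1 * gram h.1.1 * (diagGl z).1 = gram k.1.1 := by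
  let u : Idx m n → A.evenˣ := fun i => c i * (b i)⁻¹
  have hub : ∀ i, (u i : A.even) * b i = c i := fun i => by simp [u]
  -- Both Gram matrices have the same symmetry at the pair `(i, σ i)`, so the signs cancel in the
  -- ratio `u = c / b`, which is invariant under `σ`.
  have hsymm : ∀ i, (b (σ i) = b i ∧ c (σ i) = c i) ∨ (b (σ i) = -b i ∧ c (σ i) = -c i) := by
    intro i
    have hb' := hb (σ i)
    have hc' := hc (σ i)
    rw [hσ.involutive] at hb' hc'
    have hbi := hb i
    have hci := hc i
    rcases i with i | i
    · left
      obtain ⟨j, hj⟩ := hσ.inl i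
      rw [hj] at hb' hc' hbi hci ⊢
      rw [gram_inl hn h.1 i j, hbi] at hb'
      rw [gram_inl hn k.1 i j, hci] at hc'
      exact ⟨Units.ext (Subtype.ext hb'.symm), Units.ext (Subtype.ext hc'.symm)⟩
    · right
      obtain ⟨j, hj⟩ := hσ.inr i
      rw [hj] at hb' hc' hbi hci ⊢
      rw [gram_inr hn h.1 i j, hbi] at hb'
      rw [gram_inr hn k.1 i j, hci] at hc'
      exact ⟨Units.ext (Subtype.ext hb'.symm), Units.ext (Subtype.ext hc'.symm)⟩
  have hu : ∀ i, u (σ i) = u i := fun i => by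
    rcases hsymm i with ⟨h1, h2⟩ | ⟨h1, h2⟩ <;> simp [u, h1, h2]
  have hgram : ∀ i j, gram k.1.1 i j = (u i : A.even) * gram h.1.1 i j := fun i j => by
    by_cases hij : j = σ i
    · rw [hij, hb, hc, ← hub]
      rfl
    · rw [hz i j hij, kz i j hij, mul_zero]
  have hsq : ∀ i, σ i = i → ∃ r : A.even, r * r = u i := by
    intro i hi
    rcases i with i | i
    · obtain ⟨s, hs⟩ := exists_sq_eq_mk_of_gram h k hσ hu hgram hi
      exact exists_sq_eq_of_mk_nilradical (Units.isUnit _) hs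
    · -- `gram h (i, i) = -gram h (i, i)` is invertible only in the zero ring
      have h1 := gram_inr hn h.1 i i
      have h2 := hb (Sum.inr i)
      rw [hi] at h2
      rw [h2, eq_neg_iff_add_eq_zero, ← two_smul ℂ, smul_eq_zero] at h1
      have h3 : ((b (Sum.inr i) : A.even) : A) = 0 := h1.resolve_left two_ne_zero
      have h4 : IsUnit (0 : A.even) := by
        rw [← show (b (Sum.inr i) : A.even) = 0 from Subtype.ext h3]
        exact Units.isUnit _
      have := subsingleton_of_zero_eq_one (isUnit_zero_iff.1 h4)
      exact ⟨0, Subsingleton.elim _ _⟩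
  -- Any linear order will do: it only selects one index from each pair.
  let _ : LinearOrder (Idx m n) := LinearOrder.lift' (Fintype.equivFin (Idx m n))
    (Fintype.equivFin (Idx m n)).injective
  obtain ⟨z, hzu⟩ := exists_mul_involution_eq hσ.involutive
    (fun i => congrArg Units.val (hu i)) hsq
  refine ⟨z, ?_, ?_⟩
  · rw [Pi.isUnit_iff]
    exact fun i => isUnit_of_mul_isUnit_left (y := z (σ i)) (by rw [hzu]; exact Units.isUnit _)
  · ext i j
    rw [diagGl_coe, Matrix.mul_diagonal, Matrix.diagonal_mul, hgram]
    by_cases hij : j = σ i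
    · rw [hij, ← hzu, mul_assoc, ← A.even_comm _ (z (σ i)).2, ← mul_assoc]
      rfl
    · rw [hz i j hij, mul_zero, zero_mul, mul_zero]

end SuperOrbit

end

noncomputable section

namespace SuperOrbit

open SuperAlg Polynomial

/-! ### Conjugation by elements of the group -/

theorem glMap_unit_diagGl {m n : ℕ} (A : SuperAlg) (lam : Idx m n → ℂ) :
    glMap A.unit (diagGl (constEven SuperAlg.base lam)) = diagGl (constEven A lam) := by
  rw [glMap_diagGl]
  congr 1

theorem base_odd_eq_zero {a : SuperAlg.base} (h : a ∈ SuperAlg.base.odd) : a = 0 := h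

theorem glMap_unit_inl_inr {m n : ℕ} (A : SuperAlg) (M : gl m n SuperAlg.base) (i : Fin m)
    (j : Fin n) : (glMap A.unit M).1 (Sum.inl i) (Sum.inr j) = 0 := by
  have h := base_odd_eq_zero (gl_map_inl_inr M i j)
  exact (congrArg (hom A.unit) h).trans (map_zero _)

theorem glMap_unit_inr_inl {m n : ℕ} (A : SuperAlg) (M : gl m n SuperAlg.base) (i : Fin n)
    (j : Fin m) : (glMap A.unit M).1 (Sum.inr i) (Sum.inl j) = 0 := by
  have h := base_odd_eq_zero (gl_map_inr_inl M i j)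
  exact (congrArg (hom A.unit) h).trans (map_zero _)

theorem ber_diagGl {m n : ℕ} {A : SuperAlg} (z : Idx m n → A.even) :
    ber (diagGl z).1 = (∏ i, z (Sum.inl i)) * Ring.inverse (∏ i, z (Sum.inr i)) := by
  have h1 : (diagGl z).1.toBlocks₁₁ = Matrix.diagonal fun i => (z (Sum.inl i) : A) := by
    ext i j
    simp [diagGl_coe, Matrix.toBlocks₁₁, Matrix.diagonal_apply]
  have h2 : (diagGl z).1.toBlocks₁₂ = 0 := by
    ext i j
    simp [diagGl_coe, Matrix.toBlocks₁₂]
  have h3 : (diagGl z).1.toBlocks₂₂ = Matrix.diagonal fun i => (z (Sum.inr i) : A) := by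
    ext i j
    simp [diagGl_coe, Matrix.toBlocks₂₂, Matrix.diagonal_apply]
  have h4 : ∀ {κ : Type} [DecidableEq κ] (w : κ → A.even),
      (Matrix.diagonal fun i => (w i : A)).map A.ev = Matrix.diagonal w := fun w => by
    rw [Matrix.diagonal_map (map_zero _)]
    congr 1
    funext i
    exact A.ev_even _
  rw [ber, h1, h2, h3, h4, Matrix.zero_mul, Matrix.zero_mul, sub_zero, h4, Matrix.det_diagonal,
    Matrix.det_nonsing_inv, Matrix.det_diagonal]

/-- One diagonal entry different from `1` suffices, with `c` inverted if it is placed in the odd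
block. The condition `m ≠ n` ensures that there is an index at all. -/
theorem exists_ber_diagGl_eq {m n : ℕ} (hmn : m ≠ n) {A : SuperAlg} (c : A.evenˣ) :
    ∃ z : (Idx m n → A.even)ˣ, ber (diagGl z.1).1 = c := by
  have hex : ∀ k : Idx m n, ∀ c : A.evenˣ, ∃ z : (Idx m n → A.even)ˣ, z.1 = Pi.mulSingle k c.1 :=
    fun k c => ⟨⟨Pi.mulSingle k c.1, Pi.mulSingle k (c⁻¹).1, by
      rw [← Pi.mulSingle_mul, Units.mul_inv, Pi.mulSingle_one], by
      rw [← Pi.mulSingle_mul, Units.inv_mul, Pi.mulSingle_one]⟩, rfl⟩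
  rcases Nat.eq_zero_or_pos m with hm | hm
  · have hn : 0 < n := by omega
    obtain ⟨z, hz⟩ := hex (Sum.inr ⟨0, hn⟩) c⁻¹
    refine ⟨z, ?_⟩
    rw [ber_diagGl, hz]
    have h1 : ∀ i, (Pi.mulSingle (Sum.inr ⟨0, hn⟩) (c⁻¹).1 : Idx m n → A.even) (Sum.inl i) = 1 :=
      fun i => Pi.mulSingle_eq_of_ne (by simp) _
    have h2 : ∀ i, (Pi.mulSingle (Sum.inr ⟨0, hn⟩) (c⁻¹).1 : Idx m n → A.even) (Sum.inr i)
        = if i = ⟨0, hn⟩ then (c⁻¹).1 else 1 := fun i => by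
      simp [Pi.mulSingle_apply]
    simp only [h1, h2, Finset.prod_const_one, one_mul, Finset.prod_ite_eq', Finset.mem_univ,
      if_true]
    rw [Ring.inverse_unit, inv_inv]
  · obtain ⟨z, hz⟩ := hex (Sum.inl ⟨0, hm⟩) c
    refine ⟨z, ?_⟩
    rw [ber_diagGl, hz]
    have h1 : ∀ i, (Pi.mulSingle (Sum.inl ⟨0, hm⟩) c.1 : Idx m n → A.even) (Sum.inr i) = 1 :=
      fun i => Pi.mulSingle_eq_of_ne (by simp) _
    have h2 : ∀ i, (Pi.mulSingle (Sum.inl ⟨0, hm⟩) c.1 : Idx m n → A.even) (Sum.inl i)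
        = if i = ⟨0, hm⟩ then c.1 else 1 := fun i => by
      simp [Pi.mulSingle_apply]
    simp only [h1, h2, Finset.prod_const_one, Finset.prod_ite_eq', Finset.mem_univ,
      if_true, Ring.inverse_one, mul_one]

/-- The diagonal matrices, as elements of `GL_{m|n}(A)`. -/
def diagUnit {m n : ℕ} {A : SuperAlg} (z : (Idx m n → A.even)ˣ) : GLmn m n A :=
  Units.map (diagGl : (Idx m n → A.even) →ₐ[ℂ] gl m n A).toRingHom.toMonoidHom z

theorem diagUnit_coe {m n : ℕ} {A : SuperAlg} (z : (Idx m n → A.even)ˣ) :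
    (diagUnit z).1 = diagGl z.1 := rfl

theorem gram_one {m n : ℕ} (A : SuperAlg) : gram (1 : Mat m n A) = form m n A := by
  rw [gram, superTranspose_one, one_mul, mul_one]

/-- An eigenframe of `Y` and an eigenframe of `X₀` differ, up to a diagonal matrix, by an element
of the group. -/
theorem exists_inGroup {t : Series} {m n : ℕ} (hsl : t = Series.sl → m ≠ n)
    (hosp : t = Series.osp → Even n) (X₀ : Lie t m n SuperAlg.base) {lam : Idx m n → ℂ}
    (hlam : Function.Injective lam) (h₀ : GLmn m n SuperAlg.base)
    (hh₀ : X₀.1 * h₀.1 = h₀.1 * diagGl (constEven SuperAlg.base lam)) {A : SuperAlg}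
    (Y : Lie t m n A) (h : GLmn m n A) {d : Idx m n → A.even} (hd : Y.1 * h.1 = h.1 * diagGl d)
    (hnil : ∀ k, IsNilpotent (d k - algebraMap ℂ A.even (lam k))) :
    ∃ z : (Idx m n → A.even)ˣ,
      InGroup t (h * diagUnit z * (GLmnMap A.unit h₀)⁻¹ : GLmn m n A).1.1 := by
  cases t with
  | sl =>
    let V : GLmn m n A := (GLmnMap A.unit h₀)⁻¹
    have hV : V.1 = glMap A.unit (h₀⁻¹).1 := rfl
    obtain ⟨u, hu⟩ := isUnit_ber h
    obtain ⟨v, hv⟩ := isUnit_ber V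
    obtain ⟨z, hz⟩ := exists_ber_diagGl_eq (hsl rfl) (u⁻¹ * v⁻¹ : A.evenˣ)
    refine ⟨z, ?_⟩
    change ber ((h.1 * (diagUnit z).1) * V.1).1 = 1
    -- Both right factors are block diagonal, `V` because it comes from a complex matrix, so the
    -- restricted multiplicativity of the Berezinian is enough.
    rw [ber_mul_blockDiag (h.1 * (diagUnit z).1) V
      (by ext i j; rw [hV]; exact glMap_unit_inl_inr A _ i j)
      (by ext i j; rw [hV]; exact glMap_unit_inr_inl A _ i j),
      ber_mul_blockDiag h.1 (diagUnit z)
      (by ext i j; simp [diagUnit_coe, diagGl_coe, Matrix.toBlocks₁₂])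
      (by ext i j; simp [diagUnit_coe, diagGl_coe, Matrix.toBlocks₂₁]), diagUnit_coe, hz, ← hu,
      ← hv, ← Units.val_mul, ← Units.val_mul, ← Units.val_one]
    congr 1
    rw [mul_inv_cancel_left, inv_mul_cancel]
  | osp =>
    have hn := hosp rfl
    obtain ⟨σ, hσ⟩ := exists_pairing X₀ hlam h₀ hh₀
    let U : GLmn m n A := GLmnMap A.unit h₀
    have hU : (lieMap A.unit X₀).1 * U.1 = U.1 * diagGl (constEven A lam) := by
      have h1 := congrArg (glMap A.unit) hh₀
      rw [map_mul, map_mul, glMap_unit_diagGl] at h1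
      exact h1
    obtain ⟨hz, b, hb⟩ := exists_gram_units hσ Y h hd hnil
    obtain ⟨kz, c, hc⟩ := exists_gram_units hσ (lieMap A.unit X₀) U hU
      fun k => by rw [constEven, sub_self]; exact IsNilpotent.zero
    obtain ⟨_, ⟨z, rfl⟩, hzz⟩ := exists_rescaling hn hσ h U hz kz hb hc
    refine ⟨z, ?_⟩
    change gram ((h.1 * (diagUnit z).1).1 * (U⁻¹).1.1) = form m n A
    -- Once the two frames have equal Gram matrices, the matrix carrying one to the other preserves
    -- the form.
    have h1 : gram (h.1 * (diagUnit z).1).1 = gram U.1.1 := by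
      refine (gram_mul h.1 (diagUnit z).1).trans ?_
      rw [diagUnit_coe, superTranspose_diagGl, hzz]
    rw [gram_mul (h.1 * (diagUnit z).1) (U⁻¹).1, h1, ← gram_mul, ← gram_one]
    congr 1
    exact congrArg Subtype.val U.mul_inv

theorem mem_lie_of_conj {t : Series} {m n : ℕ} {A : SuperAlg} (g : Grp t m n A) (X : gl m n A)
    (Y : Lie t m n A) (h : Y.1 * g.1.1 = g.1.1 * X) : ∀ x ∈ lieEquations t X.1, x = 0 := by
  have hX : X = (g.1⁻¹).1 * Y.1 * g.1.1 := by
    rw [mul_assoc, h, ← mul_assoc, Units.inv_mul, one_mul]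
  cases t with
  | sl =>
    rintro _ rfl
    have h1 : str Y.1.1 = 0 := Y.2 _ rfl
    have h2 := str_mul_comm ((g.1⁻¹).1 * Y.1) g.1.1
    have h3 : g.1.1 * ((g.1⁻¹).1 * Y.1) = Y.1 := by rw [← mul_assoc, Units.mul_inv, one_mul]
    have h4 := congrArg Subtype.val h3
    rw [hX]
    exact h2.trans ((congrArg str h4).trans h1)
  | osp =>
    have hg : gram g.1.1.1 = form m n A := g.2
    have hg' : InGroup Series.osp (g.1⁻¹).1.1 := by
      change gram (g.1⁻¹).1.1 = form m n A
      have h1 : g.1.1.1 * (g.1⁻¹).1.1 = 1 := congrArg Subtype.val g.1.mul_inv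
      have h2 := gram_mul g.1.1 (g.1⁻¹).1
      rw [h1, gram_one, hg] at h2
      exact h2.symm
    have h1 : conj g.1⁻¹ Y.1 = X := by rw [conj, inv_inv, ← hX]
    rw [← h1]
    exact conj_mem g.1⁻¹ Y.1 hg' Y.2

/-! ### Points without odd coordinates -/

/-- The parity involution, as an automorphism of the superalgebra. -/
def SuperAlg.parityIso (A : SuperAlg) : A ⟶ A where
  toAlgHom := A.parity
  map_even a ha := by rwa [parity_even ha]
  map_odd a ha := by rw [parity_odd ha]; exact A.odd.neg_mem ha

/-- The parity automorphism of `A` fixes `X`, hence fixes all values at `X`, but it negates the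
value of an odd function. -/
theorem point_odd_eq_zero {t : Series} {m n : ℕ} {A : SuperAlg} (X : Lie t m n A)
    (hX : ∀ i j, X.1.1 i j ∈ A.even) {a : coord t m n} (ha : a ∈ (coord t m n).odd) :
    hom (point X) a = 0 := by
  have h1 : lieMap A.parityIso X = X := by
    apply Subtype.ext
    apply Subtype.ext
    ext i j
    exact parity_even (hX i j)
  have h2 := point_lieMap A.parityIso X
  rw [h1] at h2
  have h3 : hom (point X) a = A.parity (hom (point X) a) := congrArg (fun φ => hom φ a) h2
  rw [parity_odd (hom_odd _ ha), eq_neg_iff_add_eq_zero, ← two_smul ℂ, smul_eq_zero] at h3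
  exact h3.resolve_left two_ne_zero

theorem IsBlock.submatrix_mul {m n : ℕ} {κ : Type*} [Fintype κ] {b : κ → Idx m n}
    (hb : IsBlock b) {R : Type*} [Semiring R] (M N : Matrix (Idx m n) (Idx m n) R)
    (hN : ∀ k j, k ∉ Set.range b → N k (b j) = 0) :
    (M * N).submatrix b b = M.submatrix b b * N.submatrix b b := by
  ext i j
  simp only [Matrix.submatrix_apply, Matrix.mul_apply]
  exact (Fintype.sum_of_injective b hb.inj _ _ (fun k hk => by rw [hN k j hk, mul_zero])
    fun k => rfl).symm

/-- If `Z = U diag(d) U⁻¹`, with `U` complex, lies on the zero locus of the `pᵢ - cᵢ` and `d` is a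
nilpotent deformation of the eigenvalues `λ` of `X₀`, then `d = λ`. -/
theorem eigenvalue_rigid {t : Series} {m n l : ℕ} {X₀ : Lie t m n SuperAlg.base}
    {p : Fin l → coord t m n}
    (hideal : orbitIdeal X₀ = Ideal.span (Set.range fun i =>
      (coord t m n).toRed (p i - algebraMap ℂ (coord t m n) (cvalue (p i) X₀))))
    {lam : Idx m n → ℂ} (hlam : Function.Injective lam) {A : SuperAlg} (Z : Lie t m n A)
    (hp : ∀ i, value (p i) Z = algebraMap ℂ A (cvalue (p i) X₀)) (hZ : ∀ i j, Z.1.1 i j ∈ A.even)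
    (h₀ : GLmn m n SuperAlg.base) {d : Idx m n → A.even}
    (hd : Z.1 * (GLmnMap A.unit h₀).1 = (GLmnMap A.unit h₀).1 * diagGl d)
    (hnil : ∀ k, IsNilpotent (d k - algebraMap ℂ A.even (lam k)))
    {κ : Type} [Fintype κ] [DecidableEq κ] {b : κ → Idx m n} (hb : IsBlock b)
    (hspec : ((cmatrix X₀).submatrix b b).charpoly = ∏ i, (X - C (lam (b i)))) (i : κ) :
    d (b i) = algebraMap ℂ A.even (lam (b i)) := by
  have hmem : ∀ a, hom (point Z) a ∈ A.even := fun a => by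
    obtain ⟨x, hx, y, hy, rfl⟩ := (coord t m n).exists_add a
    rw [map_add, point_odd_eq_zero Z hZ hy, add_zero]
    exact hom_even _ hx
  -- Since `Z` has only even entries, evaluation at `Z` lands in `A₀` and already kills the odd
  -- functions. Thus `charpoly_block_eq` applies over `A₀` itself, and no nilpotents are lost.
  let Φ : coord t m n →ₐ[ℂ] A.even := (hom (point Z)).codRestrict A.even hmem
  have hΦ : ∀ a ∈ (coord t m n).odd, Φ.toRingHom a = 0 := fun a ha =>
    Subtype.ext (point_odd_eq_zero Z hZ ha)
  have hΦp : ∀ i, Φ.toRingHom (p i)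
      = Φ.toRingHom (algebraMap ℂ (coord t m n) (cvalue (p i) X₀)) := fun i =>
    Subtype.ext ((hp i).trans ((hom (point Z)).commutes _).symm)
  let N : Matrix κ κ A.even := ((coordMatrix t m n).submatrix b b).map Φ.toRingHom
  have hN : N = (Z.1.1.submatrix b b).map A.ev := by
    ext i j
    rw [← coordMatrix_map Z]
    exact (A.ev_coe (hmem _)).symm
  have hchar := charpoly_block_eq hideal Φ.toRingHom hΦ hΦp hb
  have hcomp : Φ.toRingHom.comp (algebraMap ℂ (coord t m n)) = algebraMap ℂ A.even :=
    Φ.comp_algebraMap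
  rw [hspec, hcomp, Polynomial.map_prod] at hchar
  let U : GLmn m n A := GLmnMap A.unit h₀
  have hU : ∀ k j, k ∉ Set.range b → U.1.1 k (b j) = 0 := fun k j hk => by
    have h1 := h₀.1.2 k (b j)
    rw [(hb.odd _ j k hk).2] at h1
    exact (congrArg (hom A.unit) (base_odd_eq_zero h1)).trans (map_zero _)
  let V : Matrix κ κ A.even := (U.1.1.submatrix b b).map A.ev
  have hV : IsUnit V.det := hb.isUnit_det U
  have hNV : N * V = V * Matrix.diagonal (d ∘ b) := by
    have h1 : (Z.1.1 * U.1.1).submatrix b b = (U.1.1 * (diagGl d).1).submatrix b b :=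
      congrArg (fun M : gl m n A => M.1.submatrix b b) hd
    rw [hb.submatrix_mul _ _ hU, hb.submatrix_mul _ _ fun k j hk => by
      rw [diagGl_coe, Matrix.diagonal_apply_ne]
      rintro rfl
      exact hk ⟨j, rfl⟩] at h1
    have h2 := congrArg (fun M : Matrix κ κ A => M.map A.ev) h1
    have h3 : (diagGl d).1.submatrix b b = Matrix.diagonal fun i => (d (b i) : A) := by
      rw [diagGl_coe]
      ext i j
      simp [Matrix.diagonal_apply, hb.inj.eq_iff]
    rw [map_ev_mul (Z.1.1.submatrix b b) (U.1.1.submatrix b b) (fun i j => hb.mem_even U.1 i j),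
      map_ev_mul (U.1.1.submatrix b b) ((diagGl d).1.submatrix b b)
        (fun i j => hb.mem_even (diagGl d) i j), h3, Matrix.diagonal_map (map_zero _), ← hN] at h2
    convert h2 using 3
    funext i
    exact (A.ev_even (d (b i))).symm
  have hchar' : N.charpoly = (Matrix.diagonal (d ∘ b)).charpoly := by
    have h1 := Matrix.charpoly_units_conj (Matrix.nonsingInvUnit V hV) (Matrix.diagonal (d ∘ b))
    rw [← h1]
    congr 1
    change N = V * Matrix.diagonal (d ∘ b) * V⁻¹
    rw [← hNV, Matrix.mul_assoc, Matrix.mul_nonsing_inv _ hV, Matrix.mul_one]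
  have hroot : (Matrix.diagonal (d ∘ b)).charpoly.eval (d (b i)) = 0 := by
    rw [Matrix.eval_charpoly, Matrix.scalar_apply, Matrix.diagonal_sub, Matrix.det_diagonal]
    exact Finset.prod_eq_zero (Finset.mem_univ i) (sub_self _)
  rw [← hchar', hchar, eval_prod, ← Finset.mul_prod_erase _ _ (Finset.mem_univ i)] at hroot
  -- In `∏ⱼ (dᵢ - λⱼ) = 0` every factor with `j ≠ i` is a nonzero number plus a nilpotent, so only
  -- `dᵢ - λᵢ` can account for the zero.
  have hu : IsUnit (∏ j ∈ Finset.univ.erase i,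
      ((X - C (lam (b j))).map (algebraMap ℂ A.even)).eval (d (b i))) := by
    refine IsUnit.prod_iff.2 fun j hj => ?_
    have h1 : ((X - C (lam (b j))).map (algebraMap ℂ A.even)).eval (d (b i))
        = d (b i) + algebraMap ℂ A.even (-lam (b j)) := by
      simp [sub_eq_add_neg]
    rw [h1]
    refine isUnit_add_of_nilpotent (hnil _) (by rw [sub_self]; exact IsNilpotent.zero) ?_
    rw [← sub_eq_add_neg, sub_ne_zero]
    exact fun h2 => (Finset.mem_erase.1 hj).1 (hb.inj (hlam h2)).symm
  have h1 := (hu.mul_left_eq_zero).1 hroot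
  simpa [sub_eq_zero] using h1

end SuperOrbit

end

noncomputable section

namespace SuperOrbit

open SuperAlg Polynomial

/-! ### The zero locus of the `pᵢ - cᵢ` is locally an orbit -/

theorem glMap_unit_mem_even {m n : ℕ} {A : SuperAlg} (M : gl m n SuperAlg.base) (i j : Idx m n) :
    (glMap A.unit M).1 i j ∈ A.even :=
  hom_even A.unit (show M.1 i j ∈ (⊤ : Subalgebra ℂ ℂ) from trivial)

theorem value_lieMap {t : Series} {m n : ℕ} {A B : SuperAlg} (φ : A ⟶ B) (a : coord t m n)
    (X : Lie t m n A) : value a (lieMap φ X) = hom φ (value a X) :=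
  congrArg (fun ψ => hom ψ a) (point_lieMap φ X)

theorem value_lieMap_unit {t : Series} {m n : ℕ} (A : SuperAlg) (a : coord t m n)
    (X : Lie t m n SuperAlg.base) :
    value a (lieMap A.unit X) = algebraMap ℂ A (cvalue a X) :=
  value_lieMap A.unit a X

/-- A point of the zero locus of the `pᵢ - cᵢ` with an eigenframe whose eigenvalues are nilpotent
deformations of those of `X₀` is in the orbit of `X₀`. -/
theorem exists_eq_ad {t : Series} {m n l : ℕ} (hsl : t = Series.sl → m ≠ n)
    (hosp : t = Series.osp → Even n) {X₀ : Lie t m n SuperAlg.base} {p : Fin l → coord t m n}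
    (hinv : ∀ i, IsInvariantPoly (p i))
    (hideal : orbitIdeal X₀ = Ideal.span (Set.range fun i =>
      (coord t m n).toRed (p i - algebraMap ℂ (coord t m n) (cvalue (p i) X₀))))
    {lam : Idx m n → ℂ} (hlam : Function.Injective lam)
    (h1 : ((cmatrix X₀).submatrix Sum.inl Sum.inl).charpoly = ∏ i, (X - C (lam (Sum.inl i))))
    (h2 : ((cmatrix X₀).submatrix Sum.inr Sum.inr).charpoly = ∏ i, (X - C (lam (Sum.inr i))))
    (h₀ : GLmn m n SuperAlg.base)
    (hh₀ : X₀.1 * h₀.1 = h₀.1 * diagGl (constEven SuperAlg.base lam)) {A : SuperAlg}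
    (Y : Lie t m n A) (hY : ∀ i, value (p i) Y = algebraMap ℂ A (cvalue (p i) X₀))
    (h : GLmn m n A) {d : Idx m n → A.even} (hd : Y.1 * h.1 = h.1 * diagGl d)
    (hnil : ∀ k, IsNilpotent (d k - algebraMap ℂ A.even (lam k))) :
    ∃ g : Grp t m n A, Y = Ad g (lieMap A.unit X₀) := by
  obtain ⟨z, hz⟩ := exists_inGroup hsl hosp X₀ hlam h₀ hh₀ Y h hd hnil
  let U : GLmn m n A := GLmnMap A.unit h₀
  let g : Grp t m n A := ⟨h * diagUnit z * U⁻¹, hz⟩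
  -- This is `X₀` with its eigenvalues `λ` deformed to `d`; the element `g` conjugates it to `Y`.
  let D : gl m n A := U.1 * diagGl d * (U⁻¹).1
  have hDU : D * U.1 = U.1 * diagGl d := Units.inv_mul_cancel_right _ U
  have hYg : Y.1 * g.1.1 = g.1.1 * D := by
    have h3 : diagGl d * (diagUnit z).1 = (diagUnit z).1 * diagGl d := by
      rw [diagUnit_coe, ← map_mul, ← map_mul, mul_comm]
    change Y.1 * (h.1 * (diagUnit z).1 * (U⁻¹).1)
      = h.1 * (diagUnit z).1 * (U⁻¹).1 * (U.1 * diagGl d * (U⁻¹).1)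
    rw [mul_assoc U.1, mul_assoc _ (U⁻¹).1, Units.inv_mul_cancel_left, ← mul_assoc, ← mul_assoc,
      hd, mul_assoc h.1, h3]
    simp only [mul_assoc]
  let Z : Lie t m n A := ⟨D, mem_lie_of_conj g D Y hYg⟩
  have hYZ : Y = Ad g Z := by
    apply Subtype.ext
    change Y.1 = g.1.1 * D * (g.1⁻¹).1
    rw [← hYg, Units.mul_inv_cancel_right]
  -- Invariance carries the equations from `Y`, which may have odd entries, to `Z`, which has none.
  have hZp : ∀ i, value (p i) Z = algebraMap ℂ A (cvalue (p i) X₀) := fun i => by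
    rw [← hY i, hYZ, hinv i A g Z]
  have hZe : ∀ i j, Z.1.1 i j ∈ A.even := fun i j => by
    change (U.1.1 * (diagGl d).1 * (U⁻¹).1.1 : Mat m n A) i j ∈ A.even
    rw [diagGl_coe, Matrix.mul_apply]
    refine A.even.sum_mem fun k _ => A.even.mul_mem ?_ (glMap_unit_mem_even (h₀⁻¹).1 k j)
    rw [Matrix.mul_diagonal]
    exact A.even.mul_mem (glMap_unit_mem_even h₀.1 i k) (d k).2
  have hdlam : d = constEven A lam := by
    funext k
    rcases k with k | k
    · exact eigenvalue_rigid hideal hlam Z hZp hZe h₀ hDU hnil (isBlock_inl m n) h1 k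
    · exact eigenvalue_rigid hideal hlam Z hZp hZe h₀ hDU hnil (isBlock_inr m n) h2 k
  have hZX : Z = lieMap A.unit X₀ := by
    apply Subtype.ext
    have h3 := congrArg (glMap A.unit) hh₀
    rw [map_mul, map_mul, glMap_unit_diagGl, ← hdlam] at h3
    exact U.isUnit.mul_left_injective (hDU.trans h3.symm)
  exact ⟨g, hYZ.trans (congrArg (Ad g) hZX)⟩

/-- The even part of an inverse of an even element is again an inverse. -/
theorem isUnit_even_of_isUnit {A : SuperAlg} {a : A.even} (h : IsUnit (a : A)) : IsUnit a := by
  obtain ⟨b, hb⟩ := h.exists_left_inv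
  have h1 := A.ev_mul_even b a.2
  rw [hb] at h1
  have h2 := A.ev_even 1
  rw [OneMemClass.coe_one] at h2
  rw [h2] at h1
  refine IsUnit.of_mul_eq_one (A.ev b) ?_
  rw [mul_comm]
  refine Eq.trans ?_ h1.symm
  congr 1
  exact (A.ev_even a).symm

theorem isUnit_evenHom_toLoc (A : SuperAlg) (f : A.even) : IsUnit (evenHom (A.toLoc f) f) :=
  isUnit_even_of_isUnit (isUnit_hom_toLoc A f)

theorem evenHom_det_block {m n : ℕ} {A B : SuperAlg} (φ : A ⟶ B) (M : gl m n A) {κ : Type*}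
    [Fintype κ] [DecidableEq κ] (b : κ → Idx m n) :
    (((glMap φ M).1.submatrix b b).map B.ev).det
      = evenHom φ ((M.1.submatrix b b).map A.ev).det := by
  rw [RingHom.map_det]
  congr 1
  ext i j
  exact congrArg Subtype.val (evenHom_ev φ _).symm

/-- A point of the zero locus of the `pᵢ - cᵢ` is locally in the orbit of `X₀`. -/
theorem exists_cover {t : Series} {m n l : ℕ} (hsl : t = Series.sl → m ≠ n)
    (hosp : t = Series.osp → Even n) {X₀ : Lie t m n SuperAlg.base}
    (hX₀ : HasDistinctEigenvalues X₀) {p : Fin l → coord t m n}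
    (hinv : ∀ i, IsInvariantPoly (p i))
    (hideal : orbitIdeal X₀ = Ideal.span (Set.range fun i =>
      (coord t m n).toRed (p i - algebraMap ℂ (coord t m n) (cvalue (p i) X₀))))
    {A : SuperAlg} (Y : Lie t m n A)
    (hY : ∀ i, value (p i) Y = algebraMap ℂ A (cvalue (p i) X₀)) :
    Ideal.span {f : A.even | ∃ g : Grp t m n (A.loc f),
      lieMap (A.toLoc f) Y = Ad g (lieMap (A.loc f).unit X₀)} = ⊤ := by
  obtain ⟨lam, hlam, h1, h2⟩ := exists_spectrum hX₀
  obtain ⟨h₀, hh₀⟩ := exists_diagonalizer hlam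
    (hasBlockSpectrum_of_value hideal h1 h2 X₀ fun i => rfl)
  by_contra hne
  -- If the admissible `f` generated a proper ideal, they would lie in a maximal ideal `I`. The
  -- frame over the residue field at `I` yields an admissible `f` outside `I`, the product of its
  -- two block determinants.
  obtain ⟨I, hI, hle⟩ := Ideal.exists_le_maximal _ hne
  let _ : Field (A.even ⧸ I) := Ideal.Quotient.field I
  have hspec := hasBlockSpectrum_of_value hideal h1 h2 Y hY
  obtain ⟨N, hN⟩ := hspec.isNilpotent
  have hN' : aeval Y.1 (∏ k, (X - C (lam k))) ^ (N + 1) = 0 := by rw [pow_succ, hN, zero_mul]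
  obtain ⟨e, he1, he2⟩ := exists_idempotent_polynomials hlam (N + 1)
  obtain ⟨h, hh, hu, hv⟩ := exists_frame hlam N.succ_ne_zero he1 he2 hN' hspec
    (Ideal.Quotient.mkₐ ℂ I) (Ideal.Quotient.mkₐ_surjective ℂ I)
  obtain ⟨u, hu'⟩ : ∃ u, u = ((h.1.submatrix Sum.inl Sum.inl).map A.ev).det := ⟨_, rfl⟩
  obtain ⟨v, hv'⟩ : ∃ v, v = ((h.1.submatrix Sum.inr Sum.inr).map A.ev).det := ⟨_, rfl⟩
  rw [← hu'] at hu
  rw [← hv'] at hv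
  have hmem : u * v ∈ I := by
    refine hle (Ideal.subset_span ?_)
    let φ := A.toLoc (u * v)
    have hunit : IsUnit (evenHom φ u * evenHom φ v) := by
      rw [← map_mul]
      exact isUnit_evenHom_toLoc A (u * v)
    obtain ⟨h', hh'⟩ := gl_isUnit (glMap φ h)
      (by rw [evenHom_det_block, ← hu']; exact isUnit_of_mul_isUnit_left hunit)
      (by rw [evenHom_det_block, ← hv']; exact isUnit_of_mul_isUnit_right hunit)
    have hY' : ∀ i, value (p i) (lieMap φ Y) = algebraMap ℂ _ (cvalue (p i) X₀) := fun i => by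
      rw [value_lieMap, hY, AlgHom.commutes]
    have hN'' : aeval (lieMap φ Y).1 (∏ k, (X - C (lam k))) ^ (N + 1) = 0 := by
      change aeval (glMap φ Y.1) _ ^ _ = 0
      rw [aeval_algHom_apply, ← map_pow, hN', map_zero]
    obtain ⟨d, hd, hd'⟩ := exists_diagonal_of_frame hlam he2 hN'' h' fun k => by
      have h3 := congrArg (glMap φ) (hh k)
      rw [map_mul, map_mul, ← aeval_algHom_apply, glMap_diagGl, ← hh'] at h3
      refine h3.trans ?_
      congr 2
      funext i
      by_cases hi : i = k
      · subst hi
        simp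
      · simp [hi]
    exact exists_eq_ad hsl hosp hinv hideal hlam h1 h2 h₀ hh₀ (lieMap φ Y) hY' h' hd
      fun k => ⟨_, hd' k⟩
  rcases hI.isPrime.mem_or_mem hmem with h3 | h3
  · exact hu (Ideal.Quotient.eq_zero_iff_mem.2 h3)
  · exact hv (Ideal.Quotient.eq_zero_iff_mem.2 h3)

/-! ### The representing superalgebra -/

theorem SuperAlg.quot_hom_ext {P : SuperAlg} {S : Set P} {B : SuperAlg} {φ ψ : quot P S ⟶ B}
    (h : toQuot P S ≫ φ = toQuot P S ≫ ψ) : φ = ψ :=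
  hom_ext (AlgHom.ext fun a => by
    obtain ⟨a, rfl⟩ := quotMk_surjective P S a
    exact congrArg (fun θ => hom θ a) h)

/-- The morphism `A_{X₀} → A` given by a point of the orbit of `X₀`. -/
def orbitPoint {t : Series} {m n l : ℕ} {X₀ : Lie t m n SuperAlg.base} {p : Fin l → coord t m n}
    (hinv : ∀ i, IsInvariantPoly (p i)) {A : SuperAlg} (Y : (orbitFunctor X₀).obj A) :
    orbitAlg p X₀ ⟶ A :=
  quotDesc _ _ (point Y.1) (by
    obtain ⟨_, g, rfl⟩ := Y
    rintro _ ⟨i, rfl⟩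
    rw [map_sub, AlgHom.commutes, sub_eq_zero]
    exact (hinv i A g _).trans (value_lieMap_unit A _ _))

theorem toQuot_orbitPoint {t : Series} {m n l : ℕ} {X₀ : Lie t m n SuperAlg.base}
    {p : Fin l → coord t m n} (hinv : ∀ i, IsInvariantPoly (p i)) {A : SuperAlg}
    (Y : (orbitFunctor X₀).obj A) : toQuot _ _ ≫ orbitPoint hinv Y = point Y.1 :=
  toQuot_desc _ _ _ _

/-- The evaluation at the points of the orbit of `X₀`, as a natural transformation. -/
def orbitEval {t : Series} {m n l : ℕ} {X₀ : Lie t m n SuperAlg.base} {p : Fin l → coord t m n}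
    (hinv : ∀ i, IsInvariantPoly (p i)) :
    orbitFunctor X₀ ⟶ coyoneda.obj (Opposite.op (orbitAlg p X₀)) where
  app A := TypeCat.ofHom fun Y => orbitPoint hinv Y
  naturality A B φ := by
    ext Y
    refine quot_hom_ext ((toQuot_orbitPoint hinv _).trans ((point_lieMap φ Y.1).trans ?_))
    rw [← toQuot_orbitPoint hinv Y]
    rfl

end SuperOrbit

end

/-! ### The representability theorem -/

theorem mainTheorem1 (t : Series) (m n : ℕ)
    (hsl : t = Series.sl → m ≠ n)
    (hosp : t = Series.osp → Even n ∧ m ≠ n + 2)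
    (X₀ : Lie t m n SuperAlg.base) (hX₀ : HasDistinctEigenvalues X₀)
    (l : ℕ) (p : Fin l → coord t m n)
    (hinv : ∀ i, IsInvariantPoly (p i))
    (hideal : orbitIdeal X₀ = Ideal.span (Set.range fun i =>
      (coord t m n).toRed (p i - algebraMap ℂ (coord t m n) (cvalue (p i) X₀)))) :
    ∃ η : orbitFunctor X₀ ⟶ coyoneda.obj (Opposite.op (orbitAlg p X₀)),
      (∀ (A : SuperAlg) (Y : (orbitFunctor X₀).obj A),
        SuperAlg.toQuot _ _ ≫ η.app A Y = point Y.1) ∧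
      IsSheafification η := by
  refine ⟨orbitEval hinv, fun A Y => toQuot_orbitPoint hinv Y, ?_⟩
  let π : coord t m n ⟶ orbitAlg p X₀ := SuperAlg.toQuot _ _
  -- The universal point of the zero locus. The cover over which it lies in the orbit is what
  -- `isSheafification_of_cover` requires; a finite part of it already generates the unit ideal.
  let Y : Lie t m n (orbitAlg p X₀) := ofPoint π
  have hpt : point Y = π := point_ofPoint π
  have hY : ∀ i, value (p i) Y = algebraMap ℂ _ (cvalue (p i) X₀) := fun i => by
    have h1 : SuperAlg.hom π (p i - algebraMap ℂ (coord t m n) (cvalue (p i) X₀)) = 0 :=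
      SuperAlg.hom_toQuot_eq_zero _ _ ⟨i, rfl⟩
    rwa [map_sub, AlgHom.commutes, sub_eq_zero, ← hpt] at h1
  obtain ⟨T, hT, hspan⟩ := (Ideal.span_eq_top_iff_finite _).1
    (exists_cover hsl (fun h => (hosp h).1) hX₀ hinv hideal Y hY)
  have hmem : ∀ i, ((T.equivFin.symm i).1 : (orbitAlg p X₀).even) ∈ _ :=
    fun i => hT (T.equivFin.symm i).2
  refine isSheafification_of_cover (orbitEval hinv) (fun A Y₁ Y₂ h => ?_)
    (fun i => (T.equivFin.symm i).1) ?_ (fun i => ⟨_, hmem i⟩) fun i => ?_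
  · refine Subtype.ext (point_injective ?_)
    rw [← toQuot_orbitPoint hinv Y₁, ← toQuot_orbitPoint hinv Y₂]
    exact congrArg (SuperAlg.toQuot _ _ ≫ ·) h
  · rw [← hspan]
    congr 1
    ext a
    constructor
    · rintro ⟨i, rfl⟩
      exact (T.equivFin.symm i).2
    · intro ha
      exact ⟨T.equivFin ⟨a, ha⟩, by simp⟩
  · refine SuperAlg.quot_hom_ext ((toQuot_orbitPoint hinv _).trans ?_)
    exact (point_lieMap _ Y).trans (congrArg (· ≫ _) hpt)
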